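/- Let $\mathbb S^1=\mathbb R/2\pi\mathbb Z$ with arc-length measure, $H=L^2(\mathbb S^1\times\mathbb S^1)$ (real-valued functions of $(x,t)$, product measure), let $2<p<\infty$, and let $q\in L^\infty(\mathbb S^1\times\mathbb S^1)$ be nonnegative. Consider the nonlinear wave equation $$-\partial_{xx}u+\partial_{tt}u=q(x,t)\,|u|^{p-2}u\qquad\text{on }\mathbb S^1\times\mathbb S^1. \tag{$*$}$$ Let $e_0=\frac1{\sqrt{2\pi}}$, $e_k(s)=\frac1{\sqrt\pi}\cos(ks)$ and $e_{-k}(s)=\frac1{\sqrt\pi}\sin(ks)$ for $k\ge1$, so that the functions $e_k(x)e_l(t)$, $k,l\in\mathbb Z$, form an orthonormal basis of $H$ of eigenfunctions of $-\partial_{xx}+\partial_{tt}$ with eigenvalues $\lambda_{kl}=k^2-l^2$. Write $u_{kl}=\int u\,e_k(x)e_l(t)\,d(x,t)$ and $$\langle u,v\rangle_+=\sum_{\lambda_{kl}>0}\lambda_{kl}u_{kl}v_{kl},\qquad \langle u,v\rangle_-=\sum_{\lambda_{kl}<0}|\lambda_{kl}|u_{kl}v_{kl}.$$ Let $E$ be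 the set of all $u\in H$ with $\langle u,u\rangle_+<\infty$, $\langle u,u\rangle_-<\infty$ and $\int q|u|^p\,d(x,t)<\infty$. A weak solution of $(*)$ is a function $u\in E$ such that $\langle u,v\rangle_+-\langle u,v\rangle_-=\int q|u|^{p-2}uv\,d(x,t)$ for all $v\in E$. A ground state solution is a weak solution $u\ne0$ that minimizes $$\Phi(u)=\tfrac12\bigl(\langle u,u\rangle_+-\langle u,u\rangle_-\bigr)-\tfrac1p\int q|u|^p\,d(x,t)$$ among all nonzero weak solutions of $(*)$. **Theorem.** Suppose that $\inf_\Omega q>0$ (essential infimum) for a subset $\Omega\subset\mathbb S^1\times\mathbb S^1$ that contains (the image in $\mathbb S^1\times\mathbb S^1$ of) a rectangle $[a_1,b_1]\times[a_2,b_2]$ with $a_1<b_1$, $a_2<b_2$ and $b_1+b_2-a_1-a_2>2\pi$. Then $(*)$ has a ground state solution. In particular, $(*)$ has a ground state solution if $\inf_\Omega q>0$ for $\Omega=\omega\times\mathbb S^1$ or $\Omega=\mathbb S^1\times\omega$ with some nonempty open set $\omega\subset\mathbb S^1$. -/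

import Mathlib

open MeasureTheory

noncomputable section

/-- The unit circle `𝕊¹`, of length `2π`, as the additive group `ℝ / 2πℤ`.  Its `volume` is the
one-dimensional Lebesgue (arc length) measure, of total mass `2π`. -/
abbrev WaveCircle : Type := AddCircle (2 * Real.pi)

instance waveCircle_fact : Fact (0 < 2 * Real.pi) := ⟨Real.two_pi_pos⟩

/-- The torus `𝕊¹ × 𝕊¹` of points `(x, t)`, with the product measure as `volume`. -/
abbrev WaveTorus : Type := WaveCircle × WaveCircle

/-- The real Hilbert space `H = L²(𝕊¹ × 𝕊¹)`. -/
abbrev WaveH : Type := Lp ℝ 2 (volume : Measure WaveTorus)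

/-- The `L²(𝕊¹)`-orthonormal basis of real eigenfunctions of `-Δ = -d²/dx²` on the circle:
`(2π)^{-1/2}` for `k = 0`, `π^{-1/2} cos(kx)` for `k > 0` and `π^{-1/2} sin(|k|x)` for `k < 0`
(see `circleMode_coe` and `circleMode_eigenfunction`).  The eigenvalue of index `k` is `k²`. -/
def circleMode (k : ℤ) (x : WaveCircle) : ℝ :=
  if k = 0 then (Real.sqrt (2 * Real.pi))⁻¹
  else if 0 < k then (Real.sqrt Real.pi)⁻¹ * (fourier k x).re
  else (Real.sqrt Real.pi)⁻¹ * (fourier (-k) x).im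

theorem fourier_coe_waveCircle (k : ℤ) (x : ℝ) :
    fourier k (x : WaveCircle) = Complex.exp (((k * x : ℝ) : ℂ) * Complex.I) := by
  rw [fourier_coe_apply]
  congr 1
  have h : (Real.pi : ℂ) ≠ 0 := by exact_mod_cast Real.pi_ne_zero
  push_cast
  field_simp

theorem circleMode_coe (k : ℤ) (x : ℝ) :
    circleMode k (x : WaveCircle) =
      if k = 0 then (Real.sqrt (2 * Real.pi))⁻¹
      else if 0 < k then (Real.sqrt Real.pi)⁻¹ * Real.cos (k * x)
      else (Real.sqrt Real.pi)⁻¹ * Real.sin (-k * x) := by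
  unfold circleMode
  rw [fourier_coe_waveCircle, fourier_coe_waveCircle, Complex.exp_ofReal_mul_I_re,
    Complex.exp_ofReal_mul_I_im]
  push_cast
  rfl

/-- `-(d²/dx²) e_k = k² e_k`. -/
theorem circleMode_eigenfunction (k : ℤ) (x : ℝ) :
    -deriv (deriv fun y : ℝ => circleMode k (y : WaveCircle)) x
      = (k : ℝ) ^ 2 * circleMode k (x : WaveCircle) := by
  have hc : ∀ a c : ℝ, deriv (fun y : ℝ => c * Real.cos (a * y)) =
      fun y => (-(a * c)) * Real.sin (a * y) := by
    intro a c
    funext y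
    have h := (((hasDerivAt_id y).const_mul a).cos.const_mul c).deriv
    simp only [id] at h
    rw [h]; ring
  have hs : ∀ a c : ℝ, deriv (fun y : ℝ => c * Real.sin (a * y)) =
      fun y => (a * c) * Real.cos (a * y) := by
    intro a c
    funext y
    have h := (((hasDerivAt_id y).const_mul a).sin.const_mul c).deriv
    simp only [id] at h
    rw [h]; ring
  simp only [circleMode_coe]
  by_cases h0 : k = 0
  · simp [h0]
  · by_cases h1 : 0 < k
    · simp only [h0, h1, if_true, if_false, hc, hs]; ring
    · simp only [h0, h1, if_false, hc, hs]; ring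

/-- The orthonormal basis `e_k(x) e_l(t)`, `k, l ∈ ℤ`, of `H` consisting of eigenfunctions of the
wave operator `L = -Δ + ∂ₜₜ = -∂ₓₓ + ∂ₜₜ`. -/
def waveMode (m : ℤ × ℤ) (z : WaveTorus) : ℝ := circleMode m.1 z.1 * circleMode m.2 z.2

/-- The eigenvalue `k² - l²` of `L` belonging to `e_k(x) e_l(t)`. -/
def waveEigenvalue (m : ℤ × ℤ) : ℝ := (m.1 : ℝ) ^ 2 - (m.2 : ℝ) ^ 2

/-- The coefficient `⟨u, e_k ⊗ e_l⟩_H` of `u` in the eigenbasis. -/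
def waveCoeff (u : WaveH) (m : ℤ × ℤ) : ℝ := ∫ z, u z * waveMode m z

/-- The scalar product `⟨P⁺u, P⁺v⟩₊ = ∫_{(0,∞)} λ d⟨E(λ)u, v⟩`, where `E` is the spectral resolution
of the self-adjoint operator `L`, which is diagonal in the basis `waveMode`. -/
def wavePosForm (u v : WaveH) : ℝ :=
  ∑' m : {m : ℤ × ℤ // 0 < waveEigenvalue m},
    waveEigenvalue m.1 * (waveCoeff u m.1 * waveCoeff v m.1)

/-- The scalar product `⟨P⁻u, P⁻v⟩₋ = ∫_{(-∞,0)} |λ| d⟨E(λ)u, v⟩`. -/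
def waveNegForm (u v : WaveH) : ℝ :=
  ∑' m : {m : ℤ × ℤ // waveEigenvalue m < 0},
    |waveEigenvalue m.1| * (waveCoeff u m.1 * waveCoeff v m.1)

/-- The energy space
`E = {u ∈ H : ‖P⁺u‖₊ < ∞, ‖P⁻u‖₋ < ∞ and ∫ q |u|^p < ∞}`. -/
def waveE (p : ℝ) (q : WaveTorus → ℝ) : Set WaveH :=
  {u | Summable (fun m : {m : ℤ × ℤ // 0 < waveEigenvalue m} =>
          waveEigenvalue m.1 * waveCoeff u m.1 ^ 2) ∧
       Summable (fun m : {m : ℤ × ℤ // waveEigenvalue m < 0} =>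
          |waveEigenvalue m.1| * waveCoeff u m.1 ^ 2) ∧
       Integrable (fun z => q z * |u z| ^ p)}

/-- `u ∈ E` is a weak solution of `-Δu + ∂ₜₜu = q(x,t) |u|^{p-2} u` on `𝕊¹ × 𝕊¹`. -/
def IsWaveWeakSolution (p : ℝ) (q : WaveTorus → ℝ) (u : WaveH) : Prop :=
  u ∈ waveE p q ∧ ∀ v ∈ waveE p q,
    wavePosForm u v - waveNegForm u v = ∫ z, q z * (|u z| ^ (p - 2) * u z * v z)

/-- The energy functional
`Φ(u) = ½ (‖P⁺u‖₊² - ‖P⁻u‖₋²) - (1/p) ∫ q |u|^p`. -/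
def waveEnergy (p : ℝ) (q : WaveTorus → ℝ) (u : WaveH) : ℝ :=
  1 / 2 * (wavePosForm u u - waveNegForm u u) - 1 / p * ∫ z, q z * |u z| ^ p

/-- A ground state solution: a minimizer of `Φ` among the nontrivial weak solutions. -/
def IsWaveGroundState (p : ℝ) (q : WaveTorus → ℝ) (u : WaveH) : Prop :=
  IsWaveWeakSolution p q u ∧ u ≠ 0 ∧
    ∀ v : WaveH, IsWaveWeakSolution p q v → v ≠ 0 → waveEnergy p q u ≤ waveEnergy p q v

/-- `inf_Ω q > 0`, for the element of `L^∞` represented by `q`. -/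
def HasPositiveInfOn (q : WaveTorus → ℝ) (Ω : Set WaveTorus) : Prop :=
  ∃ c : ℝ, 0 < c ∧ ∀ᵐ z : WaveTorus, z ∈ Ω → c ≤ q z

/-- `Ω` contains (the image in the torus of) a rectangle `[a₁,b₁] × [a₂,b₂]` with
`b₁ + b₂ - a₁ - a₂ > 2π`. -/
def ContainsLargeRectangle (Ω : Set WaveTorus) : Prop :=
  ∃ a₁ b₁ a₂ b₂ : ℝ, a₁ < b₁ ∧ a₂ < b₂ ∧ 2 * Real.pi < b₁ + b₂ - a₁ - a₂ ∧
    ∀ x ∈ Set.Icc a₁ b₁, ∀ t ∈ Set.Icc a₂ b₂, ((x : WaveCircle), (t : WaveCircle)) ∈ Ω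

end

/-! ### Fourier analysis on the circle -/

noncomputable section

/-! The problem is dualized. Write L for the wave operator, ν for the measure with density q, and
e_m for the modes. The energy is strongly indefinite and ker L is infinite dimensional, so the
unknown becomes the functional φ = ∫ |u|^{p-2} u · dν on L^p(ν). The quadratic form ⟨L⁻¹φ, φ⟩
(`dualForm`) is maximized over the functionals in the unit ball that annihilate the part of ker L
lying in L^p(ν).

Compactness: the ball is weak-* compact, so a maximizer exists once the form is weak-* continuous
there (`continuousOn_dualForm`). This is a uniform tail estimate. The eigenvalue factors as
(k+l)(k-l), and a dyadic block in these two factors with |λ| ≥ X contains O(X) modes. Duality and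
interpolation between L² and L^∞ bound the sum of φ(e_m)² over such a block by O(X^{1-2/p})
(`block_rpow_le`), so Σ |λ|⁻¹ φ(e_m)² converges with room to spare.

Observability: elements of ker L are sums F(x+t) + G(x-t), and their L² norm is controlled by an
open set that meets every diagonal and antidiagonal line (`exists_lintegral_le_of_meets`). A
rectangle whose side lengths add up to more than 2π is such a set. Hence the kernel part of L^p(ν)
is closed, and a nonzero solution cannot vanish ν-almost everywhere.

Euler-Lagrange equation: let μ be the maximum, φ a maximizer and g = L⁻¹φ. By the first-order
condition φ also maximizes the linear functional ψ ↦ ψ(g) over the admissible set, with value μ. By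
Hahn-Banach in the quotient by the closed kernel part, μ is the distance from g to it. Uniform
convexity of L^p provides a nearest point y; then φ norms z = g - y, and differentiating the norm
gives μ^{p-1} φ = |z|^{p-2} z (`exists_of_dualForm_maximizer`). A multiple of z represents a weak
solution.

Minimality: a nonzero weak solution v yields an admissible functional of norm at most ‖v‖^{p-1} with
dual form ‖v‖^p, whence 1 ≤ μ‖v‖^{p-2}. The energy of v is (1/2 - 1/p)‖v‖^p, and the constructed
solution attains the lower bound. Positivity of the maximum comes from an explicit bump ζ supported
where q is bounded below, through the functional with density Lζ (`exists_dualForm_pos`). -/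

theorem integral_fourier_waveCircle (n : ℤ) :
    ∫ x : WaveCircle, fourier n x = if n = 0 then ((2 * Real.pi : ℝ) : ℂ) else 0 := by
  have h := congrFun (fourierCoeff_fourier (T := 2 * Real.pi) n) 0
  rw [fourierCoeff, AddCircle.integral_haarAddCircle] at h
  simp only [neg_zero, fourier_zero, one_smul, Pi.single_apply] at h
  have h2 : (2 * Real.pi : ℝ) ≠ 0 := Real.two_pi_pos.ne'
  have h3 : (∫ x : WaveCircle, fourier n x) =
      (2 * Real.pi : ℝ) • ((2 * Real.pi : ℝ)⁻¹ • ∫ x : WaveCircle, fourier n x) := by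
    rw [smul_smul, mul_inv_cancel₀ h2, one_smul]
  rw [h3, h]
  by_cases hn : n = 0
  · subst hn; simp
  · rw [if_neg (Ne.symm hn), if_neg hn, smul_zero]

theorem integrable_fourier_waveCircle (n : ℤ) :
    Integrable (fun x : WaveCircle => (fourier n x : ℂ)) :=
  (fourier n).continuous.integrable_of_hasCompactSupport (HasCompactSupport.of_compactSpace _)

theorem integral_fourier_re (n : ℤ) :
    ∫ x : WaveCircle, (fourier n x).re = if n = 0 then 2 * Real.pi else 0 := by
  have h := integral_re (integrable_fourier_waveCircle n)
  refine h.trans ?_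
  rw [integral_fourier_waveCircle]
  split_ifs <;> simp

theorem integral_fourier_im (n : ℤ) : ∫ x : WaveCircle, (fourier n x).im = 0 := by
  have h := integral_im (integrable_fourier_waveCircle n)
  refine h.trans ?_
  rw [integral_fourier_waveCircle]
  split_ifs <;> simp

theorem fourier_re_mul_re (j k : ℤ) (x : WaveCircle) :
    (fourier j x).re * (fourier k x).re =
      ((fourier (j + k) x).re + (fourier (j - k) x).re) / 2 := by
  rw [sub_eq_add_neg j k, fourier_add (m := j) (n := k), fourier_add (m := j) (n := -k),
    fourier_neg, Complex.mul_re, Complex.mul_re, Complex.conj_re, Complex.conj_im]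
  ring

theorem fourier_im_mul_im (j k : ℤ) (x : WaveCircle) :
    (fourier j x).im * (fourier k x).im =
      ((fourier (j - k) x).re - (fourier (j + k) x).re) / 2 := by
  rw [sub_eq_add_neg j k, fourier_add (m := j) (n := k), fourier_add (m := j) (n := -k),
    fourier_neg, Complex.mul_re, Complex.mul_re, Complex.conj_re, Complex.conj_im]
  ring

theorem fourier_re_mul_im (j k : ℤ) (x : WaveCircle) :
    (fourier j x).re * (fourier k x).im =
      ((fourier (j + k) x).im - (fourier (j - k) x).im) / 2 := by
  rw [sub_eq_add_neg j k, fourier_add (m := j) (n := k), fourier_add (m := j) (n := -k),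
    fourier_neg, Complex.mul_im, Complex.mul_im, Complex.conj_re, Complex.conj_im]
  ring

theorem integrable_of_continuous_waveCircle {f : WaveCircle → ℝ} (hf : Continuous f) :
    Integrable f :=
  hf.integrable_of_hasCompactSupport (HasCompactSupport.of_compactSpace _)

theorem integral_re_mul_re (j k : ℤ) :
    ∫ x : WaveCircle, (fourier j x).re * (fourier k x).re =
      ((if j + k = 0 then 2 * Real.pi else 0) + (if j - k = 0 then 2 * Real.pi else 0)) / 2 := by
  simp_rw [fourier_re_mul_re]
  rw [integral_div, integral_add, integral_fourier_re, integral_fourier_re] <;>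
  exact integrable_of_continuous_waveCircle (by fun_prop)

theorem integral_im_mul_im (j k : ℤ) :
    ∫ x : WaveCircle, (fourier j x).im * (fourier k x).im =
      ((if j - k = 0 then 2 * Real.pi else 0) - (if j + k = 0 then 2 * Real.pi else 0)) / 2 := by
  simp_rw [fourier_im_mul_im]
  rw [integral_div, integral_sub, integral_fourier_re, integral_fourier_re] <;>
  exact integrable_of_continuous_waveCircle (by fun_prop)

theorem integral_re_mul_im (j k : ℤ) :
    ∫ x : WaveCircle, (fourier j x).re * (fourier k x).im = 0 := by
  simp_rw [fourier_re_mul_im]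
  rw [integral_div, integral_sub, integral_fourier_im, integral_fourier_im]
  · simp
  all_goals exact integrable_of_continuous_waveCircle (by fun_prop)

@[fun_prop]
theorem continuous_circleMode (k : ℤ) : Continuous (circleMode k) := by
  unfold circleMode
  split_ifs <;> fun_prop

theorem integral_circleMode_mul (j k : ℤ) :
    ∫ x, circleMode j x * circleMode k x = if j = k then 1 else 0 := by
  have hpi := Real.pi_pos
  have hs : (Real.sqrt Real.pi)⁻¹ * (Real.sqrt Real.pi)⁻¹ * Real.pi = 1 := by
    rw [← mul_inv, Real.mul_self_sqrt hpi.le, inv_mul_cancel₀ hpi.ne']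
  have hs2 : (Real.sqrt (2 * Real.pi))⁻¹ * (Real.sqrt (2 * Real.pi))⁻¹ * (2 * Real.pi) = 1 := by
    rw [← mul_inv, Real.mul_self_sqrt (by positivity), inv_mul_cancel₀ (by positivity)]
  have hvol : (volume : Measure WaveCircle).real Set.univ = 2 * Real.pi := by
    rw [Measure.real, AddCircle.measure_univ, ENNReal.toReal_ofReal (by positivity)]
  unfold circleMode
  rcases lt_trichotomy j 0 with hj | hj | hj <;> rcases lt_trichotomy k 0 with hk | hk | hk
  · simp only [hj.ne, hk.ne, hj.not_gt, hk.not_gt, if_false, mul_mul_mul_comm,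
      integral_const_mul, integral_im_mul_im]
    rw [if_neg (show -j + -k ≠ 0 by lia)]
    by_cases h : j = k
    · subst h; simp; linarith
    · rw [if_neg (show -j - -k ≠ 0 by lia), if_neg h]; simp
  · subst hk
    simp only [hj.ne, hj.not_gt, if_true, if_false, integral_mul_const, integral_const_mul,
      integral_fourier_im, mul_zero, zero_mul]
  · simp only [hj.ne, hk.ne', hj.not_gt, hk, if_false, if_true, mul_mul_mul_comm,
      integral_const_mul]
    simp_rw [mul_comm (fourier (-j) _ : ℂ).im]
    rw [integral_re_mul_im, if_neg (by lia)]; simp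
  · subst hj
    simp only [hk.ne, hk.ne', hk.not_gt, if_true, if_false, integral_const_mul,
      integral_fourier_im, mul_zero]
  · subst hj; subst hk
    simp only [if_true, integral_const, hvol, smul_eq_mul]
    linarith
  · subst hj
    simp only [hk.ne, hk.ne', hk, if_true, if_false, integral_const_mul,
      integral_fourier_re, mul_zero]
  · simp only [hk.ne, hj.ne', hk.not_gt, hj, if_false, if_true, mul_mul_mul_comm,
      integral_const_mul]
    rw [integral_re_mul_im, if_neg (by lia)]; simp
  · subst hk
    simp only [hj.ne', hj, if_true, if_false, integral_mul_const, integral_const_mul,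
      integral_fourier_re, mul_zero, zero_mul]
  · simp only [hj.ne', hk.ne', hj, hk, if_false, if_true, mul_mul_mul_comm,
      integral_const_mul, integral_re_mul_re]
    rw [if_neg (show j + k ≠ 0 by lia)]
    by_cases h : j = k
    · subst h; simp; linarith
    · rw [if_neg (show j - k ≠ 0 by lia), if_neg h]; simp

theorem norm_fourier_waveCircle (n : ℤ) (x : WaveCircle) : ‖(fourier n x : ℂ)‖ = 1 := by
  rw [fourier_apply]; exact Circle.norm_coe _

theorem abs_circleMode_le_one (k : ℤ) (x : WaveCircle) : |circleMode k x| ≤ 1 := by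
  have hn : ∀ n : ℤ, ‖(fourier n x : ℂ)‖ = 1 := fun n => norm_fourier_waveCircle n x
  have h1 : 1 ≤ Real.sqrt Real.pi := Real.one_le_sqrt.2 (by linarith [Real.pi_gt_three])
  have h2 : 1 ≤ Real.sqrt (2 * Real.pi) := Real.one_le_sqrt.2 (by linarith [Real.pi_gt_three])
  unfold circleMode
  split_ifs
  · rw [abs_of_nonneg (by positivity)]; exact inv_le_one_of_one_le₀ h2
  · rw [abs_mul, abs_of_nonneg (by positivity)]
    exact mul_le_one₀ (inv_le_one_of_one_le₀ h1) (abs_nonneg _)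
      ((Complex.abs_re_le_norm _).trans (hn _).le)
  · rw [abs_mul, abs_of_nonneg (by positivity)]
    exact mul_le_one₀ (inv_le_one_of_one_le₀ h1) (abs_nonneg _)
      ((Complex.abs_im_le_norm _).trans (hn _).le)

/-- A square integrable function on the circle without Fourier coefficients vanishes. -/
theorem ae_eq_zero_of_integral_mul_circleMode_eq_zero {h : WaveCircle → ℝ} (hh : MemLp h 2)
    (h0 : ∀ k, ∫ x, h x * circleMode k x = 0) : h =ᵐ[volume] 0 := by
  have hpi := Real.pi_pos
  have hp1 : (Real.sqrt Real.pi) ≠ 0 := (Real.sqrt_pos.2 hpi).ne'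
  have hp2 : (Real.sqrt (2 * Real.pi)) ≠ 0 := (Real.sqrt_pos.2 (by positivity)).ne'
  have hint : Integrable h := hh.integrable (by norm_num)
  have hpos : ∀ n : ℤ, 0 < n → ∫ x, h x * (fourier n x : ℂ).re = 0 := by
    intro n hn
    have := h0 n
    simp only [circleMode, hn.ne', hn, if_false, if_true] at this
    have h2 : ∀ a b c : ℝ, a * (b * c) = b * (a * c) := mul_left_comm
    simp only [h2 (h _)] at this
    rw [integral_const_mul] at this
    exact (mul_eq_zero.1 this).resolve_left (inv_ne_zero hp1)
  have hneg : ∀ n : ℤ, 0 < n → ∫ x, h x * (fourier n x : ℂ).im = 0 := by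
    intro n hn
    have := h0 (-n)
    have h1 : ¬ (0 < -n) := by lia
    simp only [circleMode, neg_eq_zero, hn.ne', h1, if_false, neg_neg] at this
    have h2 : ∀ a b c : ℝ, a * (b * c) = b * (a * c) := mul_left_comm
    simp only [h2 (h _)] at this
    rw [integral_const_mul] at this
    exact (mul_eq_zero.1 this).resolve_left (inv_ne_zero hp1)
  have hre : ∀ n : ℤ, ∫ x, h x * (fourier n x : ℂ).re = 0 := by
    intro n
    rcases lt_trichotomy n 0 with hn | hn | hn
    · have := hpos (-n) (by lia)
      simpa only [fourier_neg, Complex.conj_re] using this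
    · subst hn
      have := h0 0
      simp only [circleMode, if_true] at this
      rw [integral_mul_const] at this
      have h1 := (mul_eq_zero.1 this).resolve_right (inv_ne_zero hp2)
      simpa using h1
    · exact hpos n hn
  have him : ∀ n : ℤ, ∫ x, h x * (fourier n x : ℂ).im = 0 := by
    intro n
    rcases lt_trichotomy n 0 with hn | hn | hn
    · have := hneg (-n) (by lia)
      simpa only [fourier_neg, Complex.conj_im, mul_neg, integral_neg, neg_eq_zero] using this
    · subst hn; simp
    · exact hneg n hn
  have hcint : ∀ n : ℤ, Integrable (fun x => (fourier n x : ℂ) • ((h x : ℝ) : ℂ)) := by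
    intro n
    refine Integrable.bdd_mul (c := 1) hint.ofReal (by fun_prop) (Filter.Eventually.of_forall ?_)
    intro x; exact (norm_fourier_waveCircle n x).le
  have hc : ∀ n : ℤ, fourierCoeff (fun x : WaveCircle => ((h x : ℝ) : ℂ)) n = 0 := by
    intro n
    rw [fourierCoeff, AddCircle.integral_haarAddCircle]
    have hz : ∫ x : WaveCircle, (fourier (-n) x : ℂ) • ((h x : ℝ) : ℂ) = 0 := by
      apply Complex.ext
      · have := integral_re (hcint (-n))
        refine this.symm.trans ?_
        rw [Complex.zero_re]
        refine Eq.trans (integral_congr_ae (Filter.Eventually.of_forall fun x => ?_)) (hre (-n))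
        simp [mul_comm, -fourier_apply]
      · have := integral_im (hcint (-n))
        refine this.symm.trans ?_
        rw [Complex.zero_im]
        refine Eq.trans (integral_congr_ae (Filter.Eventually.of_forall fun x => ?_)) (him (-n))
        simp [mul_comm, -fourier_apply]
    rw [hz, smul_zero]
  have hm : MemLp (fun x : WaveCircle => ((h x : ℝ) : ℂ)) 2 AddCircle.haarAddCircle :=
    (memLp_haarAddCircle_iff).2 hh.ofReal
  have hz : hm.toLp = 0 := by
    apply fourierBasis.repr.injective
    rw [map_zero]
    ext n
    rw [fourierBasis_repr, fourierCoeff_congr_ae hm.coeFn_toLp, hc]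
    rfl
  have h1 : (fun x : WaveCircle => ((h x : ℝ) : ℂ)) =ᵐ[AddCircle.haarAddCircle] 0 := by
    refine hm.coeFn_toLp.symm.trans ?_
    rw [hz]; exact Lp.coeFn_zero _ _ _
  rw [AddCircle.volume_eq_smul_haarAddCircle]
  refine Measure.ae_smul_measure ?_ _
  filter_upwards [h1] with x hx
  simpa using hx

/-! ### The eigenbasis of the torus and expansions in it -/

@[fun_prop]
theorem continuous_waveMode (m : ℤ × ℤ) : Continuous (waveMode m) := by
  unfold waveMode; fun_prop

theorem abs_waveMode_le_one (m : ℤ × ℤ) (z : WaveTorus) : |waveMode m z| ≤ 1 := by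
  rw [waveMode, abs_mul]
  exact mul_le_one₀ (abs_circleMode_le_one _ _) (abs_nonneg _) (abs_circleMode_le_one _ _)

theorem memLp_waveMode (m : ℤ × ℤ) (r : ENNReal) (μ : Measure WaveTorus) [IsFiniteMeasure μ] :
    MemLp (waveMode m) r μ :=
  MemLp.of_bound (continuous_waveMode m).aestronglyMeasurable 1
    (Filter.Eventually.of_forall fun z => abs_waveMode_le_one m z)

/-- The function `e_k ⊗ e_l` as an element of `H`. -/
def waveModeH (m : ℤ × ℤ) : WaveH := (memLp_waveMode m 2 volume).toLp

theorem coeFn_waveModeH (m : ℤ × ℤ) : waveModeH m =ᵐ[volume] waveMode m :=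
  MemLp.coeFn_toLp _

theorem inner_waveH (u v : WaveH) : inner ℝ u v = ∫ z, u z * v z := by
  rw [L2.inner_def]
  refine integral_congr_ae (Filter.Eventually.of_forall fun z => ?_)
  simp [mul_comm]

theorem inner_waveModeH (m : ℤ × ℤ) (u : WaveH) : inner ℝ (waveModeH m) u = waveCoeff u m := by
  rw [inner_waveH, waveCoeff]
  refine integral_congr_ae ?_
  filter_upwards [coeFn_waveModeH m] with z hz
  rw [hz, mul_comm]

theorem waveCoeff_waveModeH (m n : ℤ × ℤ) :
    waveCoeff (waveModeH m) n = if n = m then 1 else 0 := by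
  have h : waveCoeff (waveModeH m) n = ∫ z, waveMode m z * waveMode n z := by
    rw [waveCoeff]
    refine integral_congr_ae ?_
    filter_upwards [coeFn_waveModeH m] with z hz
    rw [hz]
  rw [h]
  simp only [waveMode, mul_mul_mul_comm]
  rw [Measure.volume_eq_prod, integral_prod_mul (fun x => circleMode m.1 x * circleMode n.1 x)
    (fun t => circleMode m.2 t * circleMode n.2 t), integral_circleMode_mul,
    integral_circleMode_mul]
  by_cases h1 : m.1 = n.1 <;> by_cases h2 : m.2 = n.2 <;> simp [h1, h2, Prod.ext_iff, eq_comm]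

theorem orthonormal_waveModeH : Orthonormal ℝ waveModeH := by
  rw [orthonormal_iff_ite]
  intro m n
  rw [inner_waveModeH, waveCoeff_waveModeH]

/-- Completeness is reduced to the circle twice by Fubini: for each l the partial coefficient x ↦ ∫
u(x,t) e_l(t) dt has no Fourier coefficients, so it vanishes; hence almost every slice u(x,·) has
none either. -/
theorem eq_zero_of_waveCoeff_eq_zero {u : WaveH} (h0 : ∀ m, waveCoeff u m = 0) : u = 0 := by
  have hm : MemLp u 2 ((volume : Measure WaveCircle).prod (volume : Measure WaveCircle)) :=
    Lp.memLp u
  have hu : Measurable u := (Lp.stronglyMeasurable u).measurable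
  have hsq := hm.integrable_sq
  have hint := hm.integrable (by norm_num)
  have hbd : ∀ l : ℤ, Integrable (fun z : WaveCircle × WaveCircle => u z * circleMode l z.2)
      (volume.prod volume) := by
    intro l
    refine hint.mul_bdd (c := 1) (by fun_prop) (Filter.Eventually.of_forall fun z => ?_)
    exact abs_circleMode_le_one l z.2
  have hslice : ∀ᵐ x : WaveCircle, MemLp (fun t => u (x, t)) 2 := by
    filter_upwards [hsq.prod_right_ae] with x hx
    exact (memLp_two_iff_integrable_sq
      (hu.comp measurable_prodMk_left).aestronglyMeasurable).2 hx
  have hcs : ∀ l : ℤ, ∀ᵐ x : WaveCircle,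
      (∫ t, u (x, t) * circleMode l t) ^ 2 ≤ ∫ t, u (x, t) ^ 2 := by
    intro l
    filter_upwards [hslice] with x hx
    set c := ∫ t, u (x, t) * circleMode l t with hc
    have hi1 : Integrable (fun t => u (x, t) ^ 2) := hx.integrable_sq
    have hi2 : Integrable (fun t => u (x, t) * circleMode l t) := by
      refine (hx.integrable (by norm_num)).mul_bdd (c := 1) (by fun_prop)
        (Filter.Eventually.of_forall fun z => ?_)
      exact abs_circleMode_le_one l z
    have hi3 : Integrable (fun t => circleMode l t * circleMode l t) :=
      integrable_of_continuous_waveCircle (by fun_prop)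
    -- Bessel's inequality for a single unit vector, from the square of the residual. It makes the
    -- partial coefficient square integrable in x.
    have h1 : 0 ≤ ∫ t, (u (x, t) - c * circleMode l t) ^ 2 :=
      integral_nonneg fun t => sq_nonneg _
    have h2 : ∀ t, (u (x, t) - c * circleMode l t) ^ 2 = u (x, t) ^ 2
        - 2 * c * (u (x, t) * circleMode l t) + c ^ 2 * (circleMode l t * circleMode l t) := by
      intro t; ring
    have hi4 : Integrable (fun t => u (x, t) ^ 2 - 2 * c * (u (x, t) * circleMode l t)) :=
      hi1.sub (hi2.const_mul _)
    simp_rw [h2] at h1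
    rw [integral_add hi4 (hi3.const_mul _),
      integral_sub hi1 (hi2.const_mul _), integral_const_mul, integral_const_mul,
      integral_circleMode_mul, if_pos rfl, ← hc] at h1
    nlinarith
  have hl : ∀ l : ℤ, (fun x : WaveCircle => ∫ t, u (x, t) * circleMode l t) =ᵐ[volume] 0 := by
    intro l
    have hme : AEStronglyMeasurable (fun x : WaveCircle => ∫ t, u (x, t) * circleMode l t) volume :=
      (hbd l).aestronglyMeasurable.integral_prod_right'
    apply ae_eq_zero_of_integral_mul_circleMode_eq_zero
    · rw [memLp_two_iff_integrable_sq hme]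
      refine Integrable.mono' hsq.integral_prod_left (hme.pow 2) ?_
      filter_upwards [hcs l] with x hx
      rw [Real.norm_of_nonneg (sq_nonneg _)]
      exact hx
    · intro k
      have h1 : ∫ z : WaveCircle × WaveCircle, u z * waveMode (k, l) z ∂(volume.prod volume) = 0 :=
        h0 (k, l)
      have h2 : Integrable (fun z : WaveCircle × WaveCircle => u z * waveMode (k, l) z)
          (volume.prod volume) := by
        refine hint.mul_bdd (c := 1) (by fun_prop) (Filter.Eventually.of_forall fun z => ?_)
        exact abs_waveMode_le_one _ z
      rw [integral_prod _ h2] at h1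
      rw [← h1]
      refine integral_congr_ae (Filter.Eventually.of_forall fun x => ?_)
      simp only [waveMode]
      rw [← integral_mul_const]
      refine integral_congr_ae (Filter.Eventually.of_forall fun t => ?_)
      simp only; ring
  have hz : ∀ᵐ x : WaveCircle, ∀ᵐ t : WaveCircle, u (x, t) = 0 := by
    filter_upwards [ae_all_iff.2 hl, hslice] with x hx hx2
    filter_upwards [ae_eq_zero_of_integral_mul_circleMode_eq_zero hx2 hx] with t ht
    exact ht
  apply Lp.ext
  refine Filter.EventuallyEq.trans ?_ (Lp.coeFn_zero _ _ _).symm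
  have hms : MeasurableSet {z : WaveCircle × WaveCircle | u z = 0} :=
    hu (measurableSet_singleton 0)
  exact (Measure.ae_prod_iff_ae_ae hms).2 hz

/-- The Hilbert basis `e_k ⊗ e_l` of `H`. -/
def waveBasis : HilbertBasis (ℤ × ℤ) ℝ WaveH :=
  HilbertBasis.mkOfOrthogonalEqBot orthonormal_waveModeH (by
    rw [Submodule.eq_bot_iff]
    intro u hu
    apply eq_zero_of_waveCoeff_eq_zero
    intro m
    rw [← inner_waveModeH]
    exact hu _ (Submodule.subset_span ⟨m, rfl⟩))

theorem waveBasis_apply (m : ℤ × ℤ) : waveBasis m = waveModeH m := by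
  rw [waveBasis, HilbertBasis.coe_mkOfOrthogonalEqBot]

theorem waveBasis_repr (u : WaveH) (m : ℤ × ℤ) : waveBasis.repr u m = waveCoeff u m := by
  rw [HilbertBasis.repr_apply_apply, waveBasis_apply, inner_waveModeH]

theorem hasSum_waveCoeff_smul (u : WaveH) : HasSum (fun m => waveCoeff u m • waveModeH m) u := by
  simpa only [waveBasis_repr, waveBasis_apply] using waveBasis.hasSum_repr u

theorem hasSum_waveCoeff_mul (u v : WaveH) :
    HasSum (fun m => waveCoeff u m * waveCoeff v m) (∫ z, u z * v z) := by
  have h := waveBasis.hasSum_inner_mul_inner u v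
  rw [inner_waveH] at h
  refine h.congr_fun fun m => ?_
  rw [real_inner_comm, waveBasis_apply, inner_waveModeH, inner_waveModeH]

theorem exists_waveCoeff_eq {c : ℤ × ℤ → ℝ} (hc : Summable fun m => c m ^ 2) :
    ∃ u : WaveH, (∀ m, waveCoeff u m = c m) ∧ HasSum (fun m => c m • waveModeH m) u := by
  have hm : Memℓp c 2 := by
    apply memℓp_gen
    simpa using hc
  refine ⟨waveBasis.repr.symm ⟨c, hm⟩, ?_⟩
  have h1 : ∀ m, waveCoeff (waveBasis.repr.symm ⟨c, hm⟩) m = c m := by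
    intro m
    rw [← waveBasis_repr, LinearIsometryEquiv.apply_symm_apply]
  refine ⟨h1, ?_⟩
  have h2 := hasSum_waveCoeff_smul (waveBasis.repr.symm ⟨c, hm⟩)
  simpa only [h1] using h2

theorem waveCoeff_add (u v : WaveH) (m : ℤ × ℤ) :
    waveCoeff (u + v) m = waveCoeff u m + waveCoeff v m := by
  simp only [← inner_waveModeH, inner_add_right]

theorem waveCoeff_sub (u v : WaveH) (m : ℤ × ℤ) :
    waveCoeff (u - v) m = waveCoeff u m - waveCoeff v m := by
  simp only [← inner_waveModeH, inner_sub_right]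

theorem waveCoeff_smul (a : ℝ) (u : WaveH) (m : ℤ × ℤ) :
    waveCoeff (a • u) m = a * waveCoeff u m := by
  simp only [← inner_waveModeH, inner_smul_right]

theorem waveCoeff_zero (m : ℤ × ℤ) : waveCoeff 0 m = 0 := by
  simp only [← inner_waveModeH, inner_zero_right]

/-! ### The kernel of the wave operator and travelling waves -/

/-- The diagonal direction `s ↦ (s, s)`. -/
def diagDir : WaveCircle →+ WaveTorus := (AddMonoidHom.id _).prod (AddMonoidHom.id _)

/-- The antidiagonal direction `r ↦ (r, -r)`. -/
def antiDir : WaveCircle →+ WaveTorus := (AddMonoidHom.id _).prod (-AddMonoidHom.id _)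

theorem diagDir_apply (s : WaveCircle) : diagDir s = (s, s) := rfl

theorem antiDir_apply (s : WaveCircle) : antiDir s = (s, -s) := rfl

theorem measurePreserving_translate (a : WaveTorus) :
    MeasurePreserving (fun z : WaveTorus => z + a) volume volume := by
  have : (volume : Measure WaveTorus).IsAddRightInvariant := by
    rw [Measure.volume_eq_prod]; infer_instance
  exact measurePreserving_add_right volume a

/-- Translation by `a` on `H`. -/
def translateH (a : WaveTorus) : WaveH →L[ℝ] WaveH :=
  (Lp.compMeasurePreservingₗᵢ ℝ (fun z : WaveTorus => z + a)
    (measurePreserving_translate a)).toContinuousLinearMap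

theorem coeFn_translateH (a : WaveTorus) (u : WaveH) :
    translateH a u =ᵐ[volume] fun z => u (z + a) :=
  Lp.coeFn_compMeasurePreserving u (measurePreserving_translate a)

theorem fourier_apply_add (k : ℤ) (x t : WaveCircle) :
    (fourier k (x + t) : ℂ) = fourier k x * fourier k t := by
  simp [fourier_apply, smul_add, AddCircle.toCircle_add]

theorem fourier_apply_sub (k : ℤ) (x t : WaveCircle) :
    (fourier k (x - t) : ℂ) = fourier k x * (starRingEnd ℂ) (fourier k t) := by
  rw [sub_eq_add_neg, fourier_apply_add, ← fourier_neg, fourier_apply, fourier_apply, fourier_apply]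
  simp

/-- A mode with vanishing eigenvalue is a sum of two travelling waves. -/
theorem waveMode_eq_travelling {m : ℤ × ℤ} (hm : waveEigenvalue m = 0) :
    ∃ F G : WaveCircle → ℝ, ∀ z : WaveTorus, waveMode m z = F (z.1 + z.2) + G (z.1 - z.2) := by
  obtain ⟨k, l⟩ := m
  have hkl : (k : ℝ) ^ 2 = (l : ℝ) ^ 2 := sub_eq_zero.1 hm
  have hkl' : l = k ∨ l = -k := sq_eq_sq_iff_eq_or_eq_neg.1 (by exact_mod_cast hkl.symm)
  set c := (Real.sqrt Real.pi)⁻¹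
  rcases lt_trichotomy k 0 with hk | hk | hk
  · rcases hkl' with rfl | rfl
    · refine ⟨fun y => -(c ^ 2 / 2 * (fourier (-l) y : ℂ).re),
        fun y => c ^ 2 / 2 * (fourier (-l) y : ℂ).re, fun z => ?_⟩
      simp only [waveMode, circleMode, hk.ne, hk.not_gt, if_false, fourier_apply_add,
        fourier_apply_sub, Complex.mul_re, Complex.conj_re, Complex.conj_im]
      ring
    · refine ⟨fun y => c ^ 2 / 2 * (fourier (-k) y : ℂ).im,
        fun y => c ^ 2 / 2 * (fourier (-k) y : ℂ).im, fun z => ?_⟩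
      simp only [waveMode, circleMode, hk.ne, hk.not_gt, if_false, fourier_apply_add,
        fourier_apply_sub, Complex.mul_im, Complex.conj_re, Complex.conj_im, neg_eq_zero,
        Left.neg_pos_iff, hk, if_true]
      ring
  · subst hk
    have hl : l = 0 := by simpa using hkl'
    subst hl
    refine ⟨fun _ => circleMode 0 0 * circleMode 0 0, fun _ => 0, fun z => ?_⟩
    simp [waveMode, circleMode]
  · rcases hkl' with rfl | rfl
    · refine ⟨fun y => c ^ 2 / 2 * (fourier l y : ℂ).re,
        fun y => c ^ 2 / 2 * (fourier l y : ℂ).re, fun z => ?_⟩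
      simp only [waveMode, circleMode, hk.ne', hk, if_false, if_true, fourier_apply_add,
        fourier_apply_sub, Complex.mul_re, Complex.conj_re, Complex.conj_im]
      ring
    · refine ⟨fun y => c ^ 2 / 2 * (fourier k y : ℂ).im,
        fun y => -(c ^ 2 / 2 * (fourier k y : ℂ).im), fun z => ?_⟩
      have hk2 : ¬ (0 < -k) := by lia
      simp only [waveMode, circleMode, hk.ne', hk2, if_false, fourier_apply_add,
        fourier_apply_sub, Complex.mul_im, Complex.conj_re, Complex.conj_im, neg_eq_zero,
        hk, if_true, neg_neg]
      ring

/-- F(x+t) is constant along antidiagonals and G(x-t) along diagonals, so the mixed second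
difference kills both. -/
theorem waveMode_parallelogram {m : ℤ × ℤ} (hm : waveEigenvalue m = 0) (s r : WaveCircle)
    (z : WaveTorus) :
    waveMode m (z + (diagDir s + antiDir r)) - waveMode m (z + diagDir s)
      - waveMode m (z + antiDir r) + waveMode m z = 0 := by
  obtain ⟨F, G, h⟩ := waveMode_eq_travelling hm
  obtain ⟨x, t⟩ := z
  simp only [h, diagDir_apply, antiDir_apply, Prod.mk_add_mk]
  rw [show x + (s + r) + (t + (s + -r)) = x + s + (t + s) by abel,
    show x + (s + r) - (t + (s + -r)) = x + r - (t + -r) by abel,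
    show x + s - (t + s) = x - t by abel, show x + r + (t + -r) = x + t by abel]
  ring

/-- The kernel of the wave operator in `H`. -/
def waveKernel : Submodule ℝ WaveH where
  carrier := {u | ∀ m, waveEigenvalue m ≠ 0 → waveCoeff u m = 0}
  add_mem' := fun hu hv m hm => by rw [waveCoeff_add, hu m hm, hv m hm, add_zero]
  zero_mem' := fun m _ => waveCoeff_zero m
  smul_mem' := fun a u hu m hm => by rw [waveCoeff_smul, hu m hm, mul_zero]

/-- The mixed difference is a bounded operator on H which vanishes on the kernel modes, hence on the
sum of any series of them. This replaces an explicit splitting of u into travelling waves. -/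
theorem waveKernel_parallelogram {u : WaveH} (hu : u ∈ waveKernel) (s r : WaveCircle) :
    ∀ᵐ z, u (z + (diagDir s + antiDir r)) - u (z + diagDir s) - u (z + antiDir r) + u z = 0 := by
  set P : WaveH →L[ℝ] WaveH := translateH (diagDir s + antiDir r) - translateH (diagDir s)
    - translateH (antiDir r) + ContinuousLinearMap.id ℝ WaveH with hP
  have hco : ∀ v : WaveH, P v =ᵐ[volume] fun z => v (z + (diagDir s + antiDir r))
      - v (z + diagDir s) - v (z + antiDir r) + v z := by
    intro v
    simp only [hP, _root_.add_apply, _root_.sub_apply,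
      ContinuousLinearMap.id_apply]
    filter_upwards [Lp.coeFn_add (translateH (diagDir s + antiDir r) v - translateH (diagDir s) v
      - translateH (antiDir r) v) v, Lp.coeFn_sub (translateH (diagDir s + antiDir r) v
      - translateH (diagDir s) v) (translateH (antiDir r) v),
      Lp.coeFn_sub (translateH (diagDir s + antiDir r) v) (translateH (diagDir s) v),
      coeFn_translateH (diagDir s + antiDir r) v, coeFn_translateH (diagDir s) v,
      coeFn_translateH (antiDir r) v] with z h1 h2 h3 h4 h5 h6
    rw [h1, Pi.add_apply, h2, Pi.sub_apply, h3, Pi.sub_apply, h4, h5, h6]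
  have hmode : ∀ m, waveEigenvalue m = 0 → P (waveModeH m) = 0 := by
    intro m hm
    apply Lp.ext
    have h0 := coeFn_waveModeH m
    have h1 : ∀ a : WaveTorus, (fun z => waveModeH m (z + a)) =ᵐ[volume]
        fun z => waveMode m (z + a) := fun a =>
      (measurePreserving_translate a).quasiMeasurePreserving.ae_eq_comp h0
    filter_upwards [hco (waveModeH m), Lp.coeFn_zero ℝ 2 (volume : Measure WaveTorus), h0,
      h1 (diagDir s + antiDir r), h1 (diagDir s), h1 (antiDir r)] with z h2 h3 h4 h5 h6 h7
    rw [h2, h3, h4, h5, h6, h7, waveMode_parallelogram hm]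
    rfl
  have hsum := P.hasSum (hasSum_waveCoeff_smul u)
  have hz : ∀ m, P (waveCoeff u m • waveModeH m) = 0 := by
    intro m
    rw [map_smul]
    by_cases hm : waveEigenvalue m = 0
    · rw [hmode m hm, smul_zero]
    · rw [hu m hm, zero_smul]
  have hPu : P u = 0 := by
    refine hsum.unique ?_
    simp only [hz]
    exact hasSum_zero
  filter_upwards [hco u, Lp.coeFn_zero ℝ 2 (volume : Measure WaveTorus)] with z h1 h2
  rw [← h1, hPu, h2]
  rfl

/-! ### Observability of the kernel -/

theorem enorm_sq_add_le (a b : ℝ) : ‖a + b‖ₑ ^ 2 ≤ 2 * ‖a‖ₑ ^ 2 + 2 * ‖b‖ₑ ^ 2 := by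
  simp only [enorm_eq_nnnorm]
  norm_cast
  rw [← NNReal.coe_le_coe]
  push_cast
  simp only [Real.norm_eq_abs, sq_abs]
  nlinarith [sq_nonneg (a - b)]

theorem enorm_sq_sub_le (a b : ℝ) : ‖a - b‖ₑ ^ 2 ≤ 2 * ‖a‖ₑ ^ 2 + 2 * ‖b‖ₑ ^ 2 := by
  rw [sub_eq_add_neg]
  simpa using enorm_sq_add_le a (-b)

theorem setLIntegral_biUnion_finset_le {α ι : Type*} [MeasurableSpace α] {μ : Measure α}
    (t : Finset ι) (S : ι → Set α) (g : α → ENNReal) :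
    ∫⁻ z in ⋃ a ∈ t, S a, g z ∂μ ≤ ∑ a ∈ t, ∫⁻ z in S a, g z ∂μ := by
  classical
  induction t using Finset.induction_on with
  | empty => simp
  | insert a t ha ih =>
    rw [Finset.set_biUnion_insert, Finset.sum_insert ha]
    exact (lintegral_union_le _ _ _).trans (by gcongr)

theorem setLIntegral_translate_le {g : WaveTorus → ENNReal} (hg : Measurable g) {S U : Set WaveTorus}
    (hU : MeasurableSet U) {a : WaveTorus} (h : ∀ z ∈ S, z + a ∈ U) :
    ∫⁻ z in S, g (z + a) ≤ ∫⁻ z in U, g z := by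
  rw [← (measurePreserving_translate a).setLIntegral_comp_preimage hU hg]
  exact lintegral_mono_set h

theorem lintegral_translate {g : WaveTorus → ENNReal} (hg : Measurable g) (a : WaveTorus) :
    ∫⁻ z, g (z + a) = ∫⁻ z, g z :=
  (measurePreserving_translate a).lintegral_comp hg

/-- Small differences in the direction `d₁` are controlled by the values on `U`, if every orbit in
the direction `d₂` meets `U`. -/
theorem exists_lintegral_small_diff_le {d₁ d₂ : WaveCircle →+ WaveTorus} {U : Set WaveTorus}
    (hU : IsOpen U) (hmeet : ∀ z, ∃ r, z + d₂ r ∈ U) :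
    ∃ C : ENNReal, C ≠ ⊤ ∧ ∃ δ > 0, ∀ f : WaveTorus → ℝ, Measurable f →
      (∀ s r, ∀ᵐ z, f (z + (d₁ s + d₂ r)) - f (z + d₁ s) - f (z + d₂ r) + f z = 0) →
      ∀ s, ‖d₁ s‖ < δ → ∫⁻ z, ‖f (z + d₁ s) - f z‖ₑ ^ 2 ≤ C * ∫⁻ z in U, ‖f z‖ₑ ^ 2 := by
  -- A Lebesgue number for the cover by the translates of `U` along `d₂`: a single shift r carries a
  -- whole δ-ball into `U`.
  obtain ⟨δ, hδ, hball⟩ := lebesgue_number_lemma_of_metric (s := (Set.univ : Set WaveTorus))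
    (c := fun r : WaveCircle => {z | z + d₂ r ∈ U}) isCompact_univ
    (fun r => hU.preimage (continuous_add_const _)) (fun z _ => by
      obtain ⟨r, hr⟩ := hmeet z
      exact Set.mem_iUnion.2 ⟨r, hr⟩)
  obtain ⟨t, -, htf, htc⟩ := (isCompact_univ (X := WaveTorus)).finite_cover_balls (half_pos hδ)
  refine ⟨htf.toFinset.card * 4, ENNReal.mul_ne_top (by simp) (by simp), δ / 2, half_pos hδ, ?_⟩
  intro f hf hpar s hs
  have hG : Measurable fun z => ‖f z‖ₑ ^ 2 := by fun_prop
  have hone : ∀ x ∈ htf.toFinset, ∫⁻ z in Metric.ball x (δ / 2), ‖f (z + d₁ s) - f z‖ₑ ^ 2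
      ≤ 4 * ∫⁻ z in U, ‖f z‖ₑ ^ 2 := by
    intro x _
    -- By the parallelogram identity the difference may be taken after the shift by `d₂ r`. For z in
    -- the half-radius ball and ‖d₁ s‖ < δ/2, both shifted points lie in `U`.
    obtain ⟨r, hr⟩ := hball x (Set.mem_univ _)
    calc ∫⁻ z in Metric.ball x (δ / 2), ‖f (z + d₁ s) - f z‖ₑ ^ 2
        = ∫⁻ z in Metric.ball x (δ / 2), ‖f (z + (d₁ s + d₂ r)) - f (z + d₂ r)‖ₑ ^ 2 := by
          refine lintegral_congr_ae (ae_restrict_of_ae ?_)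
          filter_upwards [hpar s r] with z hz
          congr 2
          linarith
      _ ≤ ∫⁻ z in Metric.ball x (δ / 2),
          (2 * ‖f (z + (d₁ s + d₂ r))‖ₑ ^ 2 + 2 * ‖f (z + d₂ r)‖ₑ ^ 2) :=
          lintegral_mono fun z => enorm_sq_sub_le _ _
      _ = 2 * (∫⁻ z in Metric.ball x (δ / 2), ‖f (z + (d₁ s + d₂ r))‖ₑ ^ 2)
          + 2 * ∫⁻ z in Metric.ball x (δ / 2), ‖f (z + d₂ r)‖ₑ ^ 2 := by
          rw [lintegral_add_left (by fun_prop), lintegral_const_mul _ (by fun_prop),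
            lintegral_const_mul _ (by fun_prop)]
      _ ≤ 2 * (∫⁻ z in U, ‖f z‖ₑ ^ 2) + 2 * ∫⁻ z in U, ‖f z‖ₑ ^ 2 := by
          refine add_le_add (mul_le_mul' le_rfl ?_) (mul_le_mul' le_rfl ?_)
          · refine setLIntegral_translate_le hG hU.measurableSet fun z hz => ?_
            rw [← add_assoc]
            apply hr
            rw [Metric.mem_ball] at hz ⊢
            calc dist (z + d₁ s) x ≤ dist (z + d₁ s) z + dist z x := dist_triangle _ _ _
              _ < δ / 2 + δ / 2 := by
                refine add_lt_add ?_ hz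
                rwa [dist_eq_norm, add_sub_cancel_left]
              _ = δ := add_halves δ
          · refine setLIntegral_translate_le hG hU.measurableSet fun z hz => ?_
            exact hr (Metric.ball_subset_ball (by linarith) hz)
      _ = 4 * ∫⁻ z in U, ‖f z‖ₑ ^ 2 := by ring
  calc ∫⁻ z, ‖f (z + d₁ s) - f z‖ₑ ^ 2
      = ∫⁻ z in Set.univ, ‖f (z + d₁ s) - f z‖ₑ ^ 2 := by rw [Measure.restrict_univ]
    _ ≤ ∫⁻ z in ⋃ x ∈ htf.toFinset, Metric.ball x (δ / 2), ‖f (z + d₁ s) - f z‖ₑ ^ 2 := by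
        refine lintegral_mono_set ?_
        simpa using htc
    _ ≤ ∑ x ∈ htf.toFinset, ∫⁻ z in Metric.ball x (δ / 2), ‖f (z + d₁ s) - f z‖ₑ ^ 2 :=
        setLIntegral_biUnion_finset_le _ _ _
    _ ≤ ∑ x ∈ htf.toFinset, 4 * ∫⁻ z in U, ‖f z‖ₑ ^ 2 := Finset.sum_le_sum hone
    _ = _ := by rw [Finset.sum_const, nsmul_eq_mul, mul_assoc]

/-- An arbitrary translation is a short one doubled j times. By translation invariance each doubling
multiplies the squared L² norm of the difference by at most 4. -/
theorem exists_lintegral_diff_le {d₁ d₂ : WaveCircle →+ WaveTorus} {U : Set WaveTorus}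
    (hd : ∀ s, ‖d₁ s‖ = ‖s‖) (hU : IsOpen U) (hmeet : ∀ z, ∃ r, z + d₂ r ∈ U) :
    ∃ C : ENNReal, C ≠ ⊤ ∧ ∀ f : WaveTorus → ℝ, Measurable f →
      (∀ s r, ∀ᵐ z, f (z + (d₁ s + d₂ r)) - f (z + d₁ s) - f (z + d₂ r) + f z = 0) →
      ∀ s, ∫⁻ z, ‖f (z + d₁ s) - f z‖ₑ ^ 2 ≤ C * ∫⁻ z in U, ‖f z‖ₑ ^ 2 := by
  obtain ⟨C, hC, δ, hδ, h⟩ := exists_lintegral_small_diff_le (d₁ := d₁) hU hmeet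
  -- Representatives have absolute value at most 2π, so j halvings bring every one below δ,
  -- uniformly in s.
  obtain ⟨j, hj⟩ := exists_pow_lt_of_lt_one (div_pos hδ Real.two_pi_pos)
    (by norm_num : (1 / 2 : ℝ) < 1)
  refine ⟨4 ^ j * C, ENNReal.mul_ne_top (by simp) hC, fun f hf hpar => ?_⟩
  have hdbl : ∀ (i : ℕ) (s : WaveCircle), ∫⁻ z, ‖f (z + d₁ (2 ^ i • s)) - f z‖ₑ ^ 2
      ≤ 4 ^ i * ∫⁻ z, ‖f (z + d₁ s) - f z‖ₑ ^ 2 := by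
    intro i
    induction i with
    | zero => intro s; simp
    | succ i ih =>
      intro s
      have hm : Measurable fun z => ‖f (z + d₁ (2 ^ i • s)) - f z‖ₑ ^ 2 := by fun_prop
      have he : d₁ (2 ^ (i + 1) • s) = d₁ (2 ^ i • s) + d₁ (2 ^ i • s) := by
        rw [← map_add, ← add_smul]; congr 2; ring
      calc ∫⁻ z, ‖f (z + d₁ (2 ^ (i + 1) • s)) - f z‖ₑ ^ 2
          ≤ ∫⁻ z, (2 * ‖f (z + d₁ (2 ^ i • s) + d₁ (2 ^ i • s)) - f (z + d₁ (2 ^ i • s))‖ₑ ^ 2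
            + 2 * ‖f (z + d₁ (2 ^ i • s)) - f z‖ₑ ^ 2) := by
            refine lintegral_mono fun z => ?_
            rw [he, ← add_assoc]
            refine le_trans (le_of_eq ?_) (enorm_sq_add_le _ _)
            congr 2
            ring
        _ = 4 * ∫⁻ z, ‖f (z + d₁ (2 ^ i • s)) - f z‖ₑ ^ 2 := by
            rw [lintegral_add_left (by fun_prop), lintegral_const_mul _ (by fun_prop),
              lintegral_const_mul _ (by fun_prop), lintegral_translate hm (d₁ (2 ^ i • s))]
            ring
        _ ≤ 4 * (4 ^ i * ∫⁻ z, ‖f (z + d₁ s) - f z‖ₑ ^ 2) := by gcongr; exact ih s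
        _ = _ := by ring
  intro s
  obtain ⟨x, hx, rfl⟩ : ∃ x : ℝ, |x| ≤ 2 * Real.pi ∧ (x : WaveCircle) = s := by
    obtain ⟨x, hx, hxs⟩ := AddCircle.eq_coe_Ico s
    exact ⟨x, by rw [abs_of_nonneg hx.1]; exact hx.2.le, hxs⟩
  have hxs : (x : WaveCircle) = 2 ^ j • ((x * (1 / 2) ^ j : ℝ) : WaveCircle) := by
    rw [← AddCircle.coe_nsmul]
    congr 1
    rw [nsmul_eq_mul]
    push_cast
    rw [mul_left_comm, ← mul_pow]
    norm_num
  rw [hxs, mul_assoc]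
  refine (hdbl j _).trans ?_
  gcongr
  apply h f hf hpar
  rw [hd]
  refine (QuotientAddGroup.norm_mk_le_norm).trans_lt ?_
  rw [Real.norm_eq_abs, abs_mul, abs_of_nonneg (by positivity : (0 : ℝ) ≤ (1 / 2) ^ j)]
  calc |x| * (1 / 2) ^ j ≤ 2 * Real.pi * (1 / 2) ^ j := by gcongr
    _ < 2 * Real.pi * (δ / (2 * Real.pi)) := by gcongr
    _ = δ := by field_simp

/-- Observability of the kernel of the wave operator: an element is controlled by its restriction
to an open set which meets all characteristics. -/
theorem exists_lintegral_le_of_meets {U : Set WaveTorus} (hU : IsOpen U)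
    (hdiag : ∀ z, ∃ s, z + diagDir s ∈ U) (hanti : ∀ z, ∃ r, z + antiDir r ∈ U) :
    ∃ C : ENNReal, C ≠ ⊤ ∧ ∀ u ∈ waveKernel,
      ∫⁻ z, ‖u z‖ₑ ^ 2 ≤ C * ∫⁻ z in U, ‖u z‖ₑ ^ 2 := by
  have hd1 : ∀ s, ‖diagDir s‖ = ‖s‖ := fun s => by simp [diagDir_apply, Prod.norm_def]
  have hd2 : ∀ s, ‖antiDir s‖ = ‖s‖ := fun s => by simp [antiDir_apply, Prod.norm_def]
  obtain ⟨C₁, hC₁, h₁⟩ := exists_lintegral_diff_le hd1 hU hanti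
  obtain ⟨C₂, hC₂, h₂⟩ := exists_lintegral_diff_le hd2 hU hdiag
  obtain ⟨t, ht⟩ := (isCompact_univ (X := WaveTorus)).elim_finite_subcover
    (fun a : WaveTorus => {z | z + a ∈ U}) (fun a => hU.preimage (continuous_add_const _))
    (fun z _ => by
      obtain ⟨r, hr⟩ := hdiag z
      exact Set.mem_iUnion.2 ⟨_, hr⟩)
  refine ⟨t.card * (2 + 2 * (2 * C₂ + 2 * C₁)), by finiteness, fun u hu => ?_⟩
  have hum : Measurable u := (Lp.stronglyMeasurable u).measurable
  set I := ∫⁻ z in U, ‖u z‖ₑ ^ 2 with hI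
  have hG : Measurable fun z => ‖u z‖ₑ ^ 2 := by fun_prop
  have hpar := waveKernel_parallelogram hu
  have hall : ∀ a : WaveTorus, ∫⁻ z, ‖u (z + a) - u z‖ₑ ^ 2 ≤ (2 * C₂ + 2 * C₁) * I := by
    intro a
    obtain ⟨s, r, rfl⟩ : ∃ s r, a = diagDir s + antiDir r := by
      obtain ⟨x, t⟩ := a
      obtain ⟨x, rfl⟩ := QuotientAddGroup.mk_surjective x
      obtain ⟨t, rfl⟩ := QuotientAddGroup.mk_surjective t
      -- Halving is done on real representatives, since it is ambiguous on the circle.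
      refine ⟨(((x + t) / 2 : ℝ) : WaveCircle), (((x - t) / 2 : ℝ) : WaveCircle), ?_⟩
      rw [diagDir_apply, antiDir_apply, Prod.mk_add_mk, ← AddCircle.coe_neg, ← AddCircle.coe_add,
        ← AddCircle.coe_add]
      congr 2 <;> ring
    have hm : Measurable fun z => ‖u (z + antiDir r) - u z‖ₑ ^ 2 := by fun_prop
    calc ∫⁻ z, ‖u (z + (diagDir s + antiDir r)) - u z‖ₑ ^ 2
        ≤ ∫⁻ z, (2 * ‖u (z + diagDir s + antiDir r) - u (z + diagDir s)‖ₑ ^ 2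
            + 2 * ‖u (z + diagDir s) - u z‖ₑ ^ 2) := by
          refine lintegral_mono fun z => ?_
          rw [← add_assoc]
          refine le_trans (le_of_eq ?_) (enorm_sq_add_le _ _)
          congr 2
          ring
      _ = 2 * (∫⁻ z, ‖u (z + antiDir r) - u z‖ₑ ^ 2)
          + 2 * ∫⁻ z, ‖u (z + diagDir s) - u z‖ₑ ^ 2 := by
          rw [lintegral_add_left (by fun_prop), lintegral_const_mul _ (by fun_prop),
            lintegral_const_mul _ (by fun_prop), lintegral_translate hm (diagDir s)]
      _ ≤ 2 * (C₂ * I) + 2 * (C₁ * I) := by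
          refine add_le_add (mul_le_mul' le_rfl ?_) (mul_le_mul' le_rfl ?_)
          · refine h₂ u hum (fun r s => ?_) r
            filter_upwards [hpar s r] with z hz
            rw [add_comm (antiDir r)]
            linarith
          · exact h₁ u hum hpar s
      _ = _ := by ring
  -- Finitely many translates of `U` cover the torus. On each, u(z) is compared with u(z + a), whose
  -- argument lies in `U`, and the error is a difference already controlled by `hall`.
  calc ∫⁻ z, ‖u z‖ₑ ^ 2 = ∫⁻ z in Set.univ, ‖u z‖ₑ ^ 2 := by rw [Measure.restrict_univ]
    _ ≤ ∫⁻ z in ⋃ a ∈ t, {z | z + a ∈ U}, ‖u z‖ₑ ^ 2 := lintegral_mono_set ht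
    _ ≤ ∑ a ∈ t, ∫⁻ z in {z | z + a ∈ U}, ‖u z‖ₑ ^ 2 := setLIntegral_biUnion_finset_le _ _ _
    _ ≤ ∑ a ∈ t, (2 + 2 * (2 * C₂ + 2 * C₁)) * I := by
        refine Finset.sum_le_sum fun a _ => ?_
        calc ∫⁻ z in {z | z + a ∈ U}, ‖u z‖ₑ ^ 2
            ≤ ∫⁻ z in {z | z + a ∈ U}, (2 * ‖u (z + a)‖ₑ ^ 2 + 2 * ‖u (z + a) - u z‖ₑ ^ 2) := by
              refine lintegral_mono fun z => ?_
              refine le_trans (le_of_eq ?_) (enorm_sq_sub_le _ _)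
              congr 2
              ring
          _ = 2 * (∫⁻ z in {z | z + a ∈ U}, ‖u (z + a)‖ₑ ^ 2)
              + 2 * ∫⁻ z in {z | z + a ∈ U}, ‖u (z + a) - u z‖ₑ ^ 2 := by
              rw [lintegral_add_left (by fun_prop), lintegral_const_mul _ (by fun_prop),
                lintegral_const_mul _ (by fun_prop)]
          _ ≤ 2 * I + 2 * ((2 * C₂ + 2 * C₁) * I) := by
              refine add_le_add (mul_le_mul' le_rfl ?_) (mul_le_mul' le_rfl ?_)
              · exact setLIntegral_translate_le hG hU.measurableSet fun z hz => hz
              · exact (setLIntegral_le_lintegral _ _).trans (hall a)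
          _ = _ := by ring
    _ = _ := by rw [Finset.sum_const, nsmul_eq_mul, mul_assoc]

/-! ### Convexity and differentiability of the norm of L^p -/

section LpSpace

variable {α : Type*} [MeasurableSpace α] {ν : Measure α} {p : ℝ}

theorem toReal_ofReal_of_two_lt (hp : 2 < p) : (ENNReal.ofReal p).toReal = p :=
  ENNReal.toReal_ofReal (by linarith)

theorem integrable_abs_rpow (hp : 2 < p) {f : α → ℝ} (hf : MemLp f (ENNReal.ofReal p) ν) :
    Integrable (fun x => |f x| ^ p) ν := by
  have h := hf.integrable_norm_rpow (by simp; linarith) (by simp)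
  rwa [toReal_ofReal_of_two_lt hp] at h

theorem lp_norm_rpow (hp : 2 < p) (f : Lp ℝ (ENNReal.ofReal p) ν) :
    ‖f‖ ^ p = ∫ x, |f x| ^ p ∂ν := by
  have h0 : 0 ≤ ∫ x, |f x| ^ p ∂ν := integral_nonneg fun x => by positivity
  rw [Lp.norm_def, (Lp.memLp f).eLpNorm_eq_integral_rpow_norm (by simp; linarith) (by simp),
    toReal_ofReal_of_two_lt hp]
  simp only [Real.norm_eq_abs]
  rw [ENNReal.toReal_ofReal (by positivity), ← Real.rpow_mul h0, inv_mul_cancel₀ (by linarith),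
    Real.rpow_one]

/-- Clarkson's inequality for real numbers. -/
theorem clarkson_real (hp : 2 < p) (a b : ℝ) :
    |(1 / 2) * (a + b)| ^ p + |(1 / 2) * (a - b)| ^ p ≤ (|a| ^ p + |b| ^ p) / 2 := by
  have hsq : ∀ x : ℝ, |x| ^ p = (x ^ 2) ^ (p / 2) := by
    intro x
    rw [← sq_abs, ← Real.rpow_natCast, ← Real.rpow_mul (abs_nonneg x)]
    congr 1; push_cast; ring
  have hr : 1 ≤ p / 2 := by linarith
  simp only [hsq]
  have h1 := Real.add_rpow_le_rpow_add (sq_nonneg (1 / 2 * (a + b)))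
    (sq_nonneg (1 / 2 * (a - b))) hr
  refine h1.trans ?_
  have h2 : (1 / 2 * (a + b)) ^ 2 + (1 / 2 * (a - b)) ^ 2
      = (1 / 2 : ℝ) • a ^ 2 + (1 / 2 : ℝ) • b ^ 2 := by
    simp only [smul_eq_mul]; ring
  rw [h2]
  have h3 := (convexOn_rpow hr).2 (Set.mem_Ici.2 (sq_nonneg a)) (Set.mem_Ici.2 (sq_nonneg b))
    (by norm_num : (0 : ℝ) ≤ 1 / 2) (by norm_num : (0 : ℝ) ≤ 1 / 2) (by norm_num)
  simp only [smul_eq_mul] at h3 ⊢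
  linarith

theorem clarkson_lp (hp : 2 < p) (f g : Lp ℝ (ENNReal.ofReal p) ν) :
    ‖(1 / 2 : ℝ) • (f + g)‖ ^ p + ‖(1 / 2 : ℝ) • (f - g)‖ ^ p ≤ (‖f‖ ^ p + ‖g‖ ^ p) / 2 := by
  simp only [lp_norm_rpow hp]
  have hi := fun h : Lp ℝ (ENNReal.ofReal p) ν => integrable_abs_rpow hp (Lp.memLp h)
  rw [← integral_add (hi _) (hi _), ← integral_add (hi _) (hi _), ← integral_div]
  refine integral_mono_ae ((hi _).add (hi _)) (((hi _).add (hi _)).div_const 2) ?_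
  filter_upwards [Lp.coeFn_smul (1 / 2 : ℝ) (f + g), Lp.coeFn_smul (1 / 2 : ℝ) (f - g),
    Lp.coeFn_add f g, Lp.coeFn_sub f g] with x h1 h2 h3 h4
  rw [h1, h2, Pi.smul_apply, Pi.smul_apply, h3, h4]
  exact clarkson_real hp _ _

/-- Differentiation under the integral; for |s| < 1 the derivative is dominated by p(|f| + |g|)^p.
-/
theorem hasDerivAt_integral_abs_rpow (hp : 2 < p) (f g : Lp ℝ (ENNReal.ofReal p) ν) :
    HasDerivAt (fun s : ℝ => ‖f + s • g‖ ^ p) (p * ∫ x, |f x| ^ (p - 2) * f x * g x ∂ν) 0 := by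
  have hfun : (fun s : ℝ => ‖f + s • g‖ ^ p) = fun s => ∫ x, |f x + s * g x| ^ p ∂ν := by
    funext s
    rw [lp_norm_rpow hp]
    refine integral_congr_ae ?_
    filter_upwards [Lp.coeFn_add f (s • g), Lp.coeFn_smul s g] with x h1 h2
    rw [h1, Pi.add_apply, h2]
    rfl
  rw [hfun, ← integral_const_mul]
  have hfm := (Lp.memLp f).1
  have hgm := (Lp.memLp g).1
  have hbi : Integrable (fun x => p * |(|f x| + |g x|)| ^ p) ν :=
    (integrable_abs_rpow hp ((Lp.memLp f).abs.add (Lp.memLp g).abs)).const_mul p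
  have hmain := (hasDerivAt_integral_of_dominated_loc_of_deriv_le (μ := ν) (𝕜 := ℝ)
    (F := fun s x => |f x + s * g x| ^ p) (x₀ := 0) (s := Metric.ball 0 1)
    (F' := fun s x => p * |f x + s * g x| ^ (p - 2) * (f x + s * g x) * g x)
    (bound := fun x => p * |(|f x| + |g x|)| ^ p) (Metric.ball_mem_nhds _ one_pos)
    (Filter.Eventually.of_forall fun s => ?_) ?_ ?_ ?_ hbi ?_).2
  · refine hmain.congr_deriv (integral_congr_ae (Filter.Eventually.of_forall fun x => ?_))
    simp only [zero_mul, add_zero]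
    ring
  · exact ((hfm.add (hgm.const_mul s)).norm.aemeasurable.pow_const p).aestronglyMeasurable
  · simpa using integrable_abs_rpow hp (Lp.memLp f)
  · simp only [zero_mul, add_zero]
    exact (((hfm.norm.aemeasurable.pow_const _).aestronglyMeasurable.const_mul p).mul hfm).mul hgm
  · refine Filter.Eventually.of_forall fun x s hs => ?_
    have hs1 : |s| ≤ 1 := by
      have := mem_ball_zero_iff.1 hs
      exact this.le
    have ha : |f x + s * g x| ≤ |f x| + |g x| := by
      refine (abs_add_le _ _).trans ?_
      rw [abs_mul]
      nlinarith [abs_nonneg (g x)]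
    have hA : 0 ≤ |f x| + |g x| := by positivity
    have hb : |g x| ≤ |f x| + |g x| := le_add_of_nonneg_left (abs_nonneg _)
    rw [Real.norm_eq_abs, abs_mul, abs_mul, abs_mul, abs_of_nonneg (by linarith : 0 ≤ p),
      abs_of_nonneg (by positivity : 0 ≤ |f x + s * g x| ^ (p - 2)), abs_of_nonneg hA]
    have hsplit : (|f x| + |g x|) ^ p
        = (|f x| + |g x|) ^ (p - 2) * (|f x| + |g x|) * (|f x| + |g x|) := by
      rcases hA.eq_or_lt with h0 | h0
      · rw [← h0, Real.zero_rpow (by linarith)]; simp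
      · rw [mul_assoc, ← sq, ← Real.rpow_natCast, ← Real.rpow_add h0]
        congr 1; push_cast; ring
    rw [hsplit, mul_assoc, mul_assoc, ← mul_assoc (|f x + s * g x| ^ (p - 2))]
    have hp2 : 0 ≤ p - 2 := by linarith
    gcongr
  · refine Filter.Eventually.of_forall fun x s _ => ?_
    have h1 : HasDerivAt (fun s : ℝ => f x + s * g x) (g x) s := by
      simpa using ((hasDerivAt_id s).mul_const (g x)).const_add (f x)
    exact (hasDerivAt_abs_rpow (f x + s * g x) (by linarith : 1 < p)).comp s h1

variable [Fact (1 ≤ ENNReal.ofReal p)]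

/-- Midpoints of a minimizing sequence stay in Y, so their distance to z is no smaller than the
infimum. Clarkson's inequality then forces the half-differences to be small, and the sequence is
Cauchy. -/
theorem exists_nearest_of_isClosed (hp : 2 < p) (Y : Submodule ℝ (Lp ℝ (ENNReal.ofReal p) ν))
    (hY : IsClosed (Y : Set (Lp ℝ (ENNReal.ofReal p) ν))) (z : Lp ℝ (ENNReal.ofReal p) ν) :
    ∃ y ∈ Y, ∀ y' ∈ Y, ‖z - y‖ ≤ ‖z - y'‖ := by
  have hp0 : 0 < p := by linarith
  set D := ⨅ y : Y, ‖z - y‖ ^ p with hD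
  have hbdd : BddBelow (Set.range fun y : Y => ‖z - y‖ ^ p) :=
    ⟨0, by rintro _ ⟨y, rfl⟩; positivity⟩
  have hle : ∀ y ∈ Y, D ≤ ‖z - y‖ ^ p := fun y hy => ciInf_le hbdd ⟨y, hy⟩
  have hex : ∀ n : ℕ, ∃ y : Y, ‖z - y‖ ^ p < D + 1 / ((n : ℝ) + 1) := fun n =>
    exists_lt_of_ciInf_lt (lt_add_of_pos_right _ (by positivity))
  choose y hy using hex
  have hpair : ∀ m n N : ℕ, N ≤ m → N ≤ n →
      dist (y m : Lp ℝ (ENNReal.ofReal p) ν) (y n) ≤ 2 * (1 / ((N : ℝ) + 1)) ^ (1 / p) := by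
    intro m n N hm hn
    have hc := clarkson_lp hp (z - (y m : Lp ℝ (ENNReal.ofReal p) ν)) (z - y n)
    have h1 : (1 / 2 : ℝ) • (z - (y m : Lp ℝ (ENNReal.ofReal p) ν) + (z - y n))
        = z - (1 / 2 : ℝ) • ((y m : Lp ℝ (ENNReal.ofReal p) ν) + y n) := by
      module
    have h2 : (1 / 2 : ℝ) • (z - (y m : Lp ℝ (ENNReal.ofReal p) ν) - (z - y n))
        = (-(1 / 2) : ℝ) • ((y m : Lp ℝ (ENNReal.ofReal p) ν) - y n) := by
      module
    rw [h1, h2] at hc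
    have h3 := hle _ (Y.smul_mem (1 / 2 : ℝ) (Y.add_mem (y m).2 (y n).2))
    have hm' : 1 / ((m : ℝ) + 1) ≤ 1 / ((N : ℝ) + 1) := by gcongr
    have hn' : 1 / ((n : ℝ) + 1) ≤ 1 / ((N : ℝ) + 1) := by gcongr
    have h4 : ‖(-(1 / 2) : ℝ) • ((y m : Lp ℝ (ENNReal.ofReal p) ν) - y n)‖ ^ p
        ≤ 1 / ((N : ℝ) + 1) := by
      have := hy m
      have := hy n
      linarith
    have h5 := Real.rpow_le_rpow (by positivity) h4 (by positivity : 0 ≤ 1 / p)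
    rw [← Real.rpow_mul (norm_nonneg _), mul_one_div_cancel hp0.ne', Real.rpow_one, norm_smul,
      ← dist_eq_norm] at h5
    norm_num at h5 ⊢
    linarith
  have hlim : Filter.Tendsto (fun N : ℕ => 2 * (1 / ((N : ℝ) + 1)) ^ (1 / p)) Filter.atTop
      (nhds 0) := by
    have h := (tendsto_one_div_add_atTop_nhds_zero_nat (𝕜 := ℝ)).rpow_const
      (p := 1 / p) (Or.inr (by positivity))
    rw [Real.zero_rpow (by positivity)] at h
    simpa using h.const_mul 2
  have hcau : CauchySeq fun n => (y n : Lp ℝ (ENNReal.ofReal p) ν) :=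
    cauchySeq_of_le_tendsto_0 _ (fun n m N hn hm => hpair n m N hn hm) hlim
  obtain ⟨y₀, hy₀⟩ := cauchySeq_tendsto_of_complete hcau
  refine ⟨y₀, hY.mem_of_tendsto hy₀ (Filter.Eventually.of_forall fun n => (y n).2), ?_⟩
  have hl1 : Filter.Tendsto (fun n => ‖z - (y n : Lp ℝ (ENNReal.ofReal p) ν)‖ ^ p) Filter.atTop
      (nhds (‖z - y₀‖ ^ p)) :=
    ((tendsto_const_nhds.sub hy₀).norm).rpow_const (Or.inr hp0.le)
  have hl2 : Filter.Tendsto (fun n : ℕ => D + 1 / ((n : ℝ) + 1)) Filter.atTop (nhds (D + 0)) :=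
    tendsto_const_nhds.add tendsto_one_div_add_atTop_nhds_zero_nat
  have hD' : ‖z - y₀‖ ^ p ≤ D := by
    have := le_of_tendsto_of_tendsto' hl1 hl2 fun n => (hy n).le
    linarith
  intro y' hy'
  exact (Real.rpow_le_rpow_iff (norm_nonneg _) (norm_nonneg _) hp0).1 (hD'.trans (hle y' hy'))

/-- A functional of norm at most one which is normed by `z` is the derivative of the norm. -/
theorem dual_apply_eq_of_norming (hp : 2 < p) {φ : StrongDual ℝ (Lp ℝ (ENNReal.ofReal p) ν)}
    (hφ : ‖φ‖ ≤ 1) {z : Lp ℝ (ENNReal.ofReal p) ν} (hz : φ z = ‖z‖) (hz0 : 0 < ‖z‖)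
    (h : Lp ℝ (ENNReal.ofReal p) ν) :
    ‖z‖ ^ (p - 1) * φ h = ∫ x, |z x| ^ (p - 2) * z x * h x ∂ν := by
  have hp0 : 0 < p := by linarith
  set μ := ‖z‖ with hμ
  have hd1 := hasDerivAt_integral_abs_rpow hp z h
  have hd2 : HasDerivAt (fun s : ℝ => p * μ ^ (p - 1) * φ (z + s • h))
      (p * μ ^ (p - 1) * φ h) 0 := by
    have : (fun s : ℝ => p * μ ^ (p - 1) * φ (z + s • h))
        = fun s => p * μ ^ (p - 1) * (φ z + s * φ h) := by
      funext s; simp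
    rw [this]
    simpa using (((hasDerivAt_id (0 : ℝ)).mul_const (φ h)).const_add (φ z)).const_mul
      (p * μ ^ (p - 1))
  have hmul : μ ^ (p - 1) * μ = μ ^ p := by
    rw [← Real.rpow_add_one hz0.ne']; congr 1; ring
  -- With a = ‖z + s h‖ one has φ(z + s h) ≤ a, and Bernoulli's inequality says that a^p - pμ^{p-1}a
  -- is least at a = μ. Equality holds at s = 0, so the two derivatives there agree.
  have hmin : IsLocalMin (fun s : ℝ => ‖z + s • h‖ ^ p - p * μ ^ (p - 1) * φ (z + s • h)) 0 := by
    refine Filter.Eventually.of_forall fun s => ?_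
    simp only [zero_smul, add_zero, hz, ← hμ]
    set a := ‖z + s • h‖ with ha
    have ha0 : 0 ≤ a := norm_nonneg _
    have hb : φ (z + s • h) ≤ a := by
      refine (le_abs_self _).trans ((φ.le_opNorm _).trans ?_)
      exact mul_le_of_le_one_left ha0 hφ
    have hbern := one_add_mul_self_le_rpow_one_add (s := a / μ - 1)
      (by have : 0 ≤ a / μ := by positivity
          linarith) (by linarith : 1 ≤ p)
    rw [add_sub_cancel, Real.div_rpow ha0 hz0.le, le_div_iff₀ (by positivity)] at hbern
    have hexp : (1 + p * (a / μ - 1)) * μ ^ p = μ ^ p + p * μ ^ (p - 1) * a - p * μ ^ p := by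
      rw [← hmul]; field_simp; ring
    have hk : p * μ ^ (p - 1) * φ (z + s • h) ≤ p * μ ^ (p - 1) * a := by gcongr
    have hm2 : p * μ ^ (p - 1) * μ = p * μ ^ p := by rw [mul_assoc, hmul]
    rw [hm2]
    linarith
  have h0 := hmin.hasDerivAt_eq_zero (hd1.sub hd2)
  have h1 : p * (μ ^ (p - 1) * φ h) = p * ∫ x, |z x| ^ (p - 2) * z x * h x ∂ν := by linarith
  exact mul_left_cancel₀ hp0.ne' h1

end LpSpace

/-! ### Eigenvalues and dyadic counting of modes -/

theorem waveEigenvalue_eq_mul (m : ℤ × ℤ) :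
    waveEigenvalue m = ((m.1 + m.2 : ℤ) : ℝ) * ((m.1 - m.2 : ℤ) : ℝ) := by
  rw [waveEigenvalue]; push_cast; ring

theorem abs_waveEigenvalue_eq (m : ℤ × ℤ) :
    |waveEigenvalue m| = ((m.1 + m.2).natAbs : ℝ) * ((m.1 - m.2).natAbs : ℝ) := by
  rw [waveEigenvalue_eq_mul, abs_mul, Nat.cast_natAbs, Nat.cast_natAbs]
  push_cast; rfl

/-- Eigenvalues are integers; this is the spectral gap at zero. -/
theorem one_le_abs_waveEigenvalue {m : ℤ × ℤ} (hm : waveEigenvalue m ≠ 0) :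
    1 ≤ |waveEigenvalue m| := by
  rw [abs_waveEigenvalue_eq]
  rw [← abs_ne_zero, abs_waveEigenvalue_eq] at hm
  exact_mod_cast Nat.one_le_iff_ne_zero.2 (by exact_mod_cast hm)

theorem sumDiff_injective : Function.Injective fun m : ℤ × ℤ => (m.1 + m.2, m.1 - m.2) := by
  rintro ⟨a, b⟩ ⟨c, d⟩ h
  simp only [Prod.mk.injEq] at h ⊢
  lia

/-- When the product (k+l)(k-l) is nonzero, both integer factors are bounded by it in absolute
value. Only the eigenvalue 0 has infinite multiplicity. -/
theorem finite_waveEigenvalue_lt (R : ℝ) :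
    {m : ℤ × ℤ | waveEigenvalue m ≠ 0 ∧ |waveEigenvalue m| < R}.Finite := by
  obtain ⟨N, hN⟩ := exists_nat_gt R
  have hbox : ((Finset.Icc (-(N : ℤ)) N ×ˢ Finset.Icc (-(N : ℤ)) N : Finset (ℤ × ℤ)) :
      Set (ℤ × ℤ)).Finite := Finset.finite_toSet _
  refine (hbox.preimage sumDiff_injective.injOn).subset ?_
  rintro m ⟨hm, hR⟩
  rw [← abs_ne_zero, abs_waveEigenvalue_eq] at hm
  rw [abs_waveEigenvalue_eq] at hR
  have h1 : (m.1 + m.2).natAbs * (m.1 - m.2).natAbs < N := by exact_mod_cast hR.trans hN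
  have h2 : (m.1 + m.2).natAbs ≠ 0 := fun h => hm (by simp [h])
  have h3 : (m.1 - m.2).natAbs ≠ 0 := fun h => hm (by simp [h])
  have h4 := Nat.le_mul_of_pos_right (m.1 + m.2).natAbs (Nat.pos_of_ne_zero h3)
  have h5 := Nat.le_mul_of_pos_left (m.1 - m.2).natAbs (Nat.pos_of_ne_zero h2)
  simp only [Set.mem_preimage, Finset.coe_product, Finset.coe_Icc, Set.mem_prod, Set.mem_Icc]
  lia

/-- The dyadic block of a mode. -/
def dyadicBlock (m : ℤ × ℤ) : ℕ × ℕ :=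
  (Nat.log 2 (m.1 + m.2).natAbs, Nat.log 2 (m.1 - m.2).natAbs)

theorem two_pow_le_of_dyadicBlock {m : ℤ × ℤ} {b : ℕ × ℕ} (hm : waveEigenvalue m ≠ 0)
    (hb : dyadicBlock m = b) : (2 : ℝ) ^ (b.1 + b.2) ≤ |waveEigenvalue m| := by
  subst hb
  rw [← abs_ne_zero, abs_waveEigenvalue_eq] at hm
  rw [abs_waveEigenvalue_eq, pow_add]
  have h2 : (m.1 + m.2).natAbs ≠ 0 := fun h => hm (by simp [h])
  have h3 : (m.1 - m.2).natAbs ≠ 0 := fun h => hm (by simp [h])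
  have h4 := Nat.pow_log_le_self 2 h2
  have h5 := Nat.pow_log_le_self 2 h3
  unfold dyadicBlock
  gcongr
  · exact_mod_cast h4
  · exact_mod_cast h5

/-- In the coordinates k+l and k-l a block lies in a box whose i-th side has 4·2^{b_i} + 1 ≤
8·2^{b_i} integers, which gives 64 = 8·8. Together with `two_pow_le_of_dyadicBlock`, block size and
eigenvalue are tied to the same power of two. -/
theorem card_le_of_dyadicBlock {T : Finset (ℤ × ℤ)} {b : ℕ × ℕ}
    (hb : ∀ m ∈ T, dyadicBlock m = b) : T.card ≤ 64 * 2 ^ (b.1 + b.2) := by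
  have hsub : T.image (fun m : ℤ × ℤ => (m.1 + m.2, m.1 - m.2)) ⊆
      Finset.Icc (-(2 ^ (b.1 + 1) : ℤ)) (2 ^ (b.1 + 1)) ×ˢ
        Finset.Icc (-(2 ^ (b.2 + 1) : ℤ)) (2 ^ (b.2 + 1)) := by
    intro x hx
    obtain ⟨m, hm, rfl⟩ := Finset.mem_image.1 hx
    obtain rfl := hb m hm
    have h4 := Nat.lt_pow_succ_log_self (b := 2) (by norm_num) (m.1 + m.2).natAbs
    have h5 := Nat.lt_pow_succ_log_self (b := 2) (by norm_num) (m.1 - m.2).natAbs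
    simp only [Finset.mem_product, Finset.mem_Icc, dyadicBlock]
    zify at h4 h5
    rw [← Nat.succ_eq_add_one, ← Nat.succ_eq_add_one, ← abs_le, ← abs_le]
    exact ⟨h4.le, h5.le⟩
  rw [← Finset.card_image_of_injective T sumDiff_injective]
  refine (Finset.card_le_card hsub).trans ?_
  rw [Finset.card_product, Int.card_Icc, Int.card_Icc]
  have h : ∀ i : ℕ, ((2 : ℤ) ^ (i + 1) + 1 - -(2 ^ (i + 1))).toNat ≤ 8 * 2 ^ i := by
    intro i
    rw [Int.toNat_le]
    push_cast
    have : (1 : ℤ) ≤ 2 ^ i := one_le_pow₀ (by norm_num)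
    rw [pow_succ]
    linarith
  calc _ ≤ (8 * 2 ^ b.1) * (8 * 2 ^ b.2) := Nat.mul_le_mul (h _) (h _)
    _ = _ := by ring

/-! ### Estimates for functionals on the modes -/

section Weighted

variable (ν : Measure WaveTorus) [IsFiniteMeasure ν] (p : ℝ)

/-- The function `e_k ⊗ e_l` as an element of a weighted Lebesgue space. -/
def waveModeLp (m : ℤ × ℤ) : Lp ℝ (ENNReal.ofReal p) ν := (memLp_waveMode m _ ν).toLp

variable {ν p}

theorem coeFn_waveModeLp (m : ℤ × ℤ) : waveModeLp ν p m =ᵐ[ν] waveMode m :=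
  MemLp.coeFn_toLp _

theorem coeFn_sum_smul {ι α : Type*} [MeasurableSpace α] {κ : Measure α} {r : ENNReal}
    (T : Finset ι) (c : ι → ℝ) (f : ι → Lp ℝ r κ) {g : ι → α → ℝ} (hfg : ∀ i, f i =ᵐ[κ] g i) :
    (∑ i ∈ T, c i • f i : Lp ℝ r κ) =ᵐ[κ] fun z => ∑ i ∈ T, c i * g i z := by
  classical
  induction T using Finset.induction_on with
  | empty => exact Lp.coeFn_zero ℝ r κ
  | insert a T ha ih =>
    rw [Finset.sum_insert ha]
    filter_upwards [Lp.coeFn_add (c a • f a) (∑ i ∈ T, c i • f i), Lp.coeFn_smul (c a) (f a), hfg a,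
      ih] with z h1 h2 h3 h4
    rw [h1, Pi.add_apply, h2, Pi.smul_apply, h3, h4, Finset.sum_insert ha, smul_eq_mul]

theorem integral_sum_mul_waveMode_sq (T : Finset (ℤ × ℤ)) (c : ℤ × ℤ → ℝ) :
    ∫ z, (∑ m ∈ T, c m * waveMode m z) ^ 2 = ∑ m ∈ T, c m ^ 2 := by
  have h1 := orthonormal_waveModeH.inner_sum c c T
  rw [inner_waveH] at h1
  have h2 : ∀ m, (starRingEnd ℝ) (c m) * c m = c m ^ 2 := fun m => by simp [sq]
  simp only [h2] at h1
  rw [← h1]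
  refine integral_congr_ae ?_
  filter_upwards [coeFn_sum_smul T c waveModeH coeFn_waveModeH] with z hz
  rw [hz, sq]

variable [Fact (1 ≤ ENNReal.ofReal p)]

/-- Test φ on G = Σ c_m e_m with c_m = φ(e_m): then φ(G) = A = Σ c_m². Interpolation between sup|G|
≤ M and the L² norm √A bounds ‖G‖^p by M^{p-2}·C·A, and solving A ≤ ‖φ‖‖G‖ for A gives the claim. -/
theorem block_rpow_le (hp : 2 < p) {C : NNReal} (hν : ν ≤ C • volume)
    (φ : StrongDual ℝ (Lp ℝ (ENNReal.ofReal p) ν)) (T : Finset (ℤ × ℤ)) :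
    ∑ m ∈ T, φ (waveModeLp ν p m) ^ 2
      ≤ ‖φ‖ ^ 2 * (C : ℝ) ^ (2 / p) * (T.card : ℝ) ^ (1 - 2 / p) := by
  have hp0 : 0 < p := by linarith
  set c : ℤ × ℤ → ℝ := fun m => φ (waveModeLp ν p m) with hc
  set A := ∑ m ∈ T, c m ^ 2 with hA
  have hA0 : 0 ≤ A := Finset.sum_nonneg fun m _ => sq_nonneg _
  rcases hA0.eq_or_lt with h0 | hApos
  · rw [← h0]; positivity
  set M := Real.sqrt (T.card * A) with hM
  set g : WaveTorus → ℝ := fun z => ∑ m ∈ T, c m * waveMode m z with hg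
  have hgc : Continuous g := by fun_prop
  have hgM : ∀ z, |g z| ≤ M := by
    intro z
    have h1 : |g z| ≤ ∑ m ∈ T, |c m| := by
      refine (Finset.abs_sum_le_sum_abs _ _).trans (Finset.sum_le_sum fun m _ => ?_)
      rw [abs_mul]
      exact mul_le_of_le_one_right (abs_nonneg _) (abs_waveMode_le_one m z)
    refine h1.trans (Real.le_sqrt_of_sq_le ?_)
    refine sq_sum_le_card_mul_sum_sq.trans (le_of_eq ?_)
    simp only [sq_abs, ← hA]
  set G : Lp ℝ (ENNReal.ofReal p) ν := ∑ m ∈ T, c m • waveModeLp ν p m with hG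
  have hφG : φ G = A := by
    rw [hG, map_sum, hA]
    refine Finset.sum_congr rfl fun m _ => ?_
    rw [map_smul, smul_eq_mul, sq]
  have hsqint : Integrable (fun z => g z ^ 2) volume :=
    (hgc.pow 2).integrable_of_hasCompactSupport (HasCompactSupport.of_compactSpace _)
  have hGn : ‖G‖ ^ p ≤ M ^ (p - 2) * (C * A) := by
    rw [lp_norm_rpow hp]
    calc ∫ z, |G z| ^ p ∂ν = ∫ z, |g z| ^ p ∂ν := by
          refine integral_congr_ae ?_
          filter_upwards [coeFn_sum_smul T c (waveModeLp ν p) coeFn_waveModeLp] with z hz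
          rw [hG, hz]
      _ ≤ ∫ z, M ^ (p - 2) * g z ^ 2 ∂ν := by
          refine integral_mono ?_ ?_ fun z => ?_
          · exact ((hgc.abs).rpow_const fun z => Or.inr hp0.le).integrable_of_hasCompactSupport
              (HasCompactSupport.of_compactSpace _)
          · exact ((hgc.pow 2).integrable_of_hasCompactSupport
              (HasCompactSupport.of_compactSpace _)).const_mul _
          · have h1 : |g z| ^ p = |g z| ^ (p - 2) * g z ^ 2 := by
              rcases eq_or_ne (g z) 0 with h | h
              · rw [h]; simp [hp0.ne']
              · rw [← sq_abs (g z), ← Real.rpow_natCast, ← Real.rpow_add (abs_pos.2 h)]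
                congr 1; push_cast; ring
            simp only [h1]
            have := Real.rpow_le_rpow (abs_nonneg _) (hgM z) (by linarith : 0 ≤ p - 2)
            gcongr
      _ = M ^ (p - 2) * ∫ z, g z ^ 2 ∂ν := integral_const_mul _ _
      _ ≤ M ^ (p - 2) * ∫ z, g z ^ 2 ∂(C • volume) := by
          gcongr
          · exact Filter.Eventually.of_forall fun z => sq_nonneg _
          · exact hsqint.smul_measure_nnreal
      _ = M ^ (p - 2) * (C * A) := by
          rw [integral_smul_nnreal_measure, integral_sum_mul_waveMode_sq, NNReal.smul_def,
            smul_eq_mul]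
  have h1 : A ≤ ‖φ‖ * ‖G‖ := by
    rw [← hφG]; exact (le_abs_self _).trans (φ.le_opNorm G)
  have h2 : A ^ p ≤ ‖φ‖ ^ p * ((T.card : ℝ) ^ ((p - 2) / 2) * C) * A ^ (p / 2) := by
    calc A ^ p ≤ (‖φ‖ * ‖G‖) ^ p := Real.rpow_le_rpow hA0 h1 hp0.le
      _ = ‖φ‖ ^ p * ‖G‖ ^ p := Real.mul_rpow (norm_nonneg _) (norm_nonneg _)
      _ ≤ ‖φ‖ ^ p * (M ^ (p - 2) * (C * A)) := by gcongr
      _ = _ := by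
        have h3 : M ^ (p - 2) = (T.card : ℝ) ^ ((p - 2) / 2) * A ^ ((p - 2) / 2) := by
          rw [hM, Real.sqrt_eq_rpow, ← Real.rpow_mul (by positivity), Real.mul_rpow (by positivity) hA0]
          congr 2 <;> ring
        have h4 : A ^ (p / 2) = A ^ ((p - 2) / 2) * A := by
          rw [← Real.rpow_add_one hApos.ne']; congr 1; ring
        rw [h3, h4]; ring
  have h3 : A ^ (p / 2) ≤ ‖φ‖ ^ p * ((T.card : ℝ) ^ ((p - 2) / 2) * C) := by
    have h4 : A ^ p = A ^ (p / 2) * A ^ (p / 2) := by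
      rw [← Real.rpow_add hApos]; congr 1; ring
    rw [h4] at h2
    exact le_of_mul_le_mul_right h2 (by positivity)
  have h4 := Real.rpow_le_rpow (by positivity) h3 (by positivity : 0 ≤ 2 / p)
  rw [← Real.rpow_mul hA0, Real.mul_rpow (by positivity) (by positivity),
    Real.mul_rpow (by positivity) (by positivity), ← Real.rpow_mul (norm_nonneg _),
    ← Real.rpow_mul (by positivity)] at h4
  have e1 : p / 2 * (2 / p) = 1 := by field_simp
  have e2 : p * (2 / p) = 2 := by field_simp
  have e3 : (p - 2) / 2 * (2 / p) = 1 - 2 / p := by field_simp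
  rw [e1, e2, e3, Real.rpow_one, Real.rpow_two] at h4
  linarith

/-- A block with |λ| ≥ X contributes at most a constant times X^{1/p-1}·X^{1-2/p} = X^{-1/p}, where
X = 2^{b₁+b₂}, and this is summable over pairs b. The exponent 1/p - 1, larger than -1, leaves a
spare factor |λ|^{-1/p} for the tails. -/
theorem exists_sum_rpow_le (hp : 2 < p) {C : NNReal} (hν : ν ≤ C • volume) :
    ∃ K : ℝ, 0 < K ∧ ∀ (φ : StrongDual ℝ (Lp ℝ (ENNReal.ofReal p) ν)) (S : Finset (ℤ × ℤ)),
      (∀ m ∈ S, waveEigenvalue m ≠ 0) →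
      ∑ m ∈ S, |waveEigenvalue m| ^ (1 / p - 1) * φ (waveModeLp ν p m) ^ 2 ≤ K * ‖φ‖ ^ 2 := by
  have hp0 : 0 < p := by linarith
  -- Ratio of the geometric series: X^{-1/p} = r^{b₁}·r^{b₂}.
  set r : ℝ := 2 ^ (-(1 / p)) with hr
  have hr0 : 0 < r := by positivity
  have hr1 : r < 1 := Real.rpow_lt_one_of_one_lt_of_neg (by norm_num)
    (by simp only [one_div, Left.neg_neg_iff]; positivity)
  have hsr : Summable fun b : ℕ × ℕ => r ^ b.1 * r ^ b.2 :=
    (summable_geometric_of_lt_one hr0.le hr1).mul_of_nonneg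
      (summable_geometric_of_lt_one hr0.le hr1) (fun _ => by positivity) (fun _ => by positivity)
  set K₀ : ℝ := (C : ℝ) ^ (2 / p) * 64 ^ (1 - 2 / p) with hK₀
  have hK₀n : 0 ≤ K₀ := by positivity
  set Z := ∑' b : ℕ × ℕ, r ^ b.1 * r ^ b.2 with hZ
  have hZ0 : 0 ≤ Z := tsum_nonneg fun b => by positivity
  refine ⟨K₀ * Z + 1, by positivity, fun φ S hS => ?_⟩
  classical
  have hfib : ∀ b : ℕ × ℕ, ∑ m ∈ S with dyadicBlock m = b,
      |waveEigenvalue m| ^ (1 / p - 1) * φ (waveModeLp ν p m) ^ 2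
        ≤ ‖φ‖ ^ 2 * K₀ * (r ^ b.1 * r ^ b.2) := by
    intro b
    set T := S.filter fun m => dyadicBlock m = b with hT
    set X : ℝ := 2 ^ (b.1 + b.2) with hX
    have hX0 : 0 < X := by positivity
    have hexp : (1 / p - 1 : ℝ) ≤ 0 := by
      rw [sub_nonpos, div_le_one hp0]; linarith
    have hexp2 : (0 : ℝ) ≤ 1 - 2 / p := by
      rw [sub_nonneg, div_le_one hp0]; linarith
    have hcard : (T.card : ℝ) ≤ 64 * X := by
      have := card_le_of_dyadicBlock (T := T) (b := b) fun m hm => (Finset.mem_filter.1 hm).2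
      rw [hX]
      exact_mod_cast this
    calc ∑ m ∈ T, |waveEigenvalue m| ^ (1 / p - 1) * φ (waveModeLp ν p m) ^ 2
        ≤ ∑ m ∈ T, X ^ (1 / p - 1) * φ (waveModeLp ν p m) ^ 2 := by
          refine Finset.sum_le_sum fun m hm => ?_
          have hm' := Finset.mem_filter.1 hm
          exact mul_le_mul_of_nonneg_right (Real.rpow_le_rpow_of_nonpos hX0
            (two_pow_le_of_dyadicBlock (hS m hm'.1) hm'.2) hexp) (sq_nonneg _)
      _ = X ^ (1 / p - 1) * ∑ m ∈ T, φ (waveModeLp ν p m) ^ 2 := by rw [Finset.mul_sum]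
      _ ≤ X ^ (1 / p - 1) * (‖φ‖ ^ 2 * (C : ℝ) ^ (2 / p) * (64 * X) ^ (1 - 2 / p)) := by
          gcongr
          exact (block_rpow_le hp hν φ T).trans (by gcongr)
      _ = ‖φ‖ ^ 2 * K₀ * (X ^ (1 / p - 1) * X ^ (1 - 2 / p)) := by
          rw [Real.mul_rpow (by norm_num) hX0.le]; ring
      _ = ‖φ‖ ^ 2 * K₀ * (r ^ b.1 * r ^ b.2) := by
          rw [← Real.rpow_add hX0, ← pow_add, hr, hX, ← Real.rpow_natCast 2,
            ← Real.rpow_natCast (2 ^ _), ← Real.rpow_mul (by norm_num),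
            ← Real.rpow_mul (by norm_num)]
          congr 2; ring
  calc ∑ m ∈ S, |waveEigenvalue m| ^ (1 / p - 1) * φ (waveModeLp ν p m) ^ 2
      = ∑ b ∈ S.image dyadicBlock, ∑ m ∈ S with dyadicBlock m = b,
          |waveEigenvalue m| ^ (1 / p - 1) * φ (waveModeLp ν p m) ^ 2 :=
        (Finset.sum_fiberwise_of_maps_to (fun m hm => Finset.mem_image_of_mem _ hm) _).symm
    _ ≤ ∑ b ∈ S.image dyadicBlock, ‖φ‖ ^ 2 * K₀ * (r ^ b.1 * r ^ b.2) :=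
        Finset.sum_le_sum fun b _ => hfib b
    _ = ‖φ‖ ^ 2 * K₀ * ∑ b ∈ S.image dyadicBlock, r ^ b.1 * r ^ b.2 := by rw [Finset.mul_sum]
    _ ≤ ‖φ‖ ^ 2 * K₀ * Z := by
        gcongr
        exact hsr.sum_le_tsum _ fun b _ => by positivity
    _ ≤ (K₀ * Z + 1) * ‖φ‖ ^ 2 := by nlinarith [sq_nonneg ‖φ‖]

end Weighted

/-! ### The dual quadratic form and its weak-* continuity -/

section Weighted

variable {ν : Measure WaveTorus} {p : ℝ} [Fact (1 ≤ ENNReal.ofReal p)]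

/-- Both convergences imply convergence in ν-measure, where limits are unique. It identifies limits
taken separately in H and in L^p(ν). -/
theorem ae_eq_of_tendsto {C : NNReal} (hν : ν ≤ C • volume)
    {ι : Type*} {l : Filter ι} [l.NeBot]
    [l.IsCountablyGenerated] {f : ι → Lp ℝ (ENNReal.ofReal p) ν} {V : ι → WaveH}
    {f₀ : Lp ℝ (ENNReal.ofReal p) ν} {V₀ : WaveH} (hfV : ∀ i, f i =ᵐ[ν] V i)
    (hf : Filter.Tendsto f l (nhds f₀)) (hV : Filter.Tendsto V l (nhds V₀)) : f₀ =ᵐ[ν] V₀ := by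
  have hm1 : TendstoInMeasure ν (fun i => (V i : WaveTorus → ℝ)) l f₀ :=
    (tendstoInMeasure_of_tendsto_Lp hf).congr_left hfV
  have hm3 : TendstoInMeasure ν (fun i => (V i : WaveTorus → ℝ)) l V₀ := by
    intro ε hε
    have h0 : Filter.Tendsto (fun i => (C : ENNReal) *
        volume {x | ε ≤ edist (V i x) (V₀ x)}) l (nhds 0) := by
      simpa using ENNReal.Tendsto.const_mul (tendstoInMeasure_of_tendsto_Lp hV ε hε)
        (Or.inr ENNReal.coe_ne_top)
    refine tendsto_of_tendsto_of_tendsto_of_le_of_le tendsto_const_nhds h0 (fun _ => zero_le)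
      fun i => ?_
    exact (hν _).trans (le_of_eq (by rw [Measure.smul_apply]; rfl))
  exact tendstoInMeasure_ae_unique hm1 hm3

variable [IsFiniteMeasure ν]

/-- The spare factor |λ|^{-1/p} in `exists_sum_rpow_le` is at most R^{-1/p} on the tail. Kernel
modes need no condition because their terms vanish by the convention 0⁻¹ = 0. -/
theorem exists_tail_le (hp : 2 < p) {C : NNReal} (hν : ν ≤ C • volume) :
    ∃ K : ℝ, 0 < K ∧ ∀ (R : ℝ), 0 < R →
      ∀ (φ : StrongDual ℝ (Lp ℝ (ENNReal.ofReal p) ν)) (S : Finset (ℤ × ℤ)),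
      (∀ m ∈ S, waveEigenvalue m ≠ 0 → R ≤ |waveEigenvalue m|) →
      ∑ m ∈ S, |waveEigenvalue m|⁻¹ * φ (waveModeLp ν p m) ^ 2
        ≤ R ^ (-(1 / p)) * (K * ‖φ‖ ^ 2) := by
  classical
  have hp0 : 0 < p := by linarith
  obtain ⟨K, hK, h⟩ := exists_sum_rpow_le (ν := ν) hp hν
  refine ⟨K, hK, fun R hR φ S hS => ?_⟩
  have h1 := h φ (S.filter fun m => waveEigenvalue m ≠ 0) fun m hm => (Finset.mem_filter.1 hm).2
  calc ∑ m ∈ S, |waveEigenvalue m|⁻¹ * φ (waveModeLp ν p m) ^ 2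
      = ∑ m ∈ S with waveEigenvalue m ≠ 0, |waveEigenvalue m|⁻¹ * φ (waveModeLp ν p m) ^ 2 := by
        rw [Finset.sum_filter]
        refine Finset.sum_congr rfl fun m _ => ?_
        split_ifs with hm
        · rfl
        · rw [not_not.1 hm]; simp
    _ ≤ ∑ m ∈ S with waveEigenvalue m ≠ 0,
          R ^ (-(1 / p)) * (|waveEigenvalue m| ^ (1 / p - 1) * φ (waveModeLp ν p m) ^ 2) := by
        refine Finset.sum_le_sum fun m hm => ?_
        have hm' := Finset.mem_filter.1 hm
        have hpos : 0 < |waveEigenvalue m| := abs_pos.2 hm'.2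
        rw [← mul_assoc]
        refine mul_le_mul_of_nonneg_right ?_ (sq_nonneg _)
        have h2 : |waveEigenvalue m|⁻¹
            = |waveEigenvalue m| ^ (-(1 / p)) * |waveEigenvalue m| ^ (1 / p - 1) := by
          rw [← Real.rpow_add hpos, ← Real.rpow_neg_one]; congr 1; ring
        rw [h2]
        refine mul_le_mul_of_nonneg_right ?_ (by positivity)
        exact Real.rpow_le_rpow_of_nonpos hR (hS m hm'.1 hm'.2)
          (by simp only [one_div, Left.neg_nonpos_iff]; positivity)
    _ = R ^ (-(1 / p)) * ∑ m ∈ S with waveEigenvalue m ≠ 0,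
          (|waveEigenvalue m| ^ (1 / p - 1) * φ (waveModeLp ν p m) ^ 2) := by rw [Finset.mul_sum]
    _ ≤ _ := by gcongr

theorem exists_sum_inv_le (hp : 2 < p) {C : NNReal} (hν : ν ≤ C • volume) :
    ∃ K : ℝ, 0 < K ∧ ∀ (φ : StrongDual ℝ (Lp ℝ (ENNReal.ofReal p) ν)) (S : Finset (ℤ × ℤ)),
      ∑ m ∈ S, |waveEigenvalue m|⁻¹ * φ (waveModeLp ν p m) ^ 2 ≤ K * ‖φ‖ ^ 2 := by
  obtain ⟨K, hK, h⟩ := exists_tail_le (ν := ν) hp hν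
  refine ⟨K, hK, fun φ S => ?_⟩
  simpa using h 1 one_pos φ S fun m _ hm => one_le_abs_waveEigenvalue hm

theorem summable_inv_mul_sq (hp : 2 < p) {C : NNReal} (hν : ν ≤ C • volume)
    (φ : StrongDual ℝ (Lp ℝ (ENNReal.ofReal p) ν)) :
    Summable fun m => |waveEigenvalue m|⁻¹ * φ (waveModeLp ν p m) ^ 2 := by
  obtain ⟨K, hK, h⟩ := exists_sum_inv_le (ν := ν) hp hν
  exact summable_of_sum_le (fun m => by positivity) (h φ)

/-- The quadratic form `φ ↦ ⟨L⁻¹φ, φ⟩` on the dual of a weighted Lebesgue space. -/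
def dualForm (ν : Measure WaveTorus) [IsFiniteMeasure ν] (p : ℝ)
    (φ : Lp ℝ (ENNReal.ofReal p) ν → ℝ) : ℝ :=
  ∑' m, (waveEigenvalue m)⁻¹ * φ (waveModeLp ν p m) ^ 2

theorem summable_dualForm (hp : 2 < p) {C : NNReal} (hν : ν ≤ C • volume)
    (φ : StrongDual ℝ (Lp ℝ (ENNReal.ofReal p) ν)) :
    Summable fun m => (waveEigenvalue m)⁻¹ * φ (waveModeLp ν p m) ^ 2 := by
  refine Summable.of_norm ((summable_inv_mul_sq hp hν φ).congr fun m => ?_)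
  rw [Real.norm_eq_abs, abs_mul, abs_inv, abs_of_nonneg (sq_nonneg (φ (waveModeLp ν p m)))]

/-- On the unit ball the partial sums converge uniformly, by `exists_tail_le` and the finiteness of
the nonzero spectrum below R, and each partial sum is a polynomial in finitely many evaluations.
This is the compactness of L⁻¹ in weak-* form. -/
theorem continuousOn_dualForm (hp : 2 < p) {C : NNReal} (hν : ν ≤ C • volume) :
    ContinuousOn (fun φ : WeakDual ℝ (Lp ℝ (ENNReal.ofReal p) ν) => dualForm ν p φ)
      (WeakDual.toStrongDual ⁻¹' Metric.closedBall 0 1) := by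
  have hp0 : 0 < p := by linarith
  obtain ⟨K, hK, h⟩ := exists_tail_le (ν := ν) hp hν
  have hunif : TendstoUniformlyOn
      (fun (S : Finset (ℤ × ℤ)) (φ : WeakDual ℝ (Lp ℝ (ENNReal.ofReal p) ν)) =>
        ∑ m ∈ S, (waveEigenvalue m)⁻¹ * φ (waveModeLp ν p m) ^ 2)
      (fun φ => dualForm ν p φ) Filter.atTop
      (WeakDual.toStrongDual ⁻¹' Metric.closedBall 0 1) := by
    rw [Metric.tendstoUniformlyOn_iff]
    intro ε hε
    have hlim : Filter.Tendsto (fun R : ℝ => R ^ (-(1 / p)) * K) Filter.atTop (nhds 0) := by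
      simpa using (tendsto_rpow_neg_atTop (by positivity : 0 < 1 / p)).mul_const K
    obtain ⟨R, hR1, hR2⟩ := ((hlim.eventually (gt_mem_nhds hε)).and
      (Filter.eventually_gt_atTop 0)).exists
    filter_upwards [Filter.eventually_ge_atTop (finite_waveEigenvalue_lt R).toFinset] with S hS φ hφ
    set ψ : StrongDual ℝ (Lp ℝ (ENNReal.ofReal p) ν) := WeakDual.toStrongDual φ with hψ
    have hψ1 : ‖ψ‖ ≤ 1 := by simpa using hφ
    have hs := summable_dualForm hp hν ψ
    have hsa := summable_inv_mul_sq hp hν ψ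
    have hsplit := hs.sum_add_tsum_compl (s := S)
    rw [Real.dist_eq]
    have heq : dualForm ν p φ - ∑ m ∈ S, (waveEigenvalue m)⁻¹ * φ (waveModeLp ν p m) ^ 2
        = ∑' m : ↥((S : Set (ℤ × ℤ))ᶜ), (waveEigenvalue m)⁻¹ * ψ (waveModeLp ν p m) ^ 2 :=
      (eq_sub_of_add_eq' hsplit).symm
    rw [heq]
    refine lt_of_le_of_lt ?_ hR1
    rw [← Real.norm_eq_abs]
    refine tsum_of_norm_bounded (hsa.subtype _).hasSum (fun m => ?_) |>.trans ?_
    · simp only [Function.comp_apply]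
      rw [norm_mul, norm_inv, Real.norm_eq_abs, Real.norm_eq_abs,
        abs_of_nonneg (sq_nonneg (ψ (waveModeLp ν p m)))]
    · refine (hsa.subtype _).tsum_le_of_sum_le fun T => ?_
      classical
      have h1 := h R hR2 ψ (T.map (Function.Embedding.subtype _)) (by
        intro m hm hm0
        obtain ⟨m', -, rfl⟩ := Finset.mem_map.1 hm
        by_contra hlt
        exact m'.2 (hS ((Set.Finite.mem_toFinset _).2 ⟨hm0, not_le.1 hlt⟩)))
      rw [Finset.sum_map] at h1
      refine h1.trans ?_
      gcongr
      have : ‖ψ‖ ^ 2 ≤ 1 := pow_le_one₀ (norm_nonneg _) hψ1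
      nlinarith
  refine hunif.continuousOn (Filter.Eventually.of_forall fun S => ?_).frequently
  refine Continuous.continuousOn (continuous_finsetSum _ fun m _ => ?_)
  exact continuous_const.mul ((WeakDual.eval_continuous _).pow 2)

/-- Dual to the bound on Σ |λ|⁻¹ φ(e_m)²: apply a norming functional and Cauchy-Schwarz with weights
|λ|^{±1/2}. Away from the kernel, finite energy thus embeds into L^p(ν). -/
theorem exists_norm_sum_sq_le (hp : 2 < p) {C : NNReal} (hν : ν ≤ C • volume) :
    ∃ K : ℝ, 0 < K ∧ ∀ (c : ℤ × ℤ → ℝ), (∀ m, waveEigenvalue m = 0 → c m = 0) →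
      ∀ S : Finset (ℤ × ℤ), ‖∑ m ∈ S, c m • waveModeLp ν p m‖ ^ 2
        ≤ K * ∑ m ∈ S, |waveEigenvalue m| * c m ^ 2 := by
  obtain ⟨K, hK, h⟩ := exists_sum_inv_le (ν := ν) hp hν
  refine ⟨K, hK, fun c hc S => ?_⟩
  obtain ⟨φ, hφ1, hφ⟩ := exists_dual_vector'' ℝ (∑ m ∈ S, c m • waveModeLp ν p m)
  have h1 : ‖∑ m ∈ S, c m • waveModeLp ν p m‖
      = ∑ m ∈ S, (Real.sqrt |waveEigenvalue m| * c m)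
        * ((Real.sqrt |waveEigenvalue m|)⁻¹ * φ (waveModeLp ν p m)) := by
    have h2 : ((‖∑ m ∈ S, c m • waveModeLp ν p m‖ : ℝ) : ℝ)
        = φ (∑ m ∈ S, c m • waveModeLp ν p m) := hφ.symm
    rw [h2, map_sum]
    refine Finset.sum_congr rfl fun m _ => ?_
    rw [map_smul, smul_eq_mul]
    by_cases hm : waveEigenvalue m = 0
    · simp [hc m hm]
    · have : Real.sqrt |waveEigenvalue m| ≠ 0 := (Real.sqrt_pos.2 (abs_pos.2 hm)).ne'
      field_simp
  rw [h1]
  refine (Finset.sum_mul_sq_le_sq_mul_sq _ _ _).trans ?_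
  have h3 : ∀ m, (Real.sqrt |waveEigenvalue m| * c m) ^ 2 = |waveEigenvalue m| * c m ^ 2 := by
    intro m; rw [mul_pow, Real.sq_sqrt (abs_nonneg _)]
  have h4 : ∀ m, ((Real.sqrt |waveEigenvalue m|)⁻¹ * φ (waveModeLp ν p m)) ^ 2
      = |waveEigenvalue m|⁻¹ * φ (waveModeLp ν p m) ^ 2 := by
    intro m; rw [mul_pow, inv_pow, Real.sq_sqrt (abs_nonneg _)]
  simp only [h3, h4]
  rw [mul_comm K]
  refine mul_le_mul_of_nonneg_left ((h φ S).trans ?_) (Finset.sum_nonneg fun m _ => by positivity)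
  have : ‖φ‖ ^ 2 ≤ 1 := pow_le_one₀ (norm_nonneg _) hφ1
  nlinarith

/-- A series of modes with finite energy converges in `H` and in the weighted Lebesgue space, to
the same function. -/
theorem exists_hasSum_modes (hp : 2 < p) {C : NNReal} (hν : ν ≤ C • volume) {c : ℤ × ℤ → ℝ}
    (hc : ∀ m, waveEigenvalue m = 0 → c m = 0)
    (hs : Summable fun m => |waveEigenvalue m| * c m ^ 2) :
    ∃ (V : WaveH) (h : Lp ℝ (ENNReal.ofReal p) ν), h =ᵐ[ν] V ∧ (∀ m, waveCoeff V m = c m) ∧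
      HasSum (fun m => c m • waveModeLp ν p m) h := by
  obtain ⟨K, hK, hb⟩ := exists_norm_sum_sq_le (ν := ν) hp hν
  have hsc : Summable fun m => c m ^ 2 := by
    refine Summable.of_nonneg_of_le (fun m => sq_nonneg _) (fun m => ?_) hs
    by_cases hm : waveEigenvalue m = 0
    · simp [hc m hm]
    · exact le_mul_of_one_le_left (sq_nonneg _) (one_le_abs_waveEigenvalue hm)
  obtain ⟨V, hV, hVs⟩ := exists_waveCoeff_eq hsc
  have hsum : Summable fun m => c m • waveModeLp ν p m := by
    rw [summable_iff_vanishing_norm]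
    intro ε hε
    obtain ⟨s, hs'⟩ := summable_iff_vanishing_norm.1 hs (ε ^ 2 / K) (by positivity)
    refine ⟨s, fun t ht => ?_⟩
    have h1 := hs' t ht
    rw [Real.norm_of_nonneg (Finset.sum_nonneg fun m _ => by positivity), lt_div_iff₀' hK] at h1
    exact lt_of_pow_lt_pow_left₀ 2 hε.le ((hb c hc t).trans_lt h1)
  obtain ⟨h, hh⟩ := hsum
  refine ⟨V, h, ?_, hV, hh⟩
  have hac : ν ≪ volume := (Measure.absolutelyContinuous_of_le hν).trans
    (Measure.smul_absolutelyContinuous)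
  refine ae_eq_of_tendsto hν (fun S => ?_) hh hVs
  exact (coeFn_sum_smul S c (waveModeLp ν p) coeFn_waveModeLp).trans
    (hac.ae_eq (coeFn_sum_smul S c waveModeH coeFn_waveModeH)).symm

end Weighted

/-! ### The kernel inside L^p(ν) and the power duality map -/

section Weighted

variable {ν : Measure WaveTorus} {p : ℝ}

/-- The kernel of the wave operator is controlled by its values with respect to `ν`. -/
def ObservableKernel (ν : Measure WaveTorus) : Prop :=
  ∃ K : ENNReal, K ≠ ⊤ ∧ ∀ n ∈ waveKernel, ∫⁻ z, ‖n z‖ₑ ^ 2 ≤ K * ∫⁻ z, ‖n z‖ₑ ^ 2 ∂ν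

theorem isClosed_waveKernel : IsClosed (waveKernel : Set WaveH) := by
  have : (waveKernel : Set WaveH)
      = ⋂ (m : ℤ × ℤ) (_ : waveEigenvalue m ≠ 0), {u | inner ℝ (waveModeH m) u = 0} := by
    ext u
    simp only [Set.mem_iInter, Set.mem_ofPred_eq, inner_waveModeH]
    rfl
  rw [this]
  exact isClosed_iInter fun m => isClosed_iInter fun _ =>
    isClosed_eq (by fun_prop) continuous_const

theorem absolutelyContinuous_of_le_smul {C : NNReal} (hν : ν ≤ C • volume) : ν ≪ volume :=
  (Measure.absolutelyContinuous_of_le hν).trans Measure.smul_absolutelyContinuous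

/-- The elements of the weighted Lebesgue space which are represented by the kernel of the wave
operator. -/
def kernelLp (ν : Measure WaveTorus) (hν : ν ≪ volume) (p : ℝ) :
    Submodule ℝ (Lp ℝ (ENNReal.ofReal p) ν) where
  carrier := {h | ∃ n ∈ waveKernel, h =ᵐ[ν] n}
  add_mem' := by
    rintro h₁ h₂ ⟨n₁, hn₁, e₁⟩ ⟨n₂, hn₂, e₂⟩
    refine ⟨n₁ + n₂, waveKernel.add_mem hn₁ hn₂, ?_⟩
    filter_upwards [e₁, e₂, Lp.coeFn_add h₁ h₂, hν.ae_eq (Lp.coeFn_add n₁ n₂)] with z a b c d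
    rw [c, d, Pi.add_apply, Pi.add_apply, a, b]
  zero_mem' := ⟨0, waveKernel.zero_mem, by
    filter_upwards [Lp.coeFn_zero ℝ (ENNReal.ofReal p) ν, hν.ae_eq (Lp.coeFn_zero ℝ 2 volume)]
      with z a b
    rw [a, b]⟩
  smul_mem' := by
    rintro c h ⟨n, hn, e⟩
    refine ⟨c • n, waveKernel.smul_mem c hn, ?_⟩
    filter_upwards [e, Lp.coeFn_smul c h, hν.ae_eq (Lp.coeFn_smul c n)] with z a b d
    rw [b, d, Pi.smul_apply, Pi.smul_apply, a]

theorem holderConjugate_of_two_lt (hp : 2 < p) : p.HolderConjugate (p / (p - 1)) :=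
  Real.HolderConjugate.conjExponent (by linarith)

theorem memLp_abs_rpow_mul (hp : 2 < p) (f : Lp ℝ (ENNReal.ofReal p) ν) :
    MemLp (fun z => |f z| ^ (p - 2) * f z) (ENNReal.ofReal (p / (p - 1))) ν := by
  have h1 := (Lp.memLp f).norm_rpow_div (ENNReal.ofReal (p - 1))
  rw [ENNReal.toReal_ofReal (by linarith), ← ENNReal.ofReal_div_of_pos (by linarith)] at h1
  refine h1.congr_norm ?_ ?_
  · exact ((Lp.memLp f).1.norm.aemeasurable.pow_const _).aestronglyMeasurable.mul (Lp.memLp f).1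
  · refine Filter.Eventually.of_forall fun z => ?_
    rcases eq_or_ne (f z) 0 with h | h
    · rw [h]; simp; exact Real.zero_rpow (by linarith)
    · rw [Real.norm_of_nonneg (by positivity), Real.norm_eq_abs, Real.norm_eq_abs, abs_mul,
        abs_of_nonneg (by positivity : 0 ≤ |f z| ^ (p - 2)),
        ← Real.rpow_add_one (abs_ne_zero.2 h)]
      congr 1; ring

theorem abs_rpow_conj (hp : 2 < p) (a : ℝ) :
    |(|a| ^ (p - 2) * a)| ^ (p / (p - 1)) = |a| ^ p := by
  have h1 : p - 1 ≠ 0 := by linarith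
  rcases eq_or_ne a 0 with h | h
  · rw [h]; simp [Real.zero_rpow, h1, (by linarith : p ≠ 0)]
  · rw [abs_mul, abs_of_nonneg (by positivity : 0 ≤ |a| ^ (p - 2)),
      ← Real.rpow_add_one (abs_ne_zero.2 h), ← Real.rpow_mul (abs_nonneg _)]
    congr 1; field_simp; ring

theorem integrable_powPairing (hp : 2 < p) (f h : Lp ℝ (ENNReal.ofReal p) ν) :
    Integrable (fun z => |f z| ^ (p - 2) * f z * h z) ν := by
  have := (holderConjugate_of_two_lt hp).symm.ennrealOfReal
  exact (memLp_abs_rpow_mul hp f).integrable_mul (Lp.memLp h)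

section Dual

variable [Fact (1 ≤ ENNReal.ofReal p)]

theorem abs_powPairing_le (hp : 2 < p) (f h : Lp ℝ (ENNReal.ofReal p) ν) :
    |∫ z, |f z| ^ (p - 2) * f z * h z ∂ν| ≤ ‖f‖ ^ (p - 1) * ‖h‖ := by
  have hp0 : 0 < p := by linarith
  have hH := integral_mul_norm_le_Lp_mul_Lq (holderConjugate_of_two_lt hp).symm
    (memLp_abs_rpow_mul hp f) (Lp.memLp h)
  simp only [Real.norm_eq_abs, abs_rpow_conj hp] at hH
  rw [← lp_norm_rpow hp, ← lp_norm_rpow hp, ← Real.rpow_mul (norm_nonneg _),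
    ← Real.rpow_mul (norm_nonneg _), mul_one_div_cancel hp0.ne', Real.rpow_one] at hH
  have e : p * (1 / (p / (p - 1))) = p - 1 := by field_simp
  rw [e] at hH
  refine le_trans ?_ hH
  refine (abs_integral_le_integral_abs).trans (le_of_eq ?_)
  simp only [abs_mul]

/-- The functional `h ↦ ∫ |f|^{p-2} f h`. -/
def powDual (hp : 2 < p) (f : Lp ℝ (ENNReal.ofReal p) ν) :
    StrongDual ℝ (Lp ℝ (ENNReal.ofReal p) ν) :=
  LinearMap.mkContinuous
    { toFun := fun h => ∫ z, |f z| ^ (p - 2) * f z * h z ∂ν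
      map_add' := fun h₁ h₂ => by
        rw [← integral_add (integrable_powPairing hp f h₁) (integrable_powPairing hp f h₂)]
        refine integral_congr_ae ?_
        filter_upwards [Lp.coeFn_add h₁ h₂] with z hz
        rw [hz, Pi.add_apply]; ring
      map_smul' := fun c h => by
        rw [RingHom.id_apply, smul_eq_mul, ← integral_const_mul]
        refine integral_congr_ae ?_
        filter_upwards [Lp.coeFn_smul c h] with z hz
        rw [hz, Pi.smul_apply, smul_eq_mul]; ring } (‖f‖ ^ (p - 1)) (abs_powPairing_le hp f)

theorem powDual_apply (hp : 2 < p) (f h : Lp ℝ (ENNReal.ofReal p) ν) :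
    powDual hp f h = ∫ z, |f z| ^ (p - 2) * f z * h z ∂ν := rfl

theorem norm_powDual_le (hp : 2 < p) (f : Lp ℝ (ENNReal.ofReal p) ν) :
    ‖powDual hp f‖ ≤ ‖f‖ ^ (p - 1) :=
  LinearMap.mkContinuous_norm_le _ (by positivity) _

theorem powDual_self (hp : 2 < p) (f : Lp ℝ (ENNReal.ofReal p) ν) :
    powDual hp f f = ‖f‖ ^ p := by
  rw [powDual_apply, lp_norm_rpow hp]
  refine integral_congr_ae (Filter.Eventually.of_forall fun z => ?_)
  simp only
  rcases eq_or_ne (f z) 0 with h | h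
  · rw [h]; simp [(by linarith : p ≠ 0)]
  · rw [mul_assoc, ← sq, ← sq_abs, ← Real.rpow_natCast, ← Real.rpow_add (abs_pos.2 h)]
    congr 1; push_cast; ring

theorem powDual_smul (hp : 2 < p) {t : ℝ} (ht : 0 < t) (f : Lp ℝ (ENNReal.ofReal p) ν) :
    powDual hp (t • f) = t ^ (p - 1) • powDual hp f := by
  ext h
  rw [_root_.smul_apply, powDual_apply, powDual_apply, smul_eq_mul, ← integral_const_mul]
  refine integral_congr_ae ?_
  filter_upwards [Lp.coeFn_smul t f] with z hz
  have e : t ^ (p - 1) = t ^ (p - 2) * t := by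
    rw [← Real.rpow_add_one ht.ne']; congr 1; ring
  rw [hz, Pi.smul_apply, smul_eq_mul, abs_mul, abs_of_pos ht, Real.mul_rpow ht.le (abs_nonneg _), e]
  ring

end Dual

variable [IsFiniteMeasure ν]

/-- Observability bounds the norm in H by the one in L²(ν), and Hölder's inequality on the finite
measure ν bounds that by the norm in L^p(ν). -/
theorem ObservableKernel.exists_norm_le (hp : 2 < p) (hO : ObservableKernel ν) :
    ∃ K : ℝ, 0 ≤ K ∧ ∀ n ∈ waveKernel, ∀ h : Lp ℝ (ENNReal.ofReal p) ν, h =ᵐ[ν] n →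
      ‖n‖ ≤ K * ‖h‖ := by
  obtain ⟨K, hK, hKn⟩ := hO
  have h2 : ∀ (κ : Measure WaveTorus) (f : WaveTorus → ℝ),
      eLpNorm f 2 κ ^ (2 : ℝ) = ∫⁻ z, ‖f z‖ₑ ^ 2 ∂κ := by
    intro κ f
    have := eLpNorm_nnreal_pow_eq_lintegral (μ := κ) (f := f) (p := 2) (by norm_num)
    simpa using this
  set s : ℝ := 1 / (2 : ENNReal).toReal - 1 / (ENNReal.ofReal p).toReal with hs
  have hs0 : 0 ≤ s := by
    rw [hs, toReal_ofReal_of_two_lt hp, sub_nonneg, ENNReal.toReal_ofNat]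
    exact one_div_le_one_div_of_le (by norm_num) hp.le
  have hfin : K ^ (1 / 2 : ℝ) * ν Set.univ ^ s ≠ ⊤ :=
    ENNReal.mul_ne_top (ENNReal.rpow_ne_top_of_nonneg (by norm_num) hK)
      (ENNReal.rpow_ne_top_of_nonneg hs0 (measure_ne_top _ _))
  refine ⟨(K ^ (1 / 2 : ℝ) * ν Set.univ ^ s).toReal, ENNReal.toReal_nonneg, fun n hn h hhn => ?_⟩
  have h3 : eLpNorm n 2 volume ≤ K ^ (1 / 2 : ℝ) * eLpNorm n 2 ν := by
    have h4 := hKn n hn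
    rw [← h2, ← h2] at h4
    have h5 := ENNReal.rpow_le_rpow h4 (by norm_num : (0 : ℝ) ≤ 1 / 2)
    rw [ENNReal.mul_rpow_of_nonneg _ _ (by norm_num), ← ENNReal.rpow_mul, ← ENNReal.rpow_mul] at h5
    simpa using h5
  have h4 : eLpNorm n 2 ν ≤ eLpNorm h (ENNReal.ofReal p) ν * ν Set.univ ^ s := by
    rw [← eLpNorm_congr_ae hhn]
    refine eLpNorm_le_eLpNorm_mul_rpow_measure_univ ?_ (Lp.memLp h).1
    rw [show (2 : ENNReal) = ENNReal.ofReal 2 by simp]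
    exact ENNReal.ofReal_le_ofReal hp.le
  rw [Lp.norm_def, Lp.norm_def, ← ENNReal.toReal_mul]
  refine ENNReal.toReal_mono (ENNReal.mul_ne_top hfin (Lp.memLp h).2.ne) ?_
  calc eLpNorm n 2 volume ≤ K ^ (1 / 2 : ℝ) * (eLpNorm h (ENNReal.ofReal p) ν * ν Set.univ ^ s) :=
        h3.trans (by gcongr)
    _ = _ := by ring

variable [Fact (1 ≤ ENNReal.ofReal p)]

/-- By the observability estimate, representatives of a convergent sequence are Cauchy in H; their
limit lies in the closed kernel of L and represents the L^p limit. -/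
theorem isClosed_kernelLp (hp : 2 < p) {C : NNReal} (hν : ν ≤ C • volume) (hac : ν ≪ volume)
    (hO : ObservableKernel ν) :
    IsClosed (kernelLp ν hac p : Set (Lp ℝ (ENNReal.ofReal p) ν)) := by
  obtain ⟨K, hK, hb⟩ := hO.exists_norm_le hp
  refine IsSeqClosed.isClosed fun h h₀ hmem hlim => ?_
  choose n hn e using hmem
  have hcau : CauchySeq n := by
    rw [Metric.cauchySeq_iff]
    intro ε hε
    obtain ⟨N, hN⟩ := Metric.cauchySeq_iff.1 hlim.cauchySeq (ε / (K + 1)) (by positivity)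
    refine ⟨N, fun i hi j hj => ?_⟩
    have h1 : (h i - h j : Lp ℝ (ENNReal.ofReal p) ν) =ᵐ[ν] (n i - n j : WaveH) := by
      filter_upwards [e i, e j, Lp.coeFn_sub (h i) (h j), hac.ae_eq (Lp.coeFn_sub (n i) (n j))]
        with z a b c d
      rw [c, d, Pi.sub_apply, Pi.sub_apply, a, b]
    have h2 := hb _ (waveKernel.sub_mem (hn i) (hn j)) _ h1
    rw [← dist_eq_norm, ← dist_eq_norm] at h2
    have h3 := hN i hi j hj
    rw [lt_div_iff₀ (by positivity)] at h3
    nlinarith [dist_nonneg (x := h i) (y := h j)]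
  obtain ⟨n₀, hn₀⟩ := cauchySeq_tendsto_of_complete hcau
  exact ⟨n₀, isClosed_waveKernel.mem_of_tendsto hn₀ (Filter.Eventually.of_forall hn),
    ae_eq_of_tendsto hν e hlim hn₀⟩

end Weighted

/-! ### Maximizers of the dual form -/

section Maximizer

variable {ν : Measure WaveTorus} [IsFiniteMeasure ν] {p : ℝ} [Fact (1 ≤ ENNReal.ofReal p)]

theorem dualForm_smul (a : ℝ) (φ : StrongDual ℝ (Lp ℝ (ENNReal.ofReal p) ν)) :
    dualForm ν p (a • φ) = a ^ 2 * dualForm ν p φ := by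
  rw [dualForm, dualForm, ← tsum_mul_left]
  refine tsum_congr fun m => ?_
  rw [Pi.smul_apply, smul_eq_mul]; ring

/-- Banach-Alaoglu: the unit ball intersected with the annihilator of Y is weak-* compact.
Homogeneity of degree 2 turns maximality on the ball into the scaled inequality, and `φ₁` excludes a
nonpositive maximum. -/
theorem exists_dualForm_maximizer (hp : 2 < p) {C : NNReal} (hν : ν ≤ C • volume)
    (Y : Submodule ℝ (Lp ℝ (ENNReal.ofReal p) ν)) {φ₁ : StrongDual ℝ (Lp ℝ (ENNReal.ofReal p) ν)}
    (h₁ : ∀ y ∈ Y, φ₁ y = 0) (hpos : 0 < dualForm ν p φ₁) :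
    ∃ φ : StrongDual ℝ (Lp ℝ (ENNReal.ofReal p) ν), ‖φ‖ ≤ 1 ∧ (∀ y ∈ Y, φ y = 0) ∧
      0 < dualForm ν p φ ∧ ∀ ψ : StrongDual ℝ (Lp ℝ (ENNReal.ofReal p) ν), (∀ y ∈ Y, ψ y = 0) →
        dualForm ν p ψ ≤ dualForm ν p φ * ‖ψ‖ ^ 2 := by
  set B : Set (WeakDual ℝ (Lp ℝ (ENNReal.ofReal p) ν)) :=
    (WeakDual.toStrongDual ⁻¹' Metric.closedBall 0 1) ∩ ⋂ y ∈ Y, {φ | φ y = 0} with hB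
  have hcomp : IsCompact B :=
    (WeakDual.isCompact_closedBall 0 1).inter_right (isClosed_iInter fun y => isClosed_iInter
      fun _ => isClosed_eq (WeakDual.eval_continuous y) continuous_const)
  have hcont : ContinuousOn (fun φ : WeakDual ℝ (Lp ℝ (ENNReal.ofReal p) ν) => dualForm ν p φ) B :=
    (continuousOn_dualForm hp hν).mono Set.inter_subset_left
  have hmem : ∀ ψ : StrongDual ℝ (Lp ℝ (ENNReal.ofReal p) ν), ‖ψ‖ ≤ 1 → (∀ y ∈ Y, ψ y = 0) →
      StrongDual.toWeakDual ψ ∈ B := by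
    intro ψ h1 h2
    refine ⟨by simpa using h1, ?_⟩
    simp only [Set.mem_iInter]
    exact h2
  obtain ⟨φ, hφB, hφ⟩ := hcomp.exists_isMaxOn ⟨_, hmem 0 (by simp) (by simp)⟩ hcont
  have hφ2 := hφB.2
  simp only [Set.mem_iInter] at hφ2
  have hscale : ∀ ψ : StrongDual ℝ (Lp ℝ (ENNReal.ofReal p) ν), (∀ y ∈ Y, ψ y = 0) →
      dualForm ν p ψ ≤ dualForm ν p φ * ‖ψ‖ ^ 2 := by
    intro ψ hψ
    rcases eq_or_ne ψ 0 with rfl | h0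
    · simp [dualForm]
    · have hn : 0 < ‖ψ‖ := norm_pos_iff.2 h0
      have h2 : dualForm ν p (‖ψ‖⁻¹ • ψ : StrongDual ℝ (Lp ℝ (ENNReal.ofReal p) ν))
          ≤ dualForm ν p φ := hφ (hmem (‖ψ‖⁻¹ • ψ)
        (by rw [norm_smul, norm_inv, norm_norm, inv_mul_cancel₀ hn.ne'])
        fun y hy => by rw [_root_.smul_apply, hψ y hy, smul_zero])
      have h3 := dualForm_smul ‖ψ‖⁻¹ ψ
      have h4 : (‖ψ‖⁻¹) ^ 2 * dualForm ν p ψ ≤ dualForm ν p φ := h3 ▸ h2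
      rw [inv_pow, inv_mul_le_iff₀ (by positivity)] at h4
      linarith
  refine ⟨WeakDual.toStrongDual φ, by simpa using hφB.1, hφ2, ?_, hscale⟩
  have h5 := hscale φ₁ h₁
  by_contra hcon
  have h6 : dualForm ν p φ ≤ 0 := not_lt.1 hcon
  nlinarith [sq_nonneg ‖φ₁‖]

/-- Expansion of a quadratic form: g plays the role of L⁻¹φ, so the cross term ⟨L⁻¹φ, δ⟩ is δ(g). -/
theorem dualForm_add_smul (hp : 2 < p) {C : NNReal} (hν : ν ≤ C • volume)
    {φ : StrongDual ℝ (Lp ℝ (ENNReal.ofReal p) ν)} {g : Lp ℝ (ENNReal.ofReal p) ν}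
    (hg : HasSum (fun m => ((waveEigenvalue m)⁻¹ * φ (waveModeLp ν p m)) • waveModeLp ν p m) g)
    (δ : StrongDual ℝ (Lp ℝ (ENNReal.ofReal p) ν)) (s : ℝ) :
    dualForm ν p (φ + s • δ) = dualForm ν p φ + 2 * s * δ g + s ^ 2 * dualForm ν p δ := by
  have h1 := (summable_dualForm hp hν φ).hasSum
  have h2 := (summable_dualForm hp hν δ).hasSum.mul_left (s ^ 2)
  have h3 := (δ.hasSum hg).mul_left (2 * s)
  refine ((h1.add h3).add h2).tsum_eq.symm ▸ ?_
  refine tsum_congr fun m => ?_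
  simp only [Pi.add_apply, Pi.smul_apply, smul_eq_mul, map_smul]
  ring

/-- The maximizer of the dual form provides a solution of the Euler-Lagrange equation. -/
theorem exists_of_dualForm_maximizer (hp : 2 < p) {C : NNReal} (hν : ν ≤ C • volume)
    (hac : ν ≪ volume) (hO : ObservableKernel ν)
    {φ : StrongDual ℝ (Lp ℝ (ENNReal.ofReal p) ν)} (hφ : ‖φ‖ ≤ 1)
    (hφY : ∀ y ∈ kernelLp ν hac p, φ y = 0) (hpos : 0 < dualForm ν p φ)
    (hmax : ∀ ψ : StrongDual ℝ (Lp ℝ (ENNReal.ofReal p) ν), (∀ y ∈ kernelLp ν hac p, ψ y = 0) →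
        dualForm ν p ψ ≤ dualForm ν p φ * ‖ψ‖ ^ 2) :
    ∃ (u : WaveH) (z : Lp ℝ (ENNReal.ofReal p) ν), z =ᵐ[ν] u ∧
      (∀ m, waveEigenvalue m * waveCoeff u m = φ (waveModeLp ν p m)) ∧
      Summable (fun m => |waveEigenvalue m| * waveCoeff u m ^ 2) ∧
      ‖z‖ = dualForm ν p φ ∧ ∀ h, dualForm ν p φ ^ (p - 1) * φ h = powDual hp z h := by
  set Y := kernelLp ν hac p with hY
  have hYc : IsClosed (Y : Set (Lp ℝ (ENNReal.ofReal p) ν)) := isClosed_kernelLp hp hν hac hO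
  set μ := dualForm ν p φ with hμ
  -- Coefficients of L⁻¹φ, zero on the kernel modes.
  set c : ℤ × ℤ → ℝ := fun m => (waveEigenvalue m)⁻¹ * φ (waveModeLp ν p m) with hc
  have hcs : ∀ m, |waveEigenvalue m| * c m ^ 2
      = |waveEigenvalue m|⁻¹ * φ (waveModeLp ν p m) ^ 2 := by
    intro m
    by_cases hm : waveEigenvalue m = 0
    · simp [hm]
    · have : |waveEigenvalue m| ≠ 0 := abs_ne_zero.2 hm
      rw [hc]
      simp only [mul_pow, inv_pow]
      rw [← sq_abs (waveEigenvalue m)]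
      field_simp
  have hsum : Summable fun m => |waveEigenvalue m| * c m ^ 2 :=
    (summable_inv_mul_sq hp hν φ).congr fun m => (hcs m).symm
  obtain ⟨V, g, hgV, hVc, hg⟩ := exists_hasSum_modes (ν := ν) hp hν
    (c := c) (fun m hm => by simp [hc, hm]) hsum
  have hφg : φ g = μ := by
    rw [hμ, dualForm, ← (φ.hasSum hg).tsum_eq]
    refine tsum_congr fun m => ?_
    rw [map_smul, smul_eq_mul, hc]; ring
  -- First-order condition on a convex set: the derivative of the form at φ in the direction ψ - φ,
  -- namely 2(ψ - φ)(g), is nonpositive.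
  have hψg : ∀ ψ : StrongDual ℝ (Lp ℝ (ENNReal.ofReal p) ν), ‖ψ‖ ≤ 1 → (∀ y ∈ Y, ψ y = 0) →
      ψ g ≤ μ := by
    intro ψ hψ1 hψY
    rw [← hφg, ← sub_nonpos, ← _root_.sub_apply]
    set δ := ψ - φ with hδ
    by_contra hcon
    have hd : 0 < δ g := not_le.1 hcon
    set A := |dualForm ν p δ| with hA
    have hA0 : 0 ≤ A := abs_nonneg _
    -- A step so short that sA ≤ δ(g): the linear gain 2sδ(g) then beats the quadratic loss s²A.
    set s := δ g / (δ g + A) with hs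
    have hs0 : 0 < s := by positivity
    have hs1 : s ≤ 1 := by rw [hs, div_le_one (by positivity)]; linarith
    have hexp := dualForm_add_smul hp hν hg δ s
    have hle : dualForm ν p (φ + s • δ : StrongDual ℝ (Lp ℝ (ENNReal.ofReal p) ν)) ≤ μ := by
      have hY2 : ∀ y ∈ Y, (φ + s • δ) y = 0 := fun y hy => by
        rw [_root_.add_apply, _root_.smul_apply, hδ, _root_.sub_apply, hφY y hy, hψY y hy]
        simp
      have hn : ‖φ + s • δ‖ ≤ 1 := by
        have e : φ + s • δ = (1 - s) • φ + s • ψ := by rw [hδ]; module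
        rw [e]
        refine (norm_add_le _ _).trans ?_
        rw [norm_smul, norm_smul, Real.norm_of_nonneg (by linarith), Real.norm_of_nonneg hs0.le]
        nlinarith
      refine (hmax _ hY2).trans ?_
      have : ‖φ + s • δ‖ ^ 2 ≤ 1 := pow_le_one₀ (norm_nonneg _) hn
      nlinarith
    have hexp2 : dualForm ν p (φ + s • δ : StrongDual ℝ (Lp ℝ (ENNReal.ofReal p) ν))
        = μ + 2 * s * δ g + s ^ 2 * dualForm ν p δ := hexp
    have h1 : s * (2 * δ g + s * dualForm ν p δ) ≤ 0 := by nlinarith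
    have h2 : 2 * δ g + s * dualForm ν p δ ≤ 0 := by
      by_contra h; exact absurd h1 (not_le.2 (mul_pos hs0 (not_le.1 h)))
    have h3 : -A ≤ dualForm ν p δ := neg_abs_le _
    have h4 : s * A ≤ δ g := by
      rw [hs, div_mul_eq_mul_div, div_le_iff₀ (by positivity)]
      nlinarith
    nlinarith
  obtain ⟨y, hy, hnear⟩ := exists_nearest_of_isClosed hp Y hYc g
  set z := g - y with hz
  -- Since y is a nearest point, z is a shortest representative of its class modulo Y.
  have hznorm : ‖(Y.mkQ z)‖ = ‖z‖ := by
    refine le_antisymm (Submodule.Quotient.norm_mk_le Y z) ?_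
    refine le_of_forall_pos_le_add fun ε hε => ?_
    obtain ⟨x, hx, hxn⟩ := Submodule.Quotient.norm_mk_lt (Y.mkQ z) hε
    have h1 : z - x ∈ Y := by
      rw [← Submodule.Quotient.eq]
      exact hx.symm
    have h2 := hnear (y + (z - x)) (Y.add_mem hy h1)
    rw [show g - (y + (z - x)) = x by rw [hz]; abel] at h2
    exact h2.trans hxn.le
  -- Hahn-Banach in the quotient yields an admissible ψ with ψ(g) = ψ(z) = ‖z‖, so ‖z‖ ≤ μ by `hψg`.
  -- Conversely μ = φ(z) ≤ ‖z‖. Hence φ norms z.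
  obtain ⟨f, hf1, hf2⟩ := exists_dual_vector'' ℝ (Y.mkQ z)
  have hcontr : ∀ x, |f (Y.mkQ x)| ≤ 1 * ‖x‖ := fun x => by
    refine (f.le_opNorm _).trans ?_
    exact mul_le_mul hf1 (Submodule.Quotient.norm_mk_le Y x) (norm_nonneg _) zero_le_one
  set ψ : StrongDual ℝ (Lp ℝ (ENNReal.ofReal p) ν) :=
    LinearMap.mkContinuous (f.toLinearMap.comp Y.mkQ) 1 hcontr with hψ
  have hψY : ∀ x ∈ Y, ψ x = 0 := by
    intro x hx
    have : Y.mkQ x = 0 := (Submodule.Quotient.mk_eq_zero Y).2 hx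
    change f (Y.mkQ x) = 0
    rw [this, map_zero]
  have hψ1 : ‖ψ‖ ≤ 1 := LinearMap.mkContinuous_norm_le _ zero_le_one _
  have hψz : ψ z = ‖z‖ := by
    change f (Y.mkQ z) = ‖z‖
    rw [hf2, hznorm]; rfl
  have hzle : ‖z‖ ≤ μ := by
    have := hψg ψ hψ1 hψY
    rw [← hψz, hz, map_sub, hψY y hy, sub_zero]; exact this
  have hφz : φ z = μ := by rw [hz, map_sub, hφY y hy, sub_zero, hφg]
  have hzge : μ ≤ ‖z‖ := by
    rw [← hφz]
    refine (le_abs_self _).trans ((φ.le_opNorm z).trans ?_)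
    exact mul_le_of_le_one_left (norm_nonneg _) hφ
  have hzμ : ‖z‖ = μ := le_antisymm hzle hzge
  obtain ⟨n, hn, hyn⟩ := hy
  have hcoef : ∀ m, waveEigenvalue m ≠ 0 → waveCoeff (V - n) m = c m := fun m hm => by
    rw [waveCoeff_sub, hn m hm, sub_zero, hVc]
  refine ⟨V - n, z, ?_, ?_, ?_, hzμ, ?_⟩
  · filter_upwards [hgV, hyn, Lp.coeFn_sub g y, hac.ae_eq (Lp.coeFn_sub V n)] with x a b d e
    rw [hz, d, e, Pi.sub_apply, Pi.sub_apply, a, b]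
  · intro m
    by_cases hm : waveEigenvalue m = 0
    · rw [hm, zero_mul, hφY]
      refine ⟨waveModeH m, fun k hk => ?_, ?_⟩
      · rw [waveCoeff_waveModeH, if_neg]
        rintro rfl
        exact hk hm
      · exact coeFn_waveModeLp m |>.trans (hac.ae_eq (coeFn_waveModeH m)).symm
    · rw [hcoef m hm, hc, mul_inv_cancel_left₀ hm]
  · refine hsum.congr fun m => ?_
    by_cases hm : waveEigenvalue m = 0
    · simp [hm]
    · rw [hcoef m hm]
  · intro h
    have := dual_apply_eq_of_norming hp hφ (hφz.trans hzμ.symm) (hzμ ▸ hpos) h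
    rw [hzμ] at this
    exact this

end Maximizer

/-! ### Weak solutions in terms of the weighted measure -/

/-- The measure with density `w` on the torus. -/
def weightMeasure (w : WaveTorus → NNReal) : Measure WaveTorus :=
  volume.withDensity fun z => (w z : ENNReal)

section Forms

theorem summable_abs_eigenvalue_iff (u : WaveH) :
    Summable (fun m => |waveEigenvalue m| * waveCoeff u m ^ 2) ↔
      Summable (fun m : {m : ℤ × ℤ // 0 < waveEigenvalue m} =>
          waveEigenvalue m.1 * waveCoeff u m.1 ^ 2) ∧
       Summable (fun m : {m : ℤ × ℤ // waveEigenvalue m < 0} =>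
          |waveEigenvalue m.1| * waveCoeff u m.1 ^ 2) := by
  constructor
  · intro h
    refine ⟨(h.subtype {m | 0 < waveEigenvalue m}).congr fun m => ?_,
      h.subtype {m | waveEigenvalue m < 0}⟩
    simp only [Function.comp_apply]
    rw [abs_of_pos m.2]
  · rintro ⟨h1, h2⟩
    have h1' : Summable ({m | 0 < waveEigenvalue m}.indicator
        fun m => waveEigenvalue m * waveCoeff u m ^ 2) := summable_subtype_iff_indicator.1 h1
    have h2' : Summable ({m | waveEigenvalue m < 0}.indicator
        fun m => |waveEigenvalue m| * waveCoeff u m ^ 2) := summable_subtype_iff_indicator.1 h2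
    refine (h1'.add h2').congr fun m => ?_
    rcases lt_trichotomy (waveEigenvalue m) 0 with h | h | h
    · simp [Set.indicator, h, h.not_gt]
    · simp [Set.indicator, h]
    · simp [Set.indicator, h, h.not_gt, abs_of_pos h]

theorem summable_eigenvalue_mul {u v : WaveH}
    (hu : Summable fun m => |waveEigenvalue m| * waveCoeff u m ^ 2)
    (hv : Summable fun m => |waveEigenvalue m| * waveCoeff v m ^ 2) :
    Summable fun m => waveEigenvalue m * (waveCoeff u m * waveCoeff v m) := by
  refine Summable.of_norm_bounded (hu.add hv) fun m => ?_
  rw [Real.norm_eq_abs, abs_mul, ← mul_add]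
  refine mul_le_mul_of_nonneg_left ?_ (abs_nonneg _)
  rw [abs_le]
  constructor <;> nlinarith [sq_nonneg (waveCoeff u m + waveCoeff v m),
    sq_nonneg (waveCoeff u m - waveCoeff v m), sq_nonneg (waveCoeff u m), sq_nonneg (waveCoeff v m)]

theorem wavePosForm_sub_waveNegForm {u v : WaveH}
    (hu : Summable fun m => |waveEigenvalue m| * waveCoeff u m ^ 2)
    (hv : Summable fun m => |waveEigenvalue m| * waveCoeff v m ^ 2) :
    wavePosForm u v - waveNegForm u v
      = ∑' m, waveEigenvalue m * (waveCoeff u m * waveCoeff v m) := by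
  have hs := summable_eigenvalue_mul hu hv
  have hs' : Summable fun m => |waveEigenvalue m| * (waveCoeff u m * waveCoeff v m) := by
    refine Summable.of_norm (hs.norm.congr fun m => ?_)
    simp only [Real.norm_eq_abs, abs_mul, abs_abs]
  have h1 : wavePosForm u v = ∑' m, {m | 0 < waveEigenvalue m}.indicator
      (fun m => waveEigenvalue m * (waveCoeff u m * waveCoeff v m)) m :=
    tsum_subtype {m | 0 < waveEigenvalue m} fun m =>
      waveEigenvalue m * (waveCoeff u m * waveCoeff v m)
  have h2 : waveNegForm u v = ∑' m, {m | waveEigenvalue m < 0}.indicator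
      (fun m => |waveEigenvalue m| * (waveCoeff u m * waveCoeff v m)) m :=
    tsum_subtype {m | waveEigenvalue m < 0} fun m =>
      |waveEigenvalue m| * (waveCoeff u m * waveCoeff v m)
  rw [h1, h2, ← (hs.indicator _).tsum_sub (hs'.indicator _)]
  refine tsum_congr fun m => ?_
  rcases lt_trichotomy (waveEigenvalue m) 0 with h | h | h
  · simp [Set.indicator, h, h.not_gt, abs_of_neg h]
  · simp [Set.indicator, h]
  · simp [Set.indicator, h, h.not_gt]

end Forms

section Weight

variable {w : WaveTorus → NNReal} {p : ℝ}

theorem weightMeasure_le {C : NNReal} (hC : ∀ z, w z ≤ C) : weightMeasure w ≤ C • volume := by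
  have h : weightMeasure w ≤ volume.withDensity fun _ => (C : ENNReal) :=
    withDensity_mono (Filter.Eventually.of_forall fun z => ENNReal.coe_le_coe.2 (hC z))
  rw [withDensity_const] at h
  exact h

theorem integral_weightMeasure (hw : Measurable w) (f : WaveTorus → ℝ) :
    ∫ z, f z ∂(weightMeasure w) = ∫ z, (w z : ℝ) * f z :=
  integral_withDensity_eq_integral_smul hw f

theorem integrable_weightMeasure_iff (hw : Measurable w) {f : WaveTorus → ℝ} :
    Integrable f (weightMeasure w) ↔ Integrable fun z => (w z : ℝ) * f z :=
  integrable_withDensity_iff_integrable_smul hw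

theorem memLp_weightMeasure_iff (hp : 2 < p) (hw : Measurable w) (v : WaveH) :
    MemLp v (ENNReal.ofReal p) (weightMeasure w) ↔ Integrable fun z => (w z : ℝ) * |v z| ^ p := by
  have hm : AEStronglyMeasurable v (weightMeasure w) :=
    (Lp.stronglyMeasurable v).aestronglyMeasurable
  rw [← integrable_weightMeasure_iff hw, ← integrable_norm_rpow_iff hm (by simp; linarith) (by simp),
    toReal_ofReal_of_two_lt hp]
  rfl

theorem mem_waveE_iff (hp : 2 < p) (hw : Measurable w) (v : WaveH) :
    v ∈ waveE p (fun z => (w z : ℝ)) ↔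
      Summable (fun m => |waveEigenvalue m| * waveCoeff v m ^ 2) ∧
        MemLp v (ENNReal.ofReal p) (weightMeasure w) := by
  rw [memLp_weightMeasure_iff hp hw, summable_abs_eigenvalue_iff, and_assoc]
  rfl

variable [Fact (1 ≤ ENNReal.ofReal p)]

theorem integral_weight_pow_eq_powDual (hp : 2 < p) (hw : Measurable w) {u v : WaveH}
    {f h : Lp ℝ (ENNReal.ofReal p) (weightMeasure w)} (hf : f =ᵐ[weightMeasure w] u)
    (hh : h =ᵐ[weightMeasure w] v) :
    ∫ z, (w z : ℝ) * (|u z| ^ (p - 2) * u z * v z) = powDual hp f h := by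
  rw [powDual_apply, ← integral_weightMeasure hw]
  refine integral_congr_ae ?_
  filter_upwards [hf, hh] with z a b
  rw [a, b]

/-- Testing the equation with v itself turns the energy into a multiple of the L^p(ν) norm to the
power p, so ground states are the nonzero solutions of least norm. -/
theorem waveEnergy_of_isWaveWeakSolution (hp : 2 < p) (hw : Measurable w) {v : WaveH}
    (hv : IsWaveWeakSolution p (fun z => (w z : ℝ)) v)
    {f : Lp ℝ (ENNReal.ofReal p) (weightMeasure w)} (hf : f =ᵐ[weightMeasure w] v) :
    wavePosForm v v - waveNegForm v v = ‖f‖ ^ p ∧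
    waveEnergy p (fun z => (w z : ℝ)) v = (1 / 2 - 1 / p) * ‖f‖ ^ p := by
  have h1 := hv.2 v hv.1
  rw [integral_weight_pow_eq_powDual hp hw hf hf, powDual_self] at h1
  have h2 : ∫ z, (w z : ℝ) * |v z| ^ p = ‖f‖ ^ p := by
    rw [← integral_weightMeasure hw, lp_norm_rpow hp]
    refine integral_congr_ae ?_
    filter_upwards [hf] with z hz
    rw [hz]
  refine ⟨h1, ?_⟩
  rw [waveEnergy, h1, h2]; ring

variable [IsFiniteMeasure (weightMeasure w)]

/-- A test function splits into its non-kernel modes, whose series converges in L^p(ν) by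
`exists_hasSum_modes`, and a remainder in the kernel, which therefore also lies in L^p(ν). The
functional vanishes on the remainder and is computed term by term on the series. -/
theorem isWaveWeakSolution_of_powDual (hp : 2 < p) (hw : Measurable w) {C : NNReal}
    (hC : ∀ z, w z ≤ C) (hac : weightMeasure w ≪ volume) {u : WaveH}
    {f : Lp ℝ (ENNReal.ofReal p) (weightMeasure w)}
    (hf : f =ᵐ[weightMeasure w] u) (hu : Summable fun m => |waveEigenvalue m| * waveCoeff u m ^ 2)
    (hY : ∀ y ∈ kernelLp (weightMeasure w) hac p, powDual hp f y = 0)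
    (hm : ∀ m, waveEigenvalue m * waveCoeff u m = powDual hp f (waveModeLp (weightMeasure w) p m)) :
    IsWaveWeakSolution p (fun z => (w z : ℝ)) u := by
  refine ⟨(mem_waveE_iff hp hw u).2 ⟨hu, (memLp_congr_ae hf).1 (Lp.memLp f)⟩, fun v hv => ?_⟩
  obtain ⟨hv1, hv2⟩ := (mem_waveE_iff hp hw v).1 hv
  rw [wavePosForm_sub_waveNegForm hu hv1,
    integral_weight_pow_eq_powDual hp hw hf (hv2.coeFn_toLp)]
  set c : ℤ × ℤ → ℝ := fun m => if waveEigenvalue m = 0 then 0 else waveCoeff v m with hc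
  have hcs : Summable fun m => |waveEigenvalue m| * c m ^ 2 := by
    refine hv1.congr fun m => ?_
    by_cases h : waveEigenvalue m = 0 <;> simp [hc, h]
  obtain ⟨V, g, hgV, hVc, hg⟩ := exists_hasSum_modes hp (weightMeasure_le hC)
    (c := c) (fun m h => by simp [hc, h]) hcs
  have hmem : hv2.toLp - g ∈ kernelLp (weightMeasure w) hac p := by
    refine ⟨v - V, fun m h => ?_, ?_⟩
    · rw [waveCoeff_sub, hVc, hc]; simp [h]
    · filter_upwards [hgV, hv2.coeFn_toLp, Lp.coeFn_sub hv2.toLp g, hac.ae_eq (Lp.coeFn_sub v V)]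
        with x a b d e
      rw [d, e, Pi.sub_apply, Pi.sub_apply, a, b]
  have h1 := hY _ hmem
  rw [map_sub, sub_eq_zero] at h1
  rw [h1, ← ((powDual hp f).hasSum hg).tsum_eq]
  refine tsum_congr fun m => ?_
  rw [map_smul, smul_eq_mul, ← hm, hc]
  by_cases h : waveEigenvalue m = 0
  · simp [h]
  · simp only [h, if_false]; ring

/-- The modes, and the kernel elements in L^p(ν), belong to E and can be used as test functions. -/
theorem powDual_of_isWaveWeakSolution (hp : 2 < p) (hw : Measurable w)
    (hac : weightMeasure w ≪ volume) {v : WaveH}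
    (hv : IsWaveWeakSolution p (fun z => (w z : ℝ)) v)
    {f : Lp ℝ (ENNReal.ofReal p) (weightMeasure w)} (hf : f =ᵐ[weightMeasure w] v) :
    (∀ y ∈ kernelLp (weightMeasure w) hac p, powDual hp f y = 0) ∧
    (∀ m, waveEigenvalue m * waveCoeff v m = powDual hp f (waveModeLp (weightMeasure w) p m)) := by
  obtain ⟨hvE, hsol⟩ := hv
  obtain ⟨hv1, -⟩ := (mem_waveE_iff hp hw v).1 hvE
  constructor
  · rintro y ⟨n, hn, hy⟩
    have hn0 : ∀ m, waveEigenvalue m * waveCoeff n m = 0 := fun m => by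
      by_cases h : waveEigenvalue m = 0
      · rw [h, zero_mul]
      · rw [hn m h, mul_zero]
    have hn1 : Summable fun m => |waveEigenvalue m| * waveCoeff n m ^ 2 := by
      refine summable_zero.congr fun m => ?_
      rcases mul_eq_zero.1 (hn0 m) with h | h <;> simp [h]
    have h1 := hsol n ((mem_waveE_iff hp hw n).2 ⟨hn1, (memLp_congr_ae hy).1 (Lp.memLp y)⟩)
    rw [integral_weight_pow_eq_powDual hp hw hf hy, wavePosForm_sub_waveNegForm hv1 hn1] at h1
    rw [← h1, ← tsum_zero (α := ℝ) (β := ℤ × ℤ)]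
    refine tsum_congr fun m => ?_
    rw [mul_left_comm, hn0, mul_zero]
  · intro m
    have hm1 : Summable fun k => |waveEigenvalue k| * waveCoeff (waveModeH m) k ^ 2 := by
      refine summable_of_ne_finset_zero (s := {m}) fun k hk => ?_
      rw [waveCoeff_waveModeH, if_neg (by simpa using hk)]
      simp
    have hme : waveModeLp (weightMeasure w) p m =ᵐ[weightMeasure w] waveModeH m :=
      coeFn_waveModeLp m |>.trans (hac.ae_eq (coeFn_waveModeH m)).symm
    have h1 := hsol (waveModeH m)
      ((mem_waveE_iff hp hw _).2 ⟨hm1, (memLp_congr_ae hme).1 (Lp.memLp _)⟩)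
    rw [integral_weight_pow_eq_powDual hp hw hf hme, wavePosForm_sub_waveNegForm hv1 hm1] at h1
    rw [← h1, tsum_eq_single m]
    · rw [waveCoeff_waveModeH, if_pos rfl, mul_one]
    · intro k hk
      rw [waveCoeff_waveModeH, if_neg hk]; simp

/-- Existence of ground states from observability and positivity of the dual form. -/
theorem exists_isWaveGroundState_of_dualForm_pos (hp : 2 < p) (hw : Measurable w) {C : NNReal}
    (hC : ∀ z, w z ≤ C) (hac : weightMeasure w ≪ volume) (hO : ObservableKernel (weightMeasure w))
    {φ₁ : StrongDual ℝ (Lp ℝ (ENNReal.ofReal p) (weightMeasure w))}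
    (h₁ : ∀ y ∈ kernelLp (weightMeasure w) hac p, φ₁ y = 0)
    (hpos₁ : 0 < dualForm (weightMeasure w) p φ₁) :
    ∃ u : WaveH, IsWaveGroundState p (fun z => (w z : ℝ)) u := by
  have hν := weightMeasure_le hC
  have hp2 : 0 < p - 2 := by linarith
  have hp0 : 0 < p := by linarith
  obtain ⟨φ, hφ1, hφY, hpos, hmax⟩ := exists_dualForm_maximizer hp hν _ h₁ hpos₁
  obtain ⟨u, z, hzu, hum, hus, hzn, hEL⟩ := exists_of_dualForm_maximizer hp hν hac hO hφ1 hφY hpos hmax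
  set μ := dualForm (weightMeasure w) p φ with hμ
  -- Scaling: for tz the power functional is t^{p-1}μ^{p-1}φ, while L(tu) corresponds to tφ. They
  -- agree when t^{p-2} = μ^{1-p}.
  set t : ℝ := μ ^ ((1 - p) / (p - 2)) with ht
  have ht0 : 0 < t := by positivity
  have htp : t ^ (p - 2) = μ ^ (1 - p) := by
    rw [ht, ← Real.rpow_mul hpos.le, div_mul_cancel₀ _ hp2.ne']
  have hpow : ∀ h, powDual hp (t • z) h = t * φ h := by
    intro h
    rw [powDual_smul hp ht0, _root_.smul_apply, smul_eq_mul, ← hEL, ← mul_assoc]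
    congr 1
    have : t ^ (p - 1) = t ^ (p - 2) * t := by
      rw [← Real.rpow_add_one ht0.ne']; congr 1; ring
    rw [this, htp, mul_right_comm, ← Real.rpow_add hpos]
    simp
  have htu : (t • z : Lp ℝ (ENNReal.ofReal p) (weightMeasure w)) =ᵐ[weightMeasure w] (t • u : WaveH) := by
    filter_upwards [hzu, Lp.coeFn_smul t z, hac.ae_eq (Lp.coeFn_smul t u)] with x a b c
    rw [b, c, Pi.smul_apply, Pi.smul_apply, a]
  have hsol : IsWaveWeakSolution p (fun z => (w z : ℝ)) (t • u) := by
    refine isWaveWeakSolution_of_powDual hp hw hC hac htu ?_ (fun y hy => ?_) fun m => ?_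
    · refine (hus.mul_left (t ^ 2)).congr fun m => ?_
      rw [waveCoeff_smul]; ring
    · rw [hpow, hφY y hy, mul_zero]
    · rw [hpow, ← hum, waveCoeff_smul]; ring
  refine ⟨t • u, hsol, ?_, fun v hv hv0 => ?_⟩
  · intro h0
    have : (t • z : Lp ℝ (ENNReal.ofReal p) (weightMeasure w)) = 0 := by
      apply Lp.ext
      refine htu.trans ?_
      rw [h0]
      exact (hac.ae_eq (Lp.coeFn_zero ℝ 2 volume)).trans (Lp.coeFn_zero _ _ _).symm
    rw [smul_eq_zero] at this
    rcases this with h | h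
    · exact ht0.ne' h
    · rw [h, norm_zero] at hzn
      exact hpos.ne hzn
  · have hvm := ((mem_waveE_iff hp hw v).1 hv.1).2
    have hvs := ((mem_waveE_iff hp hw v).1 hv.1).1
    set f := hvm.toLp with hf
    have hfv : f =ᵐ[weightMeasure w] v := hvm.coeFn_toLp
    obtain ⟨hfY, hfm⟩ := powDual_of_isWaveWeakSolution hp hw hac hv hfv
    obtain ⟨hform, henergy⟩ := waveEnergy_of_isWaveWeakSolution hp hw hv hfv
    rw [(waveEnergy_of_isWaveWeakSolution hp hw hsol htu).2, henergy]
    -- The weight may vanish on a large set, so v ≠ 0 does not give this directly. If v were zero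
    -- ν-almost everywhere, the equation would put it into the kernel of L, and observability would
    -- force v = 0.
    have ha : 0 < ‖f‖ := by
      rw [norm_pos_iff]
      intro hf0
      apply hv0
      have hvk : v ∈ waveKernel := by
        intro m hm
        have h1 := hfm m
        rw [powDual_apply, hf0] at h1
        have h2 : ∫ z, |(0 : Lp ℝ (ENNReal.ofReal p) (weightMeasure w)) z| ^ (p - 2)
            * (0 : Lp ℝ (ENNReal.ofReal p) (weightMeasure w)) z
            * waveModeLp (weightMeasure w) p m z ∂(weightMeasure w) = 0 := by
          refine integral_eq_zero_of_ae ?_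
          filter_upwards [Lp.coeFn_zero ℝ (ENNReal.ofReal p) (weightMeasure w)] with x hx
          rw [hx]; simp
        rw [h2] at h1
        exact (mul_eq_zero.1 h1).resolve_left hm
      obtain ⟨K, hK, hb⟩ := hO.exists_norm_le hp
      have := hb v hvk f hfv
      rw [hf0, norm_zero, mul_zero] at this
      exact norm_le_zero_iff.1 this
    -- The coefficients of the power functional are λ_m v_m, so its dual form is Σ λ_m v_m², the
    -- quadratic form of v.
    have hdual : dualForm (weightMeasure w) p (powDual hp f) = ‖f‖ ^ p := by
      rw [← hform, wavePosForm_sub_waveNegForm hvs hvs, dualForm]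
      refine tsum_congr fun m => ?_
      rw [← hfm]
      by_cases h : waveEigenvalue m = 0
      · simp [h]
      · field_simp
    have hle := hmax _ hfY
    rw [hdual] at hle
    have h3 : ‖powDual hp f‖ ^ 2 ≤ (‖f‖ ^ (p - 1)) ^ 2 := by
      gcongr; exact norm_powDual_le hp f
    have h4 : ‖f‖ ^ p ≤ μ * (‖f‖ ^ (p - 2) * ‖f‖ ^ p) := by
      refine hle.trans ?_
      have : (‖f‖ ^ (p - 1)) ^ 2 = ‖f‖ ^ (p - 2) * ‖f‖ ^ p := by
        rw [sq, ← Real.rpow_add ha, ← Real.rpow_add ha]; congr 1; ring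
      rw [← this]
      exact mul_le_mul_of_nonneg_left h3 hpos.le
    have h5 : 1 ≤ μ * ‖f‖ ^ (p - 2) := by
      have hap : 0 < ‖f‖ ^ p := by positivity
      by_contra hcon
      have := mul_lt_mul_of_pos_right (not_le.1 hcon) hap
      rw [one_mul] at this
      linarith [mul_assoc μ (‖f‖ ^ (p - 2)) (‖f‖ ^ p)]
    -- Since ‖tz‖ = tμ and (tμ)^{p-2} = μ⁻¹, this is exactly 1 ≤ μ‖f‖^{p-2}.
    have h6 : ‖t • z‖ ≤ ‖f‖ := by
      rw [norm_smul, Real.norm_of_nonneg ht0.le, hzn]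
      refine (Real.rpow_le_rpow_iff (by positivity) ha.le hp2).1 ?_
      rw [Real.mul_rpow ht0.le hpos.le, htp, ← Real.rpow_add hpos,
        show 1 - p + (p - 2) = -1 by ring, Real.rpow_neg_one]
      rwa [inv_le_iff_one_le_mul₀' hpos]
    have h7 : 0 ≤ 1 / 2 - 1 / p := by
      rw [sub_nonneg]; exact one_div_le_one_div_of_le (by norm_num) hp.le
    gcongr

end Weight

/-! ### Cosine bumps on the circle -/

theorem integral_indicator_closedBall {x₀ h : ℝ} (hh : 0 < h) (hh2 : h ≤ Real.pi)
    (g : WaveCircle → ℝ) :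
    ∫ y, (Metric.closedBall (x₀ : WaveCircle) h).indicator g y
      = ∫ x in (x₀ - h)..(x₀ + h), g (x : WaveCircle) := by
  have hpi := Real.pi_pos
  rw [← AddCircle.intervalIntegral_preimage (2 * Real.pi) (x₀ - Real.pi),
    intervalIntegral.integral_of_le (by linarith), intervalIntegral.integral_of_le (by linarith)]
  have h1 : ∀ x ∈ Set.Ioc (x₀ - Real.pi) (x₀ - Real.pi + 2 * Real.pi),
      (Metric.closedBall (x₀ : WaveCircle) h).indicator g (x : WaveCircle)
        = (Set.Icc (x₀ - h) (x₀ + h)).indicator (fun x : ℝ => g (x : WaveCircle)) x := by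
    intro x hx
    have hn : ‖((x - x₀ : ℝ) : WaveCircle)‖ = |x - x₀| := by
      rw [AddCircle.norm_coe_eq_abs_iff _ (by positivity), abs_of_pos (by positivity : 0 < 2 * Real.pi),
        abs_le]
      constructor <;> linarith [hx.1, hx.2]
    have hiff : (x : WaveCircle) ∈ Metric.closedBall (x₀ : WaveCircle) h
        ↔ x ∈ Set.Icc (x₀ - h) (x₀ + h) := by
      rw [Metric.mem_closedBall, dist_eq_norm, ← AddCircle.coe_sub, hn, abs_le, Set.mem_Icc]
      constructor <;> rintro ⟨a, b⟩ <;> constructor <;> linarith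
    by_cases hx2 : x ∈ Set.Icc (x₀ - h) (x₀ + h)
    · rw [Set.indicator_of_mem hx2, Set.indicator_of_mem (hiff.2 hx2)]
    · rw [Set.indicator_of_notMem hx2, Set.indicator_of_notMem fun h3 => hx2 (hiff.1 h3)]
  rw [setIntegral_congr_fun measurableSet_Ioc h1, setIntegral_indicator measurableSet_Icc]
  refine setIntegral_congr_set ?_
  have h2 : Set.Ioc (x₀ - h) (x₀ + h)
      = Set.Ioc (x₀ - Real.pi) (x₀ - Real.pi + 2 * Real.pi) ∩ Set.Ioc (x₀ - h) (x₀ + h) := by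
    rw [Set.inter_eq_right.2]
    exact Set.Ioc_subset_Ioc (by linarith) (by linarith)
  rw [h2]
  exact (Filter.EventuallyEq.refl _ _).inter Ioc_ae_eq_Icc.symm

/-- A cosine bump of width `2π/N` on the circle. -/
def circleBump (x₀ : ℝ) (N : ℕ) : WaveCircle → ℝ :=
  (Metric.closedBall (x₀ : WaveCircle) (Real.pi / N)).indicator
    fun y => 1 + (fourier N (y - (x₀ : WaveCircle)) : ℂ).re

/-- The second derivative of `circleBump`. -/
def circleBumpDeriv (x₀ : ℝ) (N : ℕ) : WaveCircle → ℝ :=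
  (Metric.closedBall (x₀ : WaveCircle) (Real.pi / N)).indicator
    fun y => -(N : ℝ) ^ 2 * (fourier N (y - (x₀ : WaveCircle)) : ℂ).re

theorem fourier_sub_re (x₀ : ℝ) (N : ℕ) (x : ℝ) :
    (fourier N ((x : WaveCircle) - (x₀ : WaveCircle)) : ℂ).re = Real.cos (N * (x - x₀)) := by
  rw [← AddCircle.coe_sub, fourier_coe_waveCircle, Complex.exp_ofReal_mul_I_re]
  simp

theorem exists_deriv_circleMode (k : ℤ) : ∃ e' : ℝ → ℝ,
    (∀ x, HasDerivAt (fun y : ℝ => circleMode k (y : WaveCircle)) (e' x) x) ∧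
    ∀ x : ℝ, HasDerivAt e' (-(k : ℝ) ^ 2 * circleMode k (x : WaveCircle)) x := by
  have hlin : ∀ a x : ℝ, HasDerivAt (fun y : ℝ => a * y) a x := fun a x => by
    simpa using (hasDerivAt_id x).const_mul a
  simp only [circleMode_coe]
  by_cases h0 : k = 0
  · refine ⟨fun _ => 0, fun x => ?_, fun x => ?_⟩
    · simpa [h0] using hasDerivAt_const x _
    · simpa [h0] using hasDerivAt_const x (0 : ℝ)
  · by_cases h1 : 0 < k
    · refine ⟨fun x => (Real.sqrt Real.pi)⁻¹ * (-Real.sin (k * x) * k), fun x => ?_, fun x => ?_⟩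
      · simpa only [h0, h1, if_true, if_false] using (hlin k x).cos.const_mul _
      · simp only [h0, h1, if_true, if_false]
        exact (((hlin k x).sin.neg.mul_const (k : ℝ)).const_mul _).congr_deriv (by ring)
    · refine ⟨fun x => (Real.sqrt Real.pi)⁻¹ * (Real.cos (-k * x) * -k), fun x => ?_, fun x => ?_⟩
      · simpa only [h0, h1, if_false] using (hlin (-k) x).sin.const_mul _
      · simp only [h0, h1, if_false]
        exact (((hlin (-k) x).cos.mul_const (-k : ℝ)).const_mul _).congr_deriv (by ring)

section Bump

variable (x₀ : ℝ) {N : ℕ}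

theorem measurable_circleBump : Measurable (circleBump x₀ N) :=
  Measurable.indicator (by fun_prop) Metric.isClosed_closedBall.measurableSet

theorem measurable_circleBumpDeriv : Measurable (circleBumpDeriv x₀ N) :=
  Measurable.indicator (by fun_prop) Metric.isClosed_closedBall.measurableSet

theorem abs_circleBump_le (y : WaveCircle) : |circleBump x₀ N y| ≤ 2 := by
  unfold circleBump
  by_cases h : y ∈ Metric.closedBall (x₀ : WaveCircle) (Real.pi / N)
  · rw [Set.indicator_of_mem h]
    have := (Complex.abs_re_le_norm (fourier N (y - (x₀ : WaveCircle)))).trans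
      (norm_fourier_waveCircle _ _).le
    rw [abs_le] at this ⊢
    constructor <;> linarith
  · rw [Set.indicator_of_notMem h]; simp

theorem abs_circleBumpDeriv_le (y : WaveCircle) : |circleBumpDeriv x₀ N y| ≤ (N : ℝ) ^ 2 := by
  unfold circleBumpDeriv
  by_cases h : y ∈ Metric.closedBall (x₀ : WaveCircle) (Real.pi / N)
  · rw [Set.indicator_of_mem h, abs_mul, abs_neg, abs_of_nonneg (by positivity)]
    exact mul_le_of_le_one_right (by positivity) ((Complex.abs_re_le_norm _).trans
      (norm_fourier_waveCircle _ _).le)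
  · rw [Set.indicator_of_notMem h]; simp

theorem circleBump_eq_zero {y : WaveCircle} (hy : Real.pi / N < dist y (x₀ : WaveCircle)) :
    circleBump x₀ N y = 0 :=
  Set.indicator_of_notMem (by rw [Metric.mem_closedBall]; exact not_le.2 hy) _

theorem circleBumpDeriv_eq_zero {y : WaveCircle} (hy : Real.pi / N < dist y (x₀ : WaveCircle)) :
    circleBumpDeriv x₀ N y = 0 :=
  Set.indicator_of_notMem (by rw [Metric.mem_closedBall]; exact not_le.2 hy) _

theorem pi_div_le (hN : 0 < N) : 0 < Real.pi / N ∧ Real.pi / N ≤ Real.pi := by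
  have h1 : (1 : ℝ) ≤ N := by exact_mod_cast hN
  exact ⟨by positivity, div_le_self Real.pi_pos.le h1⟩

theorem sin_mul_endpoints (hN : 0 < N) : Real.sin (N * (x₀ + Real.pi / N - x₀)) = 0 ∧
    Real.sin (N * (x₀ - Real.pi / N - x₀)) = 0 ∧
    Real.cos (N * (x₀ + Real.pi / N - x₀)) = -1 ∧ Real.cos (N * (x₀ - Real.pi / N - x₀)) = -1 := by
  have h1 : (N : ℝ) ≠ 0 := by positivity
  have e1 : (N : ℝ) * (x₀ + Real.pi / N - x₀) = Real.pi := by field_simp; ring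
  have e2 : (N : ℝ) * (x₀ - Real.pi / N - x₀) = -Real.pi := by field_simp; ring
  rw [e1, e2]
  simp

theorem hasDerivAt_mul_sub (a x : ℝ) : HasDerivAt (fun y : ℝ => a * (y - x₀)) a x := by
  simpa using ((hasDerivAt_id x).sub_const x₀).const_mul a

/-- Two integrations by parts. The boundary terms vanish because 1 + cos(N(x - x₀)) and its
derivative are zero at x₀ ± π/N; the jump of the second derivative there is harmless. -/
theorem integral_circleBumpDeriv_mul (hN : 0 < N) (k : ℤ) :
    ∫ y, circleBumpDeriv x₀ N y * circleMode k y
      = -(k : ℝ) ^ 2 * ∫ y, circleBump x₀ N y * circleMode k y := by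
  obtain ⟨h1, h2⟩ := pi_div_le hN
  obtain ⟨s1, s2, c1, c2⟩ := sin_mul_endpoints x₀ hN
  have e1 : ∀ y, circleBumpDeriv x₀ N y * circleMode k y
      = (Metric.closedBall (x₀ : WaveCircle) (Real.pi / N)).indicator (fun y =>
        -(N : ℝ) ^ 2 * (fourier N (y - (x₀ : WaveCircle)) : ℂ).re * circleMode k y) y := fun y => by
    simp only [circleBumpDeriv, Set.indicator]; split_ifs <;> simp
  have e2 : ∀ y, circleBump x₀ N y * circleMode k y
      = (Metric.closedBall (x₀ : WaveCircle) (Real.pi / N)).indicator (fun y =>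
        (1 + (fourier N (y - (x₀ : WaveCircle)) : ℂ).re) * circleMode k y) y := fun y => by
    rw [circleBump, Set.indicator_mul_left]
  simp only [e1, e2]
  rw [integral_indicator_closedBall h1 h2, integral_indicator_closedBall h1 h2]
  simp only [fourier_sub_re]
  obtain ⟨e', he, he'⟩ := exists_deriv_circleMode k
  have hec : Continuous fun x : ℝ => circleMode k (x : WaveCircle) :=
    (continuous_circleMode k).comp (AddCircle.continuous_mk' _)
  have hder : ∀ x ∈ Set.uIcc (x₀ - Real.pi / N) (x₀ + Real.pi / N), HasDerivAt (fun x : ℝ =>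
      (-Real.sin (N * (x - x₀)) * N) * circleMode k (x : WaveCircle)
        - (1 + Real.cos (N * (x - x₀))) * e' x)
      (-(N : ℝ) ^ 2 * Real.cos (N * (x - x₀)) * circleMode k (x : WaveCircle)
        - -(k : ℝ) ^ 2 * ((1 + Real.cos (N * (x - x₀))) * circleMode k (x : WaveCircle))) x := by
    intro x _
    have hl := hasDerivAt_mul_sub x₀ N x
    exact (((hl.sin.neg.mul_const (N : ℝ)).mul (he x)).sub
      ((hl.cos.const_add 1).mul (he' x))).congr_deriv (by simp only [Pi.neg_apply]; ring)
  have hft := intervalIntegral.integral_eq_sub_of_hasDerivAt hder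
    (Continuous.intervalIntegrable (by fun_prop) _ _)
  rw [s1, s2, c1, c2, intervalIntegral.integral_sub (Continuous.intervalIntegrable (by fun_prop) _ _)
    (Continuous.intervalIntegrable (by fun_prop) _ _), intervalIntegral.integral_const_mul] at hft
  simp only [neg_zero, zero_mul, add_neg_cancel, sub_zero] at hft
  linarith

theorem integral_circleBump_sq (hN : 0 < N) :
    ∫ y, circleBump x₀ N y * circleBump x₀ N y = 3 * Real.pi / N := by
  obtain ⟨h1, h2⟩ := pi_div_le hN
  obtain ⟨s1, s2, c1, c2⟩ := sin_mul_endpoints x₀ hN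
  have hN0 : (N : ℝ) ≠ 0 := by positivity
  have e1 : ∀ y, circleBump x₀ N y * circleBump x₀ N y
      = (Metric.closedBall (x₀ : WaveCircle) (Real.pi / N)).indicator (fun y =>
        (1 + (fourier N (y - (x₀ : WaveCircle)) : ℂ).re)
          * (1 + (fourier N (y - (x₀ : WaveCircle)) : ℂ).re)) y := fun y => by
    rw [circleBump, Set.indicator_mul]
  simp only [e1]
  rw [integral_indicator_closedBall h1 h2]
  simp only [fourier_sub_re]
  have hder : ∀ x ∈ Set.uIcc (x₀ - Real.pi / N) (x₀ + Real.pi / N), HasDerivAt (fun x : ℝ =>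
      3 / 2 * x + Real.sin (N * (x - x₀)) * (2 / N)
        + Real.sin (N * (x - x₀)) * Real.cos (N * (x - x₀)) * (1 / (2 * N)))
      ((1 + Real.cos (N * (x - x₀))) * (1 + Real.cos (N * (x - x₀)))) x := by
    intro x _
    have hl := hasDerivAt_mul_sub x₀ N x
    refine ((((hasDerivAt_id x).const_mul (3 / 2)).add (hl.sin.mul_const (2 / (N : ℝ)))).add
      ((hl.sin.mul hl.cos).mul_const (1 / (2 * (N : ℝ))))).congr_deriv ?_
    have := Real.sin_sq_add_cos_sq (N * (x - x₀))
    field_simp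
    linear_combination -(this)
  rw [intervalIntegral.integral_eq_sub_of_hasDerivAt hder
    (Continuous.intervalIntegrable (by fun_prop) _ _), s1, s2]
  ring

theorem integral_circleBump_mul_deriv (hN : 0 < N) :
    ∫ y, circleBump x₀ N y * circleBumpDeriv x₀ N y = -(N * Real.pi) := by
  obtain ⟨h1, h2⟩ := pi_div_le hN
  obtain ⟨s1, s2, c1, c2⟩ := sin_mul_endpoints x₀ hN
  have hN0 : (N : ℝ) ≠ 0 := by positivity
  have e1 : ∀ y, circleBump x₀ N y * circleBumpDeriv x₀ N y
      = (Metric.closedBall (x₀ : WaveCircle) (Real.pi / N)).indicator (fun y =>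
        (1 + (fourier N (y - (x₀ : WaveCircle)) : ℂ).re)
          * (-(N : ℝ) ^ 2 * (fourier N (y - (x₀ : WaveCircle)) : ℂ).re)) y := fun y => by
    simp only [circleBump, circleBumpDeriv, Set.indicator]; split_ifs <;> simp
  simp only [e1]
  rw [integral_indicator_closedBall h1 h2]
  simp only [fourier_sub_re]
  have hder : ∀ x ∈ Set.uIcc (x₀ - Real.pi / N) (x₀ + Real.pi / N), HasDerivAt (fun x : ℝ =>
      -(N : ℝ) ^ 2 / 2 * x + Real.sin (N * (x - x₀)) * (-N)
        + Real.sin (N * (x - x₀)) * Real.cos (N * (x - x₀)) * (-N / 2))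
      ((1 + Real.cos (N * (x - x₀))) * (-(N : ℝ) ^ 2 * Real.cos (N * (x - x₀)))) x := by
    intro x _
    have hl := hasDerivAt_mul_sub x₀ N x
    refine ((((hasDerivAt_id x).const_mul (-(N : ℝ) ^ 2 / 2)).add (hl.sin.mul_const (-(N : ℝ)))).add
      ((hl.sin.mul hl.cos).mul_const (-(N : ℝ) / 2))).congr_deriv ?_
    have := Real.sin_sq_add_cos_sq (N * (x - x₀))
    linear_combination ((N : ℝ) ^ 2 / 2) * this
  rw [intervalIntegral.integral_eq_sub_of_hasDerivAt hder
    (Continuous.intervalIntegrable (by fun_prop) _ _), s1, s2]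
  field_simp
  ring

end Bump

/-! ### Positivity of the dual form -/

/-- Pairing with W against volume is pairing with W/w against ν. The quotient is bounded because w ≥
c wherever W ≠ 0. -/
theorem exists_dual_eq_integral {w : WaveTorus → NNReal} {p : ℝ} [Fact (1 ≤ ENNReal.ofReal p)]
    [IsFiniteMeasure (weightMeasure w)] (hp : 2 < p) (hw : Measurable w)
    (hac : weightMeasure w ≪ volume) {W : WaveTorus → ℝ} (hW : Measurable W) {K c : ℝ}
    (hK : ∀ z, |W z| ≤ K) (hc : 0 < c) (hcw : ∀ᵐ z, W z ≠ 0 → c ≤ w z) :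
    ∃ φ : StrongDual ℝ (Lp ℝ (ENNReal.ofReal p) (weightMeasure w)),
      ∀ (h : Lp ℝ (ENNReal.ofReal p) (weightMeasure w)) (v : WaveTorus → ℝ),
        h =ᵐ[weightMeasure w] v → φ h = ∫ z, W z * v z := by
  have hpc := holderConjugate_of_two_lt hp
  have := hpc.symm.ennrealOfReal
  have : Fact (1 ≤ ENNReal.ofReal (p / (p - 1))) := ⟨by
    rw [ENNReal.one_le_ofReal]; exact hpc.symm.lt.le⟩
  have hψ : MemLp (fun z => W z / w z) (ENNReal.ofReal (p / (p - 1))) (weightMeasure w) := by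
    refine MemLp.of_bound (hW.div hw.coe_nnreal_real).aestronglyMeasurable (K / c) ?_
    filter_upwards [hac.ae_le hcw] with z hz
    have hK0 : 0 ≤ K := (abs_nonneg _).trans (hK z)
    rw [Real.norm_eq_abs, abs_div]
    by_cases h0 : W z = 0
    · rw [h0, abs_zero, zero_div]; positivity
    · rw [abs_of_nonneg (w z).coe_nonneg]
      exact div_le_div₀ hK0 (hK z) hc (hz h0)
  refine ⟨(ContinuousLinearMap.mul ℝ ℝ).lpPairing (weightMeasure w)
    (ENNReal.ofReal (p / (p - 1))) (ENNReal.ofReal p) hψ.toLp, fun h v hv => ?_⟩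
  rw [ContinuousLinearMap.lpPairing_eq_integral]
  have h1 : ∫ z, ContinuousLinearMap.mul ℝ ℝ (hψ.toLp _ z) (h z) ∂(weightMeasure w)
      = ∫ z, W z / w z * v z ∂(weightMeasure w) := by
    refine integral_congr_ae ?_
    filter_upwards [hψ.coeFn_toLp, hv] with z a b
    rw [a, b]; rfl
  rw [h1, integral_weightMeasure hw]
  refine integral_congr_ae ?_
  filter_upwards [hcw] with z hz
  by_cases h0 : W z = 0
  · simp [h0]
  · have : (w z : ℝ) ≠ 0 := (hc.trans_le (hz h0)).ne'
    field_simp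

/-- W is Lζ in the sense of coefficients. By Parseval it is orthogonal to the kernel, and its dual
form is Σ λ_m ζ_m² = ∫ Wζ. -/
theorem exists_dualForm_pos_of_waveCoeff {w : WaveTorus → NNReal} {p : ℝ}
    [Fact (1 ≤ ENNReal.ofReal p)]
    [IsFiniteMeasure (weightMeasure w)] (hp : 2 < p) (hw : Measurable w)
    (hac : weightMeasure w ≪ volume) {W ζ : WaveTorus → ℝ} (hW : Measurable W) (hζ : Measurable ζ)
    {K K' c : ℝ} (hK : ∀ z, |W z| ≤ K) (hK' : ∀ z, |ζ z| ≤ K') (hc : 0 < c)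
    (hcw : ∀ᵐ z, W z ≠ 0 → c ≤ w z)
    (hWζ : ∀ m, ∫ z, W z * waveMode m z = waveEigenvalue m * ∫ z, ζ z * waveMode m z)
    (hpos : 0 < ∫ z, W z * ζ z) :
    ∃ φ : StrongDual ℝ (Lp ℝ (ENNReal.ofReal p) (weightMeasure w)),
      (∀ y ∈ kernelLp (weightMeasure w) hac p, φ y = 0) ∧ 0 < dualForm (weightMeasure w) p φ := by
  obtain ⟨φ, hφ⟩ := exists_dual_eq_integral hp hw hac hW hK hc hcw
  have hWm : MemLp W 2 (volume : Measure WaveTorus) :=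
    MemLp.of_bound hW.aestronglyMeasurable K (Filter.Eventually.of_forall hK)
  have hζm : MemLp ζ 2 (volume : Measure WaveTorus) :=
    MemLp.of_bound hζ.aestronglyMeasurable K' (Filter.Eventually.of_forall hK')
  have hWc : ∀ m, waveCoeff hWm.toLp m = ∫ z, W z * waveMode m z := fun m => by
    refine integral_congr_ae ?_
    filter_upwards [hWm.coeFn_toLp] with z hz
    rw [hz]
  have hζc : ∀ m, waveCoeff hζm.toLp m = ∫ z, ζ z * waveMode m z := fun m => by
    refine integral_congr_ae ?_
    filter_upwards [hζm.coeFn_toLp] with z hz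
    rw [hz]
  refine ⟨φ, fun y ⟨n, hn, hy⟩ => ?_, ?_⟩
  · rw [hφ y n hy]
    have h1 : ∫ z, W z * n z = ∫ z, hWm.toLp W z * n z := by
      refine integral_congr_ae ?_
      filter_upwards [hWm.coeFn_toLp] with z hz
      rw [hz]
    rw [h1, ← (hasSum_waveCoeff_mul hWm.toLp n).tsum_eq, ← tsum_zero (α := ℝ) (β := ℤ × ℤ)]
    refine tsum_congr fun m => ?_
    by_cases h : waveEigenvalue m = 0
    · rw [hWc, hWζ, h, zero_mul, zero_mul]
    · rw [hn m h, mul_zero]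
  · have h1 : ∫ z, W z * ζ z = ∫ z, hWm.toLp W z * hζm.toLp ζ z := by
      refine integral_congr_ae ?_
      filter_upwards [hWm.coeFn_toLp, hζm.coeFn_toLp] with z a b
      rw [a, b]
    rw [h1, ← (hasSum_waveCoeff_mul hWm.toLp hζm.toLp).tsum_eq] at hpos
    refine hpos.trans_eq (tsum_congr fun m => ?_)
    rw [hφ _ _ (coeFn_waveModeLp m), hWc, hζc, hWζ]
    by_cases h : waveEigenvalue m = 0
    · simp [h]
    · field_simp

theorem integral_tensor (f g : WaveCircle → ℝ) :
    ∫ z : WaveTorus, f z.1 * g z.2 = (∫ x, f x) * ∫ t, g t :=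
  integral_prod_mul (μ := (volume : Measure WaveCircle)) (ν := (volume : Measure WaveCircle)) f g

theorem integrable_tensor {f g : WaveCircle → ℝ} (hf : Measurable f) (hg : Measurable g)
    {A B : ℝ} (hA : ∀ x, |f x| ≤ A) (hB : ∀ x, |g x| ≤ B) :
    Integrable fun z : WaveTorus => f z.1 * g z.2 := by
  refine Integrable.of_bound ((hf.comp measurable_fst).mul (hg.comp measurable_snd)).aestronglyMeasurable
    (A * B) (Filter.Eventually.of_forall fun z => ?_)
  rw [Real.norm_eq_abs, abs_mul]
  exact mul_le_mul (hA _) (hB _) (abs_nonneg _) ((abs_nonneg _).trans (hA z.1))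

/-- A tensor bump inside U that oscillates faster in x than in t has a positive quadratic form for
-∂ₓₓ + ∂ₜₜ. -/
theorem exists_dualForm_pos {w : WaveTorus → NNReal} {p : ℝ} [Fact (1 ≤ ENNReal.ofReal p)]
    [IsFiniteMeasure (weightMeasure w)] (hp : 2 < p) (hw : Measurable w)
    (hac : weightMeasure w ≪ volume) {U : Set WaveTorus} (hU : IsOpen U) (hne : U.Nonempty)
    {c : ℝ} (hc : 0 < c) (hcw : ∀ᵐ z, z ∈ U → c ≤ w z) :
    ∃ φ : StrongDual ℝ (Lp ℝ (ENNReal.ofReal p) (weightMeasure w)),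
      (∀ y ∈ kernelLp (weightMeasure w) hac p, φ y = 0) ∧ 0 < dualForm (weightMeasure w) p φ := by
  obtain ⟨⟨x, t⟩, hz⟩ := hne
  obtain ⟨x₀, rfl⟩ := QuotientAddGroup.mk_surjective x
  obtain ⟨t₀, rfl⟩ := QuotientAddGroup.mk_surjective t
  obtain ⟨ε, hε, hball⟩ := Metric.isOpen_iff.1 hU _ hz
  obtain ⟨M', hM'⟩ := exists_nat_gt (Real.pi / ε)
  set M := M' + 1 with hM
  set N := 2 * M with hN
  have hM0 : 0 < M := Nat.succ_pos _
  have hN0 : 0 < N := by positivity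
  have hMr : (0 : ℝ) < M := by exact_mod_cast hM0
  have hNr : (N : ℝ) = 2 * M := by rw [hN]; push_cast; ring
  have hpi := Real.pi_pos
  have hMε : Real.pi / M < ε := by
    rw [div_lt_iff₀ hε] at hM'
    rw [div_lt_iff₀ hMr, hM]
    push_cast
    nlinarith
  have hNε : Real.pi / N < ε := by
    refine lt_of_le_of_lt ?_ hMε
    rw [hNr]
    exact div_le_div_of_nonneg_left hpi.le hMr (by linarith)
  set a := circleBump x₀ N
  set a' := circleBumpDeriv x₀ N
  set b := circleBump t₀ M
  set b' := circleBumpDeriv t₀ M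
  have ma : Measurable a := measurable_circleBump x₀
  have ma' : Measurable a' := measurable_circleBumpDeriv x₀
  have mb : Measurable b := measurable_circleBump t₀
  have mb' : Measurable b' := measurable_circleBumpDeriv t₀
  have ba : ∀ x, |a x| ≤ 2 := abs_circleBump_le x₀
  have ba' : ∀ x, |a' x| ≤ (N : ℝ) ^ 2 := abs_circleBumpDeriv_le x₀
  have bb : ∀ x, |b x| ≤ 2 := abs_circleBump_le t₀
  have bb' : ∀ x, |b' x| ≤ (M : ℝ) ^ 2 := abs_circleBumpDeriv_le t₀
  have mulm : ∀ {f g : WaveCircle → ℝ}, Measurable f → Measurable g →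
      Measurable fun z : WaveTorus => f z.1 * g z.2 := fun hf hg =>
    (hf.comp measurable_fst).mul (hg.comp measurable_snd)
  have mulb : ∀ {f g : ℝ} {A B : ℝ}, |f| ≤ A → |g| ≤ B → |f * g| ≤ A * B := fun hf hg => by
    rw [abs_mul]
    exact mul_le_mul hf hg (abs_nonneg _) ((abs_nonneg _).trans hf)
  refine exists_dualForm_pos_of_waveCoeff hp hw hac
    (W := fun z => a z.1 * b' z.2 - a' z.1 * b z.2) (ζ := fun z => a z.1 * b z.2)
    (K := 2 * (M : ℝ) ^ 2 + (N : ℝ) ^ 2 * 2) (K' := 2 * 2)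
    ((mulm ma mb').sub (mulm ma' mb)) (mulm ma mb) (fun z => (abs_sub _ _).trans
      (add_le_add (mulb (ba _) (bb' _)) (mulb (ba' _) (bb _)))) (fun z => mulb (ba _) (bb _)) hc
    ?_ (fun m => ?_) ?_
  · filter_upwards [hcw] with z hz hW
    apply hz
    apply hball
    rw [Metric.mem_ball, Prod.dist_eq]
    by_contra hcon
    apply hW
    rcases le_max_iff.1 (not_lt.1 hcon) with h | h
    · simp only [a, a', circleBump_eq_zero x₀ (hNε.trans_le h),
        circleBumpDeriv_eq_zero x₀ (hNε.trans_le h)]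
      ring
    · simp only [b, b', circleBump_eq_zero t₀ (hMε.trans_le h),
        circleBumpDeriv_eq_zero t₀ (hMε.trans_le h)]
      ring
  · have bd : ∀ {f : WaveCircle → ℝ} {A : ℝ} (k : ℤ), (∀ x, |f x| ≤ A) →
        ∀ x, |f x * circleMode k x| ≤ A * 1 := fun k hf x => mulb (hf x) (abs_circleMode_le_one k x)
    have md : ∀ {f : WaveCircle → ℝ} (k : ℤ), Measurable f → Measurable fun x => f x * circleMode k x :=
      fun k hf => hf.mul (continuous_circleMode k).measurable
    have e1 : ∀ z : WaveTorus, (a z.1 * b' z.2 - a' z.1 * b z.2) * waveMode m z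
        = (a z.1 * circleMode m.1 z.1) * (b' z.2 * circleMode m.2 z.2)
          - (a' z.1 * circleMode m.1 z.1) * (b z.2 * circleMode m.2 z.2) := fun z => by
      rw [waveMode]; ring
    have e2 : ∀ z : WaveTorus, (a z.1 * b z.2) * waveMode m z
        = (a z.1 * circleMode m.1 z.1) * (b z.2 * circleMode m.2 z.2) := fun z => by
      rw [waveMode]; ring
    simp only [e1, e2]
    rw [integral_sub
      (integrable_tensor (md m.1 ma) (md m.2 mb') (bd m.1 ba) (bd m.2 bb'))
      (integrable_tensor (md m.1 ma') (md m.2 mb) (bd m.1 ba') (bd m.2 bb)),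
      integral_tensor (fun x => a x * circleMode m.1 x) (fun x => b' x * circleMode m.2 x),
      integral_tensor (fun x => a' x * circleMode m.1 x) (fun x => b x * circleMode m.2 x),
      integral_tensor (fun x => a x * circleMode m.1 x) (fun x => b x * circleMode m.2 x),
      integral_circleBumpDeriv_mul x₀ hN0, integral_circleBumpDeriv_mul t₀ hM0, waveEigenvalue]
    ring
  · have bd : ∀ {f g : WaveCircle → ℝ} {A B : ℝ}, (∀ x, |f x| ≤ A) → (∀ x, |g x| ≤ B) →
        ∀ x, |f x * g x| ≤ A * B := fun hf hg x => mulb (hf x) (hg x)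
    have md : ∀ {f g : WaveCircle → ℝ}, Measurable f → Measurable g →
        Measurable fun x => f x * g x := fun hf hg => hf.mul hg
    have e1 : ∀ z : WaveTorus, (a z.1 * b' z.2 - a' z.1 * b z.2) * (a z.1 * b z.2)
        = (a z.1 * a z.1) * (b z.2 * b' z.2) - (a z.1 * a' z.1) * (b z.2 * b z.2) := fun z => by
      ring
    simp only [e1]
    rw [integral_sub (integrable_tensor (md ma ma) (md mb mb') (bd ba ba) (bd bb bb'))
      (integrable_tensor (md ma ma') (md mb mb) (bd ba ba') (bd bb bb)),
      integral_tensor (fun x => a x * a x) (fun x => b x * b' x),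
      integral_tensor (fun x => a x * a' x) (fun x => b x * b x),
      integral_circleBump_sq x₀ hN0, integral_circleBump_sq t₀ hM0,
      integral_circleBump_mul_deriv x₀ hN0, integral_circleBump_mul_deriv t₀ hM0, hNr]
    have h : 3 * Real.pi / (2 * M) * -((M : ℝ) * Real.pi) - -(2 * M * Real.pi) * (3 * Real.pi / M)
        = 9 / 2 * Real.pi ^ 2 := by
      field_simp; ring
    rw [h]
    positivity

/-! ### Geometry of the rectangle -/

theorem observableKernel_of_meets {w : WaveTorus → NNReal} (hw : Measurable w)
    {U : Set WaveTorus} (hU : IsOpen U) (hdiag : ∀ z, ∃ s, z + diagDir s ∈ U)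
    (hanti : ∀ z, ∃ r, z + antiDir r ∈ U) {c : ℝ} (hc : 0 < c) (hcw : ∀ᵐ z, z ∈ U → c ≤ w z) :
    ObservableKernel (weightMeasure w) := by
  obtain ⟨C, hC, hobs⟩ := exists_lintegral_le_of_meets hU hdiag hanti
  have hc0 : ENNReal.ofReal c ≠ 0 := by simpa using hc
  refine ⟨C * (ENNReal.ofReal c)⁻¹, ENNReal.mul_ne_top hC (ENNReal.inv_ne_top.2 hc0),
    fun n hn => (hobs n hn).trans ?_⟩
  rw [mul_assoc]
  gcongr
  have h1 : ENNReal.ofReal c * ∫⁻ z in U, ‖n z‖ₑ ^ 2 ≤ ∫⁻ z, ‖n z‖ₑ ^ 2 ∂(weightMeasure w) := by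
    have hm : Measurable fun z => ‖n z‖ₑ ^ 2 := (Lp.stronglyMeasurable n).measurable.enorm.pow_const 2
    rw [weightMeasure, lintegral_withDensity_eq_lintegral_mul _ hw.coe_nnreal_ennreal hm,
      ← lintegral_const_mul _ hm]
    refine le_trans (lintegral_mono_ae ?_) (setLIntegral_le_lintegral U _)
    refine (ae_restrict_iff' hU.measurableSet).2 ?_
    filter_upwards [hcw] with z hz hzU
    rw [Pi.mul_apply]
    gcongr
    exact ENNReal.ofReal_le_of_le_toReal (hz hzU)
  calc ∫⁻ z in U, ‖n z‖ₑ ^ 2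
      = (ENNReal.ofReal c)⁻¹ * (ENNReal.ofReal c * ∫⁻ z in U, ‖n z‖ₑ ^ 2) := by
        rw [← mul_assoc, ENNReal.inv_mul_cancel hc0 ENNReal.ofReal_ne_top, one_mul]
    _ ≤ _ := by gcongr

theorem exists_mem_Ioo_of_sub_lt {α β : ℝ} (h : 2 * Real.pi < β - α) (y : ℝ) :
    ∃ k : ℤ, y + k * (2 * Real.pi) ∈ Set.Ioo α β := by
  have hp := Real.two_pi_pos
  -- The least k with y + 2πk > α strictly; the point then exceeds α by at most 2π, hence stays
  -- below β.
  refine ⟨⌊(α - y) / (2 * Real.pi)⌋ + 1, ?_, ?_⟩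
  · have := Int.lt_floor_add_one ((α - y) / (2 * Real.pi))
    rw [div_lt_iff₀ hp] at this
    push_cast
    linarith
  · have := Int.floor_le ((α - y) / (2 * Real.pi))
    rw [le_div_iff₀ hp] at this
    push_cast
    linarith

theorem coe_add_int_mul (x : ℝ) (k : ℤ) : ((x + k * (2 * Real.pi) : ℝ) : WaveCircle) = x := by
  rw [AddCircle.coe_add, ← zsmul_eq_mul, AddCircle.coe_zsmul, AddCircle.coe_period, smul_zero,
    add_zero]

/-- An antidiagonal line is determined by x + t modulo 2π. On the open rectangle this sum fills an
interval of length greater than 2π, so it takes every residue. -/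
theorem exists_antiDir_mem_rectangle {a₁ b₁ a₂ b₂ : ℝ} (h₁ : a₁ < b₁) (h₂ : a₂ < b₂)
    (h : 2 * Real.pi < b₁ + b₂ - a₁ - a₂) (x t : ℝ) :
    ∃ r : ℝ, ∃ x' ∈ Set.Ioo a₁ b₁, ∃ t' ∈ Set.Ioo a₂ b₂,
      (x' : WaveCircle) = x + r ∧ (t' : WaveCircle) = t - r := by
  obtain ⟨k, hk1, hk2⟩ := exists_mem_Ioo_of_sub_lt (α := a₁ + a₂) (β := b₁ + b₂) (by linarith) (x + t)
  set σ := x + t + k * (2 * Real.pi) with hσ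
  -- Relative position on the rectangle's diagonal from (a₁, a₂) to (b₁, b₂) of the point with
  -- coordinate sum σ.
  set θ := (σ - (a₁ + a₂)) / (b₁ + b₂ - (a₁ + a₂)) with hθ
  have hd : 0 < b₁ + b₂ - (a₁ + a₂) := by linarith
  have hθ0 : 0 < θ := div_pos (by linarith) hd
  have hθ1 : θ < 1 := by rw [hθ, div_lt_one hd]; linarith
  have hθe : θ * (b₁ + b₂ - (a₁ + a₂)) = σ - (a₁ + a₂) := div_mul_cancel₀ _ hd.ne'
  refine ⟨a₁ + θ * (b₁ - a₁) - x, a₁ + θ * (b₁ - a₁), ⟨by nlinarith, by nlinarith⟩,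
    a₂ + θ * (b₂ - a₂), ⟨by nlinarith, by nlinarith⟩, ?_, ?_⟩
  · rw [← AddCircle.coe_add]; congr 1; ring
  · rw [← AddCircle.coe_sub, ← coe_add_int_mul (t - _) k]
    congr 1
    linear_combination hθe

/-- The reflection t ↦ -t exchanges diagonals and antidiagonals and preserves the side lengths. -/
theorem exists_diagDir_mem_rectangle {a₁ b₁ a₂ b₂ : ℝ} (h₁ : a₁ < b₁) (h₂ : a₂ < b₂)
    (h : 2 * Real.pi < b₁ + b₂ - a₁ - a₂) (x t : ℝ) :
    ∃ r : ℝ, ∃ x' ∈ Set.Ioo a₁ b₁, ∃ t' ∈ Set.Ioo a₂ b₂,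
      (x' : WaveCircle) = x + r ∧ (t' : WaveCircle) = t + r := by
  obtain ⟨r, x', hx', t', ht', e1, e2⟩ := exists_antiDir_mem_rectangle h₁ (neg_lt_neg h₂)
    (by linarith) x (-t)
  refine ⟨r, x', hx', -t', ⟨by linarith [ht'.2], by linarith [ht'.1]⟩, e1, ?_⟩
  rw [AddCircle.coe_neg, e2, AddCircle.coe_neg]
  abel

theorem isOpen_rectangle_image (a₁ b₁ a₂ b₂ : ℝ) :
    IsOpen ((fun y : ℝ × ℝ => ((y.1 : WaveCircle), (y.2 : WaveCircle))) ''
      (Set.Ioo a₁ b₁ ×ˢ Set.Ioo a₂ b₂)) :=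
  (QuotientAddGroup.isOpenMap_coe.prodMap QuotientAddGroup.isOpenMap_coe) _
    (isOpen_Ioo.prod isOpen_Ioo)

theorem exists_isWaveGroundState_of_weight {p : ℝ} (hp : 2 < p) {w : WaveTorus → NNReal}
    (hw : Measurable w) {C : NNReal} (hC : ∀ z, w z ≤ C) {Ω : Set WaveTorus}
    (hΩ : ContainsLargeRectangle Ω) (hpos : HasPositiveInfOn (fun z => (w z : ℝ)) Ω) :
    ∃ u : WaveH, IsWaveGroundState p (fun z => (w z : ℝ)) u := by
  obtain ⟨a₁, b₁, a₂, b₂, h₁, h₂, h, hsub⟩ := hΩ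
  obtain ⟨c, hc, hcΩ⟩ := hpos
  have : Fact (1 ≤ ENNReal.ofReal p) := ⟨by rw [ENNReal.one_le_ofReal]; linarith⟩
  have : IsFiniteMeasure (weightMeasure w) := isFiniteMeasure_of_le _ (weightMeasure_le hC)
  have hac : weightMeasure w ≪ volume := absolutelyContinuous_of_le_smul (weightMeasure_le hC)
  set U : Set WaveTorus := (fun y : ℝ × ℝ => ((y.1 : WaveCircle), (y.2 : WaveCircle))) ''
      (Set.Ioo a₁ b₁ ×ˢ Set.Ioo a₂ b₂) with hUdef
  have hU : IsOpen U := isOpen_rectangle_image a₁ b₁ a₂ b₂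
  have hcw : ∀ᵐ z, z ∈ U → c ≤ w z := by
    filter_upwards [hcΩ] with z hz hzU
    obtain ⟨y, hy, rfl⟩ := hzU
    exact hz (hsub _ (Set.Ioo_subset_Icc_self hy.1) _ (Set.Ioo_subset_Icc_self hy.2))
  have hne : U.Nonempty := ((Set.nonempty_Ioo.2 h₁).prod (Set.nonempty_Ioo.2 h₂)).image _
  have hO : ObservableKernel (weightMeasure w) := by
    refine observableKernel_of_meets hw hU (fun z => ?_) (fun z => ?_) hc hcw
    · obtain ⟨x, t⟩ := z
      obtain ⟨x, rfl⟩ := QuotientAddGroup.mk_surjective x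
      obtain ⟨t, rfl⟩ := QuotientAddGroup.mk_surjective t
      obtain ⟨r, x', hx', t', ht', e1, e2⟩ := exists_diagDir_mem_rectangle h₁ h₂ h x t
      exact ⟨r, (x', t'), ⟨hx', ht'⟩, Prod.ext e1 e2⟩
    · obtain ⟨x, t⟩ := z
      obtain ⟨x, rfl⟩ := QuotientAddGroup.mk_surjective x
      obtain ⟨t, rfl⟩ := QuotientAddGroup.mk_surjective t
      obtain ⟨r, x', hx', t', ht', e1, e2⟩ := exists_antiDir_mem_rectangle h₁ h₂ h x t
      exact ⟨r, (x', t'), ⟨hx', ht'⟩, Prod.ext e1 (e2.trans (sub_eq_add_neg _ _))⟩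
  obtain ⟨φ, hφ, hφpos⟩ := exists_dualForm_pos hp hw hac hU hne hc hcw
  exact exists_isWaveGroundState_of_dualForm_pos hp hw hC hac hO hφ hφpos

/-! ### Passage to a bounded representative of q, and conclusion -/

theorem isWaveGroundState_congr {p : ℝ} {q q' : WaveTorus → ℝ} (h : q =ᵐ[volume] q') (u : WaveH) :
    IsWaveGroundState p q u ↔ IsWaveGroundState p q' u := by
  have h1 : waveE p q = waveE p q' := by
    ext v
    have : Integrable (fun z => q z * |v z| ^ p) ↔ Integrable (fun z => q' z * |v z| ^ p) :=
      integrable_congr (h.mono fun z hz => by simp only [hz])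
    simp only [waveE, Set.mem_ofPred_eq, this]
  have h2 : ∀ f : WaveTorus → ℝ, ∫ z, q z * f z = ∫ z, q' z * f z := fun f =>
    integral_congr_ae (h.mono fun z hz => by simp only [hz])
  simp only [IsWaveGroundState, IsWaveWeakSolution, waveEnergy, h1, h2]

/-- A measurable representative is truncated at 0 and at the essential supremum, so that the bounds
hold at every point. -/
theorem exists_weight_ae_eq {q : WaveTorus → ℝ} (hq : MemLp q ⊤ (volume : Measure WaveTorus))
    (hq_nonneg : ∀ᵐ z : WaveTorus, 0 ≤ q z) :
    ∃ (w : WaveTorus → NNReal) (C : NNReal), Measurable w ∧ (∀ z, w z ≤ C) ∧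
      q =ᵐ[volume] fun z => (w z : ℝ) := by
  obtain ⟨hm, hfin⟩ := hq
  rw [eLpNorm_exponent_top] at hfin
  lift eLpNormEssSup q volume to NNReal using hfin.ne with C hC
  refine ⟨fun z => min (hm.aemeasurable.mk q z).toNNReal C, C,
    hm.aemeasurable.measurable_mk.real_toNNReal.min measurable_const, fun z => min_le_right _ _, ?_⟩
  filter_upwards [hm.aemeasurable.ae_eq_mk, hq_nonneg, ae_le_eLpNormEssSup (f := q) (μ := volume)]
    with z h1 h2 h3
  rw [← h1, min_eq_left]
  · exact (Real.coe_toNNReal _ h2).symm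
  · rw [← hC] at h3
    rw [← NNReal.coe_le_coe, Real.coe_toNNReal _ h2]
    have h4 : ‖q z‖₊ ≤ C := ENNReal.coe_le_coe.1 h3
    exact (le_abs_self _).trans (NNReal.coe_le_coe.2 h4)

theorem exists_Icc_subset_of_isOpen {ω : Set WaveCircle} (hω : IsOpen ω) (hne : ω.Nonempty) :
    ∃ a b : ℝ, a < b ∧ ∀ x ∈ Set.Icc a b, (x : WaveCircle) ∈ ω := by
  obtain ⟨x, hx⟩ := hne
  obtain ⟨x, rfl⟩ := QuotientAddGroup.mk_surjective x
  have ho : IsOpen ((fun x : ℝ => (x : WaveCircle)) ⁻¹' ω) :=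
    hω.preimage (AddCircle.continuous_mk' _)
  obtain ⟨ε, hε, hb⟩ := Metric.isOpen_iff.1 ho x hx
  refine ⟨x, x + ε / 2, by linarith, fun y hy => hb ?_⟩
  rw [Metric.mem_ball, Real.dist_eq, abs_lt]
  constructor <;> linarith [hy.1, hy.2]

theorem containsLargeRectangle_prod_univ {ω : Set WaveCircle} (hω : IsOpen ω) (hne : ω.Nonempty) :
    ContainsLargeRectangle (ω ×ˢ Set.univ) := by
  obtain ⟨a, b, hab, hs⟩ := exists_Icc_subset_of_isOpen hω hne
  exact ⟨a, b, 0, 2 * Real.pi, hab, Real.two_pi_pos, by linarith, fun x hx t _ => ⟨hs x hx, trivial⟩⟩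

theorem containsLargeRectangle_univ_prod {ω : Set WaveCircle} (hω : IsOpen ω) (hne : ω.Nonempty) :
    ContainsLargeRectangle (Set.univ ×ˢ ω) := by
  obtain ⟨a, b, hab, hs⟩ := exists_Icc_subset_of_isOpen hω hne
  exact ⟨0, 2 * Real.pi, a, b, Real.two_pi_pos, hab, by linarith, fun x _ t ht => ⟨trivial, hs t ht⟩⟩

end

theorem mainTheorem3 (p : ℝ) (hp : 2 < p) (q : WaveTorus → ℝ)
    (hq : MemLp q ⊤ (volume : Measure WaveTorus))
    (hq_nonneg : ∀ᵐ z : WaveTorus, 0 ≤ q z) :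
    (∀ Ω : Set WaveTorus, ContainsLargeRectangle Ω → HasPositiveInfOn q Ω →
      ∃ u : WaveH, IsWaveGroundState p q u) ∧
    (∀ ω : Set WaveCircle, IsOpen ω → ω.Nonempty →
      (HasPositiveInfOn q (ω ×ˢ Set.univ) ∨ HasPositiveInfOn q (Set.univ ×ˢ ω)) →
      ∃ u : WaveH, IsWaveGroundState p q u) := by
  have main : ∀ Ω : Set WaveTorus, ContainsLargeRectangle Ω → HasPositiveInfOn q Ω →
      ∃ u : WaveH, IsWaveGroundState p q u := by
    intro Ω hΩ ⟨c, hc, hcΩ⟩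
    obtain ⟨w, C, hw, hC, hqw⟩ := exists_weight_ae_eq hq hq_nonneg
    obtain ⟨u, hu⟩ := exists_isWaveGroundState_of_weight hp hw hC hΩ ⟨c, hc, by
      filter_upwards [hcΩ, hqw] with z h1 h2 hz
      exact (h1 hz).trans_eq h2⟩
    exact ⟨u, (isWaveGroundState_congr hqw u).2 hu⟩
  refine ⟨main, fun ω hω hne h => ?_⟩
  rcases h with h | h
  · exact main _ (containsLargeRectangle_prod_univ hω hne) h
  · exact main _ (containsLargeRectangle_univ_prod hω hne) h
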